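/- Let $N\ge 2$, $1\le p<1+\frac2N$, let $\mathbb T^N=[0,1]^N$ be the unit torus, let $u_0\in L^2(\mathbb T^N)$ be real-valued and let $v\in L^\infty\big(\mathbb R_+;L^{\frac{2}{p-1}}(\mathbb T^N;\mathbb R^N)\big)$ (with $\frac{2}{p-1}=\infty$ if $p=1$). Consider $$u_t+v\cdot\nabla u-\Delta u=|u|^p-\int_{\mathbb T^N}|u|^p\,dx\quad\text{on }\mathbb T^N,\qquad u(0)=u_0 .$$ For $T>0$ let $X_T$ be the space of all $u\in C([0,T];L^2(\mathbb T^N))$ with $\nabla u(t)\in L^2(\mathbb T^N)$ for $0<t\le T$ and $\sup_{0<t\le T}t^{1/2}\|\nabla u(t)\|_{L^2}<\infty$. A function $u\in C([0,T];L^2(\mathbb T^N))$ with $\nabla u(t)\in L^2(\mathbb T^N)$ for all $0<t\le T$ is a mild solution on $[0,T]$ if for all $t\in[0,T]$ $$u(t)=e^{t\Delta}u_0+\int_0^t e^{(t-\tau)\Delta}\big(|u(\tau)|^p\big)\,d\tau-\int_0^t e^{(t-\tau)\Delta}\big(v(\tau)\cdot\nabla u(\tau)\big)\,d\tau-\int_0^t\int_{\mathbb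 T^N}|u(\tau)|^p\,dx\,d\tau ,$$ where the integrals in $\tau$ are (convergent) Bochner integrals and $e^{t\Delta}$ is the heat semigroup on $\mathbb T^N$, $\widehat{e^{t\Delta}f}(k)=e^{-4\pi^2|k|^2t}\hat f(k)$ for $k\in\mathbb Z^N$. Let $T^*\in[0,\infty]$ be the supremum of all $T>0$ for which there is a mild solution on $[0,T]$ belonging to $X_T$. Then $T^*>0$, and there is a function $u:[0,T^*)\to L^2(\mathbb T^N)$ that is a mild solution on $[0,T]$ belonging to $X_T$ for every $0<T<T^*$; it is unique, in the sense that every mild solution on some $[0,T]$ belonging to $X_T$ agrees with $u$ on $[0,T)$. If $T^*<\infty$, then $$\limsup_{t\to T^*_-}\|u(t)\|_{L^2}=\infty .$$ Otherwise $T^*=\infty$; in particular, if $\|u(t)\|_{L^2}$ is bounded on $[0,T)$ for every finite $T\le T^*$, then $T^*=\infty$. -/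

import Mathlib

open MeasureTheory Set Filter Topology UnitAddTorus
open scoped ENNReal

noncomputable section

/-- The normalised Lebesgue (Haar) measure on the torus `(ℝ/ℤ)^N = [0,1]^N`. -/
abbrev torusMeasure (N : ℕ) : Measure (UnitAddTorus (Fin N)) :=
  Measure.pi fun _ => AddCircle.haarAddCircle

/-- The space `L²(𝕋^N)` of real-valued functions. -/
abbrev TorusL2 (N : ℕ) : Type :=
  Lp ℝ 2 (torusMeasure N)

/-- The space `L²(𝕋^N; ℝ^N)` of vector fields, with the Euclidean norm on `ℝ^N`. -/
abbrev TorusL2Vec (N : ℕ) : Type :=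
  Lp (EuclideanSpace ℝ (Fin N)) 2 (torusMeasure N)

/-- Fourier coefficient `f̂(k) = ∫ f(x) e^{-2πi k·x} dx` of a real-valued function. -/
def fourierCoef {N : ℕ} (f : UnitAddTorus (Fin N) → ℝ) (k : Fin N → ℤ) : ℂ :=
  mFourierCoeff (fun x => (f x : ℂ)) k

/-- The Fourier coefficients of `e^{tΔ} f`. On `[0,1]^N` the Laplacian multiplies the `k`-th
Fourier mode `e^{2πi k·x}` by `-4π²|k|²`. -/
def heatCoef {N : ℕ} (t : ℝ) (f : UnitAddTorus (Fin N) → ℝ) (k : Fin N → ℤ) : ℂ :=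
  (Real.exp (-(4 * Real.pi ^ 2 * (∑ i, (k i : ℝ) ^ 2) * t)) : ℂ) * fourierCoef f k

open Classical in
/-- The heat semigroup: `heat t f = e^{tΔ} f` is the element of `L²(𝕋^N)` with Fourier
coefficients `e^{-4π²|k|²t} f̂(k)`. These are square summable whenever `t > 0` and `f` is
integrable, and whenever `t = 0` and `f` is in `L²`; in all other cases in which they
are not square summable the value is `0`. The real part only turns the (a.e. real-valued)
complex `L²` function into a real one. -/
def heat {N : ℕ} (t : ℝ) (f : UnitAddTorus (Fin N) → ℝ) : TorusL2 N :=
  if h : Memℓp (heatCoef t f) 2 then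
    Complex.reCLM.compLp
      (mFourierBasis.repr.symm (⟨heatCoef t f, h⟩ : lp (fun _ : Fin N → ℤ => ℂ) 2) :
        Lp ℂ 2 (torusMeasure N))
  else 0

/-- `G ∈ L²` is the (distributional) gradient of `f`: the `k`-th Fourier coefficient of its
`j`-th component is `2πi k_j f̂(k)`. -/
def IsGradient {N : ℕ} (f : TorusL2 N) (G : TorusL2Vec N) : Prop :=
  ∀ (j : Fin N) (k : Fin N → ℤ),
    fourierCoef (fun x => G x j) k = 2 * Real.pi * Complex.I * (k j : ℂ) * fourierCoef f k

/-- `∇ f ∈ L²`. -/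
def HasL2Gradient {N : ℕ} (f : TorusL2 N) : Prop :=
  ∃ G : TorusL2Vec N, IsGradient f G

open Classical in
/-- The gradient of `f` if it lies in `L²` (and `0` otherwise). -/
def l2Gradient {N : ℕ} (f : TorusL2 N) : TorusL2Vec N :=
  if h : HasL2Gradient f then h.choose else 0

/-- The function `|f|^p`. -/
def absPow {N : ℕ} (p : ℝ) (f : TorusL2 N) (x : UnitAddTorus (Fin N)) : ℝ :=
  |f x| ^ p

/-- The function `w · ∇ f`. -/
def advect {N : ℕ} (w : UnitAddTorus (Fin N) → EuclideanSpace ℝ (Fin N)) (f : TorusL2 N)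
    (x : UnitAddTorus (Fin N)) : ℝ :=
  inner ℝ (w x) (l2Gradient f x)

/-- `v ∈ L^∞(ℝ₊; L^q(𝕋^N; ℝ^N))`. -/
def IsLInftyLq {N : ℕ} (q : ℝ≥0∞)
    (v : ℝ → UnitAddTorus (Fin N) → EuclideanSpace ℝ (Fin N)) : Prop :=
  AEStronglyMeasurable (Function.uncurry v)
    ((volume.restrict (Ioi (0 : ℝ))).prod (torusMeasure N)) ∧
  essSup (fun t => eLpNorm (v t) q (torusMeasure N)) (volume.restrict (Ioi (0 : ℝ))) < ⊤

/-- `u` is a mild solution on `[0, T]` of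
`u_t + v · ∇u - Δu = |u|^p - ∫ |u|^p`, `u(0) = u₀`. The integrals in time are Bochner integrals
in `L²` (and a Lebesgue integral for the spatially constant term). -/
structure IsMildSolution {N : ℕ} (p : ℝ)
    (v : ℝ → UnitAddTorus (Fin N) → EuclideanSpace ℝ (Fin N)) (u₀ : TorusL2 N)
    (T : ℝ) (u : ℝ → TorusL2 N) : Prop where
  pos : 0 < T
  continuousOn : ContinuousOn u (Icc 0 T)
  hasGradient : ∀ t ∈ Ioc 0 T, HasL2Gradient (u t)
  integrable_power : ∀ t ∈ Icc 0 T,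
    IntervalIntegrable (fun τ => heat (t - τ) (absPow p (u τ))) volume 0 t
  integrable_advect : ∀ t ∈ Icc 0 T,
    IntervalIntegrable (fun τ => heat (t - τ) (advect (v τ) (u τ))) volume 0 t
  integrable_mean : ∀ t ∈ Icc 0 T,
    IntervalIntegrable (fun τ => ∫ x, absPow p (u τ) x ∂(torusMeasure N)) volume 0 t
  eq : ∀ t ∈ Icc 0 T,
    u t = heat t u₀ + (∫ τ in (0 : ℝ)..t, heat (t - τ) (absPow p (u τ)))
      - (∫ τ in (0 : ℝ)..t, heat (t - τ) (advect (v τ) (u τ)))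
      - Lp.const 2 (torusMeasure N)
          (∫ τ in (0 : ℝ)..t, ∫ x, absPow p (u τ) x ∂(torusMeasure N))

/-- `u ∈ X_T`: `u ∈ C([0,T]; L²)` and `sup_{0<t≤T} t^{1/2} ‖∇u(t)‖_{L²} < ∞`. -/
def MemX {N : ℕ} (T : ℝ) (u : ℝ → TorusL2 N) : Prop :=
  ContinuousOn u (Icc 0 T) ∧ (∀ t ∈ Ioc 0 T, HasL2Gradient (u t)) ∧
    ∃ C : ℝ, ∀ t ∈ Ioc 0 T, t ^ (1 / 2 : ℝ) * ‖l2Gradient (u t)‖ ≤ C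

/-- The maximal time of existence: the supremum in `[0, ∞]` of all `T` such that there is a
mild solution on `[0, T]` belonging to `X_T`. -/
def maximalTime {N : ℕ} (p : ℝ)
    (v : ℝ → UnitAddTorus (Fin N) → EuclideanSpace ℝ (Fin N)) (u₀ : TorusL2 N) : ℝ≥0∞ :=
  sSup {s : ℝ≥0∞ | ∃ (T : ℝ) (u : ℝ → TorusL2 N),
    IsMildSolution p v u₀ T u ∧ MemX T u ∧ s = ENNReal.ofReal T}

end

/-! The condition p < 1 + 2/N says that a = N(p-1)/4 is less than 1/2. From L^{2/p} the heat
semigroup reaches L² at the cost of t^{-a}, and its gradient reaches L² at the cost of t^{-(a+1/2)};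
both powers are integrable at 0. Both nonlinear terms lie in L^{2/p}: u ↦ |u|^p is Lipschitz there
on bounded sets of L², and v·∇u is linear in ∇u and bounded by Hölder, since (p-1)/2 + 1/2 = p/2.
For the pair z = (u, t^{1/2}∇u), Duhamel's formula is therefore a Volterra equation with a weakly
singular kernel of order b = a + 1/2 < 1.

The Lipschitz constant depends on u only through its L² norm. Retracting u radially onto a ball of
radius M makes the kernel globally Lipschitz (`isVolterraKernel_truncatedKernel`). The truncated
equation is solvable on every [0,T], and its bounded solutions are unique, by contraction in an
exponentially weighted sup norm (`IsVolterraKernel.exists_solution`, `IsVolterraKernel.eqOn`). Mild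
solutions in X_T that are bounded by M solve the truncated equation (`IsMildSolution.volterra`);
conversely, a solution of it is mild as long as it stays in the ball (`isMildSolution_of_volterra`).

Local existence takes M = ‖u₀‖ + 1. Uniqueness takes M above both solutions. If u is bounded by M up
to a finite T, then the truncated solution at level M + 1 on [0,T+1] equals u before T and, by
continuity, stays in the ball for a while after T, so T < T*.

The smoothing estimates are proved on the Fourier side: `sum_multiplier_sq_le` obtains them by
duality from a Gaussian bound for the sum of the squares of e^{-λ_k t}, where λ_k = 4π²|k|². -/

noncomputable section

/-! ### Parseval coordinates: a common interface for scalar functions and vector fields. -/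

/-- Complex coordinates on a real normed space for which Parseval's identity holds. -/
structure ParsevalCoords (E : Type*) [NormedAddCommGroup E] [NormedSpace ℝ E] (ι : Type*) where
  coord : ι → E →L[ℝ] ℂ
  parseval : ∀ x, HasSum (fun i => ‖coord i x‖ ^ 2) (‖x‖ ^ 2)

namespace ParsevalCoords

variable {E : Type*} [NormedAddCommGroup E] [NormedSpace ℝ E] {ι : Type*}
  (c : ParsevalCoords E ι)

include c in
theorem ext {x y : E} (h : ∀ i, c.coord i x = c.coord i y) : x = y := by
  have h1 := c.parseval (x - y)
  have h2 : (fun i => ‖c.coord i (x - y)‖ ^ 2) = fun _ => 0 := by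
    funext i; simp [h i]
  rw [h2] at h1
  have h3 := h1.unique hasSum_zero
  exact sub_eq_zero.1 (norm_eq_zero.1 (pow_eq_zero_iff (two_ne_zero) |>.1 h3))

include c in
theorem norm_le_of_sum_le {x : E} {B : ℝ} (hB : 0 ≤ B)
    (h : ∀ s : Finset ι, ∑ i ∈ s, ‖c.coord i x‖ ^ 2 ≤ B ^ 2) : ‖x‖ ≤ B := by
  have h1 : ‖x‖ ^ 2 ≤ B ^ 2 := le_of_tendsto' (c.parseval x) h
  exact (sq_le_sq₀ (norm_nonneg _) hB).1 h1

theorem memℓp (x : E) : Memℓp (fun i => c.coord i x) 2 := by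
  refine (memℓp_gen_iff (by norm_num)).2 ?_
  simpa using (c.parseval x).summable

/-- The isometric embedding into `ℓ²` given by the coordinates. -/
def toLp (x : E) : lp (fun _ : ι => ℂ) 2 := ⟨fun i => c.coord i x, c.memℓp x⟩

theorem isometry_toLp : Isometry c.toLp := by
  refine Isometry.of_dist_eq fun x y => ?_
  have h1 := lp.hasSum_norm (p := 2) (by norm_num) (c.toLp x - c.toLp y)
  have h2 := c.parseval (x - y)
  have h3 : ‖c.toLp x - c.toLp y‖ ^ 2 = ‖x - y‖ ^ 2 := by
    refine HasSum.unique (f := fun i => ‖c.coord i (x - y)‖ ^ 2) ?_ h2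
    have h4 : (fun i => ‖c.coord i (x - y)‖ ^ 2) =
        fun i => ‖(c.toLp x - c.toLp y) i‖ ^ (2 : ℝ≥0∞).toReal := by
      funext i
      rw [map_sub, ENNReal.toReal_ofNat, Real.rpow_ofNat]
      rfl
    rw [h4]
    simpa using h1
  rw [dist_eq_norm, dist_eq_norm]
  exact (sq_eq_sq₀ (norm_nonneg _) (norm_nonneg _)).1 h3

/-- The isometric embedding into `ℓ²` reduces measurability to that of the finite partial sums,
which converge pointwise. -/
theorem aestronglyMeasurable [Countable ι] {α : Type*} [MeasurableSpace α] {μ : Measure α}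
    {g : α → E} (h : ∀ i, AEStronglyMeasurable (fun a => c.coord i (g a)) μ) :
    AEStronglyMeasurable g μ := by
  classical
  refine (c.isometry_toLp.isEmbedding.aestronglyMeasurable_comp_iff).1 ?_
  refine aestronglyMeasurable_of_tendsto_ae (atTop : Filter (Finset ι))
    (f := fun s a => ∑ i ∈ s, lp.single 2 i (c.coord i (g a))) (fun s => ?_) ?_
  · refine Finset.aestronglyMeasurable_fun_sum s fun i _ => ?_
    exact (lp.isometry_single (E := fun _ : ι => ℂ) (p := 2) i).continuous.comp_aestronglyMeasurable
      (h i)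
  · refine Eventually.of_forall fun a => ?_
    exact lp.hasSum_single (p := 2) (by norm_num) (c.toLp (g a))

-- A square-summable majorant of the coordinates allows dominated convergence in Parseval's sum for
-- ‖g x - g a‖².
include c in
theorem continuousWithinAt {X : Type*} [TopologicalSpace X] {g : X → E} {s : Set X} {a : X}
    {B : ι → ℝ} (hB : Summable fun i => B i ^ 2)
    (hc : ∀ i, ContinuousWithinAt (fun x => c.coord i (g x)) s a)
    (hle : ∀ᶠ x in 𝓝[s] a, ∀ i, ‖c.coord i (g x)‖ ≤ B i) (ha : ∀ i, ‖c.coord i (g a)‖ ≤ B i) :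
    ContinuousWithinAt g s a := by
  have h1 : Tendsto (fun x => ∑' i, ‖c.coord i (g x - g a)‖ ^ 2) (𝓝[s] a)
      (𝓝 (∑' _ : ι, (0 : ℝ))) := by
    refine tendsto_tsum_of_dominated_convergence (bound := fun i => 4 * B i ^ 2)
      (hB.mul_left 4) (fun i => ?_) ?_
    · have h2 := ((hc i).tendsto.sub_const (c.coord i (g a))).norm.pow 2
      simpa using h2
    · filter_upwards [hle] with x hx i
      have h3 : ‖c.coord i (g x - g a)‖ ≤ 2 * B i := by
        rw [map_sub]
        exact (norm_sub_le _ _).trans (by linarith [hx i, ha i])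
      rw [Real.norm_of_nonneg (by positivity)]
      calc ‖c.coord i (g x - g a)‖ ^ 2 ≤ (2 * B i) ^ 2 := by gcongr
        _ = 4 * B i ^ 2 := by ring
  simp_rw [fun x => (c.parseval (g x - g a)).tsum_eq, tsum_zero] at h1
  rw [ContinuousWithinAt, tendsto_iff_norm_sub_tendsto_zero]
  have h4 := h1.sqrt
  simpa [Real.sqrt_sq] using h4

end ParsevalCoords

/-! ### Fourier coefficients on the torus. -/

variable {N : ℕ}

/-- The Hilbert basis of exponentials of `L²(𝕋^N; ℂ)`. -/
def torusBasis (N : ℕ) : HilbertBasis (Fin N → ℤ) ℂ (Lp ℂ 2 (torusMeasure N)) := mFourierBasis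

theorem torusBasis_repr (f : Lp ℂ 2 (torusMeasure N)) (k : Fin N → ℤ) :
    (torusBasis N).repr f k = mFourierCoeff f k := mFourierBasis_repr f k

theorem mFourierCoeff_eq_integral_torus (f : UnitAddTorus (Fin N) → ℂ) (k : Fin N → ℤ) :
    mFourierCoeff f k = ∫ x, mFourier (-k) x * f x ∂(torusMeasure N) := rfl

theorem fourierCoef_eq_integral (f : UnitAddTorus (Fin N) → ℝ) (k : Fin N → ℤ) :
    fourierCoef f k = ∫ x, mFourier (-k) x * (f x : ℂ) ∂(torusMeasure N) := rfl

theorem fourierCoef_congr {f g : UnitAddTorus (Fin N) → ℝ} (h : f =ᵐ[torusMeasure N] g) :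
    fourierCoef f = fourierCoef g := by
  funext k
  rw [fourierCoef_eq_integral, fourierCoef_eq_integral]
  refine integral_congr_ae ?_
  filter_upwards [h] with x hx
  rw [hx]

/-- The inclusion of real-valued into complex-valued square integrable functions. -/
def complexify (N : ℕ) : TorusL2 N →L[ℝ] Lp ℂ 2 (torusMeasure N) :=
  Complex.ofRealCLM.compLpL 2 (torusMeasure N)

theorem coeFn_complexify (f : TorusL2 N) :
    complexify N f =ᵐ[torusMeasure N] fun x => (f x : ℂ) :=
  Complex.ofRealCLM.coeFn_compLpL f

theorem norm_complexify (f : TorusL2 N) : ‖complexify N f‖ = ‖f‖ := by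
  rw [Lp.norm_def, Lp.norm_def]
  congr 1
  refine eLpNorm_congr_norm_ae ?_
  filter_upwards [coeFn_complexify f] with x hx
  rw [hx]; simp

/-- The `k`-th Fourier coefficient as a continuous functional on `L²`. -/
def fourierCLM (k : Fin N → ℤ) : TorusL2 N →L[ℝ] ℂ :=
  ((innerSL ℂ (torusBasis N k)).restrictScalars ℝ).comp (complexify N)

theorem fourierCLM_eq_repr (k : Fin N → ℤ) (f : TorusL2 N) :
    fourierCLM k f = (torusBasis N).repr (complexify N f) k := by
  rw [HilbertBasis.repr_apply_apply]; rfl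

theorem fourierCLM_apply (k : Fin N → ℤ) (f : TorusL2 N) : fourierCLM k f = fourierCoef f k := by
  rw [fourierCLM_eq_repr, torusBasis_repr, mFourierCoeff_eq_integral_torus, fourierCoef_eq_integral]
  refine integral_congr_ae ?_
  filter_upwards [coeFn_complexify f] with x hx
  rw [hx]

/-- Fourier coefficients on `L²(𝕋^N)`. -/
def scalarCoords (N : ℕ) : ParsevalCoords (TorusL2 N) (Fin N → ℤ) where
  coord := fourierCLM
  parseval f := by
    have h := lp.hasSum_norm (p := 2) (by norm_num) ((torusBasis N).repr (complexify N f))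
    simp only [← fourierCLM_eq_repr, LinearIsometryEquiv.norm_map, norm_complexify] at h
    simpa using h

theorem scalarCoords_coord (k : Fin N → ℤ) (f : TorusL2 N) :
    (scalarCoords N).coord k f = fourierCoef f k := fourierCLM_apply k f

/-- The `j`-th component of a vector field. -/
def component (j : Fin N) : TorusL2Vec N →L[ℝ] TorusL2 N :=
  (EuclideanSpace.proj (𝕜 := ℝ) j : EuclideanSpace ℝ (Fin N) →L[ℝ] ℝ).compLpL 2 (torusMeasure N)

theorem coeFn_component (j : Fin N) (G : TorusL2Vec N) :
    component j G =ᵐ[torusMeasure N] fun x => G x j :=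
  (EuclideanSpace.proj (𝕜 := ℝ) j : EuclideanSpace ℝ (Fin N) →L[ℝ] ℝ).coeFn_compLpL G

theorem norm_sq_eq_integral {F : Type*} [NormedAddCommGroup F] (f : Lp F 2 (torusMeasure N)) :
    ‖f‖ ^ 2 = ∫ x, ‖f x‖ ^ 2 ∂(torusMeasure N) := by
  have h := (Lp.memLp f).eLpNorm_eq_integral_rpow_norm two_ne_zero ENNReal.ofNat_ne_top
  rw [Lp.norm_def, h, ENNReal.toReal_ofReal (by positivity)]
  simp only [ENNReal.toReal_ofNat, Real.rpow_ofNat]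
  rw [← Real.rpow_natCast, ← Real.rpow_mul (by positivity)]
  simp

theorem norm_sq_eq_sum_component (G : TorusL2Vec N) :
    ‖G‖ ^ 2 = ∑ j, ‖component j G‖ ^ 2 := by
  simp_rw [norm_sq_eq_integral]
  rw [← integral_finsetSum]
  · refine integral_congr_ae ?_
    have h : ∀ᵐ x ∂(torusMeasure N), ∀ j, component j G x = G x j :=
      ae_all_iff.2 fun j => coeFn_component j G
    filter_upwards [h] with x hx
    simp [hx, EuclideanSpace.norm_sq_eq]
  · intro j _
    exact (Lp.memLp (component j G)).integrable_norm_pow two_ne_zero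

/-- Fourier coefficients of the components on `L²(𝕋^N; ℝ^N)`. -/
def vectorCoords (N : ℕ) : ParsevalCoords (TorusL2Vec N) (Fin N × (Fin N → ℤ)) where
  coord i := (fourierCLM i.2).comp (component i.1)
  parseval G := by
    rw [norm_sq_eq_sum_component]
    have h (j : Fin N) := (scalarCoords N).parseval (component j G)
    have hs : Summable fun i : Fin N × (Fin N → ℤ) => ‖fourierCLM i.2 (component i.1 G)‖ ^ 2 :=
      (summable_prod_of_nonneg fun i => by positivity).2
        ⟨fun j => (h j).summable, (hasSum_fintype _).summable⟩
    refine (hs.hasSum_iff).2 ?_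
    rw [hs.tsum_prod, tsum_fintype]
    exact Finset.sum_congr rfl fun j _ => (h j).tsum_eq

theorem vectorCoords_coord (i : Fin N × (Fin N → ℤ)) (G : TorusL2Vec N) :
    (vectorCoords N).coord i G = fourierCoef (fun x => G x i.1) i.2 := by
  change fourierCLM i.2 (component i.1 G) = _
  rw [fourierCLM_apply, fourierCoef_congr (coeFn_component i.1 G)]


theorem integrable_mFourier_mul {f : UnitAddTorus (Fin N) → ℂ} (hf : Integrable f (torusMeasure N))
    (k : Fin N → ℤ) : Integrable (fun x => mFourier k x * f x) (torusMeasure N) :=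
  hf.bdd_mul (mFourier k).continuous.aestronglyMeasurable
    (Eventually.of_forall fun x => (ContinuousMap.norm_coe_le_norm _ x).trans mFourier_norm.le)

theorem integrable_mFourier_mul_ofReal {f : UnitAddTorus (Fin N) → ℝ}
    (hf : Integrable f (torusMeasure N)) (k : Fin N → ℤ) :
    Integrable (fun x => mFourier k x * (f x : ℂ)) (torusMeasure N) :=
  integrable_mFourier_mul (f := fun x => (f x : ℂ)) hf.ofReal k

theorem norm_mFourier_apply (k : Fin N → ℤ) (x : UnitAddTorus (Fin N)) : ‖mFourier k x‖ = 1 := by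
  simp only [mFourier, fourier_apply, ContinuousMap.coe_mk, norm_prod, Circle.norm_coe,
    Finset.prod_const_one]

theorem fourierCoef_neg (f : UnitAddTorus (Fin N) → ℝ) (k : Fin N → ℤ) :
    fourierCoef f (-k) = (starRingEnd ℂ) (fourierCoef f k) := by
  rw [fourierCoef_eq_integral, fourierCoef_eq_integral, ← integral_conj]
  refine integral_congr_ae (Eventually.of_forall fun x => ?_)
  simp [mFourier_neg]

theorem fourierCoef_sub {f g : UnitAddTorus (Fin N) → ℝ} (hf : Integrable f (torusMeasure N))
    (hg : Integrable g (torusMeasure N)) (k : Fin N → ℤ) :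
    fourierCoef (fun x => f x - g x) k = fourierCoef f k - fourierCoef g k := by
  simp_rw [fourierCoef_eq_integral]
  rw [← integral_sub (integrable_mFourier_mul_ofReal hf _) (integrable_mFourier_mul_ofReal hg _)]
  refine integral_congr_ae (Eventually.of_forall fun x => ?_)
  push_cast
  ring

theorem norm_fourierCoef_le (f : UnitAddTorus (Fin N) → ℝ) (k : Fin N → ℤ) :
    ‖fourierCoef f k‖ ≤ ∫ x, ‖f x‖ ∂(torusMeasure N) := by
  rw [fourierCoef_eq_integral]
  refine (norm_integral_le_integral_norm _).trans_eq ?_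
  refine integral_congr_ae (Eventually.of_forall fun x => ?_)
  simp [norm_mFourier_apply]

/-- The real part of the function with given square summable Fourier coefficients. -/
def ofCoef (c : (Fin N → ℤ) → ℂ) (h : Memℓp c 2) : TorusL2 N :=
  Complex.reCLM.compLp ((torusBasis N).repr.symm (⟨c, h⟩ : lp (fun _ : Fin N → ℤ => ℂ) 2))

/-- Re g = (g + ḡ)/2, so its coefficient at k is the mean of c_k and the conjugate of c_{-k}, which
the symmetry makes equal. Hence the real part taken in `heat` loses nothing. -/
theorem fourierCoef_ofCoef {c : (Fin N → ℤ) → ℂ} (h : Memℓp c 2)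
    (hc : ∀ k, c (-k) = (starRingEnd ℂ) (c k)) (k : Fin N → ℤ) :
    fourierCoef (ofCoef c h) k = c k := by
  set g := (torusBasis N).repr.symm (⟨c, h⟩ : lp (fun _ : Fin N → ℤ => ℂ) 2) with hg
  have hgk (k : Fin N → ℤ) : ∫ x, mFourier (-k) x * g x ∂(torusMeasure N) = c k := by
    rw [← mFourierCoeff_eq_integral_torus, ← torusBasis_repr, hg,
      LinearIsometryEquiv.apply_symm_apply]
  have hgi : Integrable g (torusMeasure N) := (Lp.memLp g).integrable (by norm_num)
  have h1 : fourierCoef (ofCoef c h) k =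
      ∫ x, (2⁻¹ * (mFourier (-k) x * g x) + 2⁻¹ * (starRingEnd ℂ) (mFourier k x * g x))
        ∂(torusMeasure N) := by
    rw [fourierCoef_eq_integral]
    refine integral_congr_ae ?_
    filter_upwards [Complex.reCLM.coeFn_compLp g] with x hx
    have h2 : ((ofCoef c h x : ℝ) : ℂ) = (g x + (starRingEnd ℂ) (g x)) / 2 := by
      rw [ofCoef, hx, Complex.reCLM_apply, Complex.re_eq_add_conj]
    rw [h2, map_mul, ← mFourier_neg]
    ring
  have h3 := integrable_mFourier_mul hgi k
  rw [h1, integral_add ((integrable_mFourier_mul hgi _).const_mul _), integral_const_mul,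
    integral_const_mul, integral_conj, hgk]
  · have h4 := hgk (-k)
    rw [neg_neg] at h4
    rw [h4, hc, Complex.conj_conj]
    ring
  · exact (Complex.conjCLE.toContinuousLinearMap.integrable_comp h3).const_mul _

theorem heat_eq_ofCoef {t : ℝ} {f : UnitAddTorus (Fin N) → ℝ} (h : Memℓp (heatCoef t f) 2) :
    heat t f = ofCoef (heatCoef t f) h := by
  rw [heat, dif_pos h]; rfl

theorem heatCoef_neg (t : ℝ) (f : UnitAddTorus (Fin N) → ℝ) (k : Fin N → ℤ) :
    heatCoef t f (-k) = (starRingEnd ℂ) (heatCoef t f k) := by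
  simp only [heatCoef, fourierCoef_neg, map_mul, Complex.conj_ofReal, Pi.neg_apply, Int.cast_neg,
    neg_sq]

theorem fourierCoef_heat {t : ℝ} {f : UnitAddTorus (Fin N) → ℝ} (h : Memℓp (heatCoef t f) 2)
    (k : Fin N → ℤ) : fourierCoef (heat t f) k = heatCoef t f k := by
  rw [heat_eq_ofCoef h, fourierCoef_ofCoef h (heatCoef_neg t f)]

/-- The `j`-th coordinate vector field multiplied by a scalar function. -/
def coordinateField (j : Fin N) : TorusL2 N →L[ℝ] TorusL2Vec N :=
  ((ContinuousLinearMap.id ℝ ℝ).smulRight (EuclideanSpace.single j (1 : ℝ))).compLpL 2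
    (torusMeasure N)

theorem component_coordinateField (i j : Fin N) (f : TorusL2 N) :
    component i (coordinateField j f) = if i = j then f else 0 := by
  have h := ((ContinuousLinearMap.id ℝ ℝ).smulRight (EuclideanSpace.single j (1 : ℝ))).coeFn_compLpL
    (p := 2) (μ := torusMeasure N) f
  refine Lp.ext ?_
  split_ifs with hij
  · filter_upwards [coeFn_component i (coordinateField j f), h] with x hx h'
    rw [hx, coordinateField, h']
    simp [hij]
  · filter_upwards [coeFn_component i (coordinateField j f), h,
      Lp.coeFn_zero ℝ 2 (torusMeasure N)] with x hx h' h0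
    rw [hx, coordinateField, h', h0]
    simp [hij]

theorem exists_vector_of_component (f : Fin N → TorusL2 N) :
    ∃ G : TorusL2Vec N, ∀ j, component j G = f j := by
  refine ⟨∑ i, coordinateField i (f i), fun j => ?_⟩
  simp [map_sum, component_coordinateField]

end

/-! ### Gradients and the heat semigroup on the Fourier side. -/

noncomputable section

variable {N : ℕ}

theorem IsGradient.unique {f : TorusL2 N} {G G' : TorusL2Vec N} (h : IsGradient f G)
    (h' : IsGradient f G') : G = G' := by
  refine (vectorCoords N).ext fun i => ?_
  rw [vectorCoords_coord, vectorCoords_coord, h i.1 i.2, h' i.1 i.2]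

theorem IsGradient.l2Gradient_eq {f : TorusL2 N} {G : TorusL2Vec N} (h : IsGradient f G) :
    l2Gradient f = G := by
  have h' : HasL2Gradient f := ⟨G, h⟩
  rw [l2Gradient, dif_pos h']
  exact h'.choose_spec.unique h

theorem HasL2Gradient.isGradient {f : TorusL2 N} (h : HasL2Gradient f) :
    IsGradient f (l2Gradient f) := by
  rw [l2Gradient, dif_pos h]
  exact h.choose_spec

theorem isGradient_iff {f : TorusL2 N} {G : TorusL2Vec N} : IsGradient f G ↔
    ∀ i, (vectorCoords N).coord i G =
      2 * Real.pi * Complex.I * (i.2 i.1 : ℂ) * (scalarCoords N).coord i.2 f := by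
  simp only [vectorCoords_coord, scalarCoords_coord, IsGradient, Prod.forall]

theorem IsGradient.add {f g : TorusL2 N} {F G : TorusL2Vec N} (hf : IsGradient f F)
    (hg : IsGradient g G) : IsGradient (f + g) (F + G) := by
  rw [isGradient_iff] at *
  intro i
  rw [map_add, map_add, hf i, hg i, mul_add]

theorem IsGradient.sub {f g : TorusL2 N} {F G : TorusL2Vec N} (hf : IsGradient f F)
    (hg : IsGradient g G) : IsGradient (f - g) (F - G) := by
  rw [isGradient_iff] at *
  intro i
  rw [map_sub, map_sub, hf i, hg i, mul_sub]

/-- The gradient is a closed operator: Fourier coefficients are continuous functionals and commute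
with Bochner integrals. This is how Duhamel's formula gets differentiated. -/
theorem IsGradient.integral {α : Type*} [MeasurableSpace α] {μ : Measure α} {f : α → TorusL2 N}
    {F : α → TorusL2Vec N} (hf : Integrable f μ) (hF : Integrable F μ)
    (h : ∀ᵐ a ∂μ, IsGradient (f a) (F a)) : IsGradient (∫ a, f a ∂μ) (∫ a, F a ∂μ) := by
  rw [isGradient_iff]
  intro i
  rw [← ContinuousLinearMap.integral_comp_comm _ hf, ← ContinuousLinearMap.integral_comp_comm _ hF,
    ← integral_const_mul]
  refine integral_congr_ae ?_
  filter_upwards [h] with a ha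
  exact isGradient_iff.1 ha i

/-- The eigenvalue `4π²|k|²` of `-Δ`. -/
def laplaceEigenvalue (k : Fin N → ℤ) : ℝ := 4 * Real.pi ^ 2 * ∑ i, (k i : ℝ) ^ 2

theorem laplaceEigenvalue_nonneg (k : Fin N → ℤ) : 0 ≤ laplaceEigenvalue k := by
  unfold laplaceEigenvalue; positivity

theorem heatCoef_eq (t : ℝ) (f : UnitAddTorus (Fin N) → ℝ) (k : Fin N → ℤ) :
    heatCoef t f k = (Real.exp (-(laplaceEigenvalue k * t)) : ℂ) * fourierCoef f k := rfl

theorem norm_heatCoef (t : ℝ) (f : UnitAddTorus (Fin N) → ℝ) (k : Fin N → ℤ) :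
    ‖heatCoef t f k‖ = Real.exp (-(laplaceEigenvalue k * t)) * ‖fourierCoef f k‖ := by
  rw [heatCoef_eq, norm_mul, Complex.norm_real, Real.norm_of_nonneg (Real.exp_pos _).le]

theorem heatCoef_zero (f : UnitAddTorus (Fin N) → ℝ) : heatCoef 0 f = fourierCoef f := by
  funext k
  simp [heatCoef_eq]

theorem norm_heatCoef_le_of_le {s t : ℝ} (hst : s ≤ t) (f : UnitAddTorus (Fin N) → ℝ)
    (k : Fin N → ℤ) : ‖heatCoef t f k‖ ≤ ‖heatCoef s f k‖ := by
  rw [norm_heatCoef, norm_heatCoef]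
  have := laplaceEigenvalue_nonneg k
  gcongr

/-- The Fourier coefficients of the components of `∇ e^{tΔ} f`. -/
def gradHeatCoef (t : ℝ) (f : UnitAddTorus (Fin N) → ℝ) (i : Fin N × (Fin N → ℤ)) : ℂ :=
  2 * Real.pi * Complex.I * (i.2 i.1 : ℂ) * heatCoef t f i.2

theorem norm_gradHeatCoef_le_of_le {s t : ℝ} (hst : s ≤ t) (f : UnitAddTorus (Fin N) → ℝ)
    (i : Fin N × (Fin N → ℤ)) : ‖gradHeatCoef t f i‖ ≤ ‖gradHeatCoef s f i‖ := by
  rw [gradHeatCoef, gradHeatCoef, norm_mul, norm_mul (2 * _ * _ * _)]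
  gcongr
  exact norm_heatCoef_le_of_le hst f i.2

theorem sum_gradHeatCoef_sq (t : ℝ) (f : UnitAddTorus (Fin N) → ℝ) (k : Fin N → ℤ) :
    ∑ j, ‖gradHeatCoef t f (j, k)‖ ^ 2 = laplaceEigenvalue k * ‖heatCoef t f k‖ ^ 2 := by
  simp only [gradHeatCoef, norm_mul, mul_pow, laplaceEigenvalue, Finset.mul_sum, Finset.sum_mul,
    Complex.norm_I, Complex.norm_real, Complex.norm_ofNat, Complex.norm_intCast,
    Real.norm_of_nonneg Real.pi_pos.le, sq_abs]
  refine Finset.sum_congr rfl fun j _ => ?_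
  ring

/-- This is x ≤ eˣ at x = λt: half of the decay e^{-2λt} pays for the factor λ, the other half is
kept as the heat flow at time t/2. -/
theorem laplaceEigenvalue_mul_heatCoef_le {t : ℝ} (ht : 0 < t) (f : UnitAddTorus (Fin N) → ℝ)
    (k : Fin N → ℤ) :
    laplaceEigenvalue k * ‖heatCoef t f k‖ ^ 2 ≤ t⁻¹ * ‖heatCoef (t / 2) f k‖ ^ 2 := by
  rw [norm_heatCoef, norm_heatCoef, mul_pow, mul_pow, ← mul_assoc, ← mul_assoc]
  refine mul_le_mul_of_nonneg_right ?_ (by positivity)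
  set l := laplaceEigenvalue k
  have h1 : l * t ≤ Real.exp (l * t) := (by linarith : l * t ≤ l * t + 1).trans (Real.add_one_le_exp _)
  have h2 : Real.exp (-(l * (t / 2))) ^ 2 = Real.exp (l * t) * Real.exp (-(l * t)) ^ 2 := by
    rw [← Real.exp_nat_mul, ← Real.exp_nat_mul, ← Real.exp_add]
    congr 1; push_cast; ring
  rw [h2, ← mul_assoc]
  refine mul_le_mul_of_nonneg_right ?_ (by positivity)
  rw [inv_mul_eq_div, le_div_iff₀ ht]
  exact h1

theorem sum_gradHeatCoef_sq_le {t : ℝ} (ht : 0 < t) {f : UnitAddTorus (Fin N) → ℝ} {B : ℝ}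
    (hB : ∀ s : Finset (Fin N → ℤ), ∑ k ∈ s, ‖heatCoef (t / 2) f k‖ ^ 2 ≤ B)
    (s : Finset (Fin N × (Fin N → ℤ))) : ∑ i ∈ s, ‖gradHeatCoef t f i‖ ^ 2 ≤ t⁻¹ * B := by
  classical
  calc ∑ i ∈ s, ‖gradHeatCoef t f i‖ ^ 2
      ≤ ∑ i ∈ Finset.univ ×ˢ s.image Prod.snd, ‖gradHeatCoef t f i‖ ^ 2 := by
        refine Finset.sum_le_sum_of_subset_of_nonneg (fun i hi => ?_) fun _ _ _ => by positivity
        exact Finset.mem_product.2 ⟨Finset.mem_univ _, Finset.mem_image_of_mem _ hi⟩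
    _ = ∑ k ∈ s.image Prod.snd, laplaceEigenvalue k * ‖heatCoef t f k‖ ^ 2 := by
        rw [Finset.sum_product_right]
        exact Finset.sum_congr rfl fun k _ => sum_gradHeatCoef_sq t f k
    _ ≤ ∑ k ∈ s.image Prod.snd, t⁻¹ * ‖heatCoef (t / 2) f k‖ ^ 2 :=
        Finset.sum_le_sum fun k _ => laplaceEigenvalue_mul_heatCoef_le ht f k
    _ ≤ t⁻¹ * B := by
        rw [← Finset.mul_sum]
        gcongr
        exact hB _

/-- The terms decrease in |k|, so each half of the sum is at most the half-line Gaussian integral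
√(π/c)/2; the 1 is the term k = 0. -/
theorem sum_Icc_exp_neg_sq_le {c : ℝ} (hc : 0 < c) (n : ℕ) :
    ∑ k ∈ Finset.Icc (-(n : ℤ)) n, Real.exp (-c * (k : ℝ) ^ 2) ≤ 1 + √(Real.pi / c) := by
  have h1 : ∑ i ∈ Finset.range n, Real.exp (-c * ((i + 1 : ℕ) : ℝ) ^ 2) ≤ √(Real.pi / c) / 2 := by
    have hanti : AntitoneOn (fun x : ℝ => Real.exp (-c * x ^ 2)) (Icc (0 : ℝ) (0 + n)) := by
      intro x hx y _ hxy
      have := hx.1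
      simp only [neg_mul, Real.exp_le_exp, neg_le_neg_iff]
      gcongr
    have h2 := hanti.sum_le_integral
    simp only [zero_add] at h2
    refine h2.trans ?_
    rw [intervalIntegral.integral_of_le (by positivity), ← integral_gaussian_Ioi c]
    exact setIntegral_mono_set (integrable_exp_neg_mul_sq hc).integrableOn
      (Eventually.of_forall fun x => (Real.exp_pos _).le) (Ioc_subset_Ioi_self).eventuallyLE
  have h3 : ∀ n : ℕ, ∑ k ∈ Finset.Icc (-(n : ℤ)) n, Real.exp (-c * (k : ℝ) ^ 2) =
      1 + 2 * ∑ i ∈ Finset.range n, Real.exp (-c * ((i + 1 : ℕ) : ℝ) ^ 2) := by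
    intro n
    induction n with
    | zero => simp
    | succ n ih =>
      have h4 : Finset.Icc (-((n + 1 : ℕ) : ℤ)) (n + 1 : ℕ) =
          insert (-((n : ℤ) + 1)) (insert ((n : ℤ) + 1) (Finset.Icc (-(n : ℤ)) n)) := by
        ext k
        simp only [Finset.mem_Icc, Finset.mem_insert]
        omega
      rw [h4, Finset.sum_insert, Finset.sum_insert, ih, Finset.sum_range_succ]
      · push_cast; ring_nf
      · simp
      · simp only [Finset.mem_insert, Finset.mem_Icc]; omega
  rw [h3]
  linarith

/-- Over a cube the sum factorises into N one-dimensional Gaussian sums. This is where the dimension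
enters the smoothing exponent. -/
theorem sum_exp_laplaceEigenvalue_sq_le {t : ℝ} (ht : 0 < t) (s : Finset (Fin N → ℤ)) :
    ∑ k ∈ s, Real.exp (-(laplaceEigenvalue k * t)) ^ 2 ≤ (1 + t ^ (-(1 / 2) : ℝ)) ^ N := by
  classical
  obtain ⟨n, hn⟩ : ∃ n : ℕ, s ⊆ Fintype.piFinset fun _ => Finset.Icc (-(n : ℤ)) n := by
    refine ⟨s.sup fun k => Finset.univ.sup fun i => (k i).natAbs, fun k hk => ?_⟩
    rw [Fintype.mem_piFinset]
    intro i
    have h1 : (k i).natAbs ≤ s.sup fun k => Finset.univ.sup fun i => (k i).natAbs :=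
      (Finset.le_sup (f := fun i => (k i).natAbs) (Finset.mem_univ i)).trans
        (Finset.le_sup (f := fun k : Fin N → ℤ => Finset.univ.sup fun i => (k i).natAbs) hk)
    rw [Finset.mem_Icc]
    omega
  set c := 8 * Real.pi ^ 2 * t with hc
  have hcpos : 0 < c := by positivity
  have h2 (k : Fin N → ℤ) : Real.exp (-(laplaceEigenvalue k * t)) ^ 2 =
      ∏ i, Real.exp (-c * (k i : ℝ) ^ 2) := by
    rw [← Real.exp_sum, ← Real.exp_nat_mul, ← Finset.mul_sum, laplaceEigenvalue]
    congr 1; push_cast; rw [hc]; ring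
  have h3 : √(Real.pi / c) ≤ t ^ (-(1 / 2) : ℝ) := by
    rw [Real.rpow_neg ht.le, ← Real.sqrt_eq_rpow, ← Real.sqrt_inv]
    refine Real.sqrt_le_sqrt ?_
    rw [div_le_iff₀ hcpos, hc]
    have := Real.pi_gt_three
    field_simp
    nlinarith
  calc ∑ k ∈ s, Real.exp (-(laplaceEigenvalue k * t)) ^ 2
      ≤ ∑ k ∈ Fintype.piFinset fun _ : Fin N => Finset.Icc (-(n : ℤ)) n,
          ∏ i, Real.exp (-c * (k i : ℝ) ^ 2) := by
        simp_rw [h2]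
        exact Finset.sum_le_sum_of_subset_of_nonneg hn fun _ _ _ => by positivity
    _ = (∑ k ∈ Finset.Icc (-(n : ℤ)) n, Real.exp (-c * (k : ℝ) ^ 2)) ^ N := by
        rw [Finset.sum_prod_piFinset (Finset.Icc (-(n : ℤ)) n)
          (fun (_ : Fin N) (k : ℤ) => Real.exp (-c * (k : ℝ) ^ 2))]
        simp
    _ ≤ (1 + t ^ (-(1 / 2) : ℝ)) ^ N := by
        refine pow_le_pow_left₀ (Finset.sum_nonneg fun _ _ => (Real.exp_pos _).le) ?_ N
        exact (sum_Icc_exp_neg_sq_le hcpos n).trans (by linarith)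

theorem memℓp_two_of_sum_le {ι : Type*} {c : ι → ℂ} {B : ℝ}
    (h : ∀ s : Finset ι, ∑ i ∈ s, ‖c i‖ ^ 2 ≤ B) : Memℓp c 2 := by
  refine (memℓp_gen_iff (by norm_num)).2 ?_
  simpa using summable_of_sum_le (fun i => by positivity) h

/-- No integrability of `f` is needed, because undefined integrals are 0 by convention. So for t > 0
`heat` never falls into its default case. -/
theorem sum_heatCoef_sq_le {t : ℝ} (ht : 0 < t) (f : UnitAddTorus (Fin N) → ℝ)
    (s : Finset (Fin N → ℤ)) : ∑ k ∈ s, ‖heatCoef t f k‖ ^ 2 ≤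
      (1 + t ^ (-(1 / 2) : ℝ)) ^ N * (∫ x, ‖f x‖ ∂(torusMeasure N)) ^ 2 := by
  refine le_trans ?_ (mul_le_mul_of_nonneg_right (sum_exp_laplaceEigenvalue_sq_le ht s)
    (by positivity))
  rw [Finset.sum_mul]
  refine Finset.sum_le_sum fun k _ => ?_
  rw [norm_heatCoef, mul_pow]
  gcongr
  exact norm_fourierCoef_le f k

theorem memℓp_heatCoef {t : ℝ} (ht : 0 < t) (f : UnitAddTorus (Fin N) → ℝ) :
    Memℓp (heatCoef t f) 2 :=
  memℓp_two_of_sum_le (sum_heatCoef_sq_le ht f)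

theorem memℓp_heatCoef_zero (f : TorusL2 N) : Memℓp (heatCoef 0 f) 2 := by
  rw [heatCoef_zero]
  simpa only [scalarCoords_coord] using (scalarCoords N).memℓp f

theorem fourierCoef_heat_of_pos {t : ℝ} (ht : 0 < t) (f : UnitAddTorus (Fin N) → ℝ)
    (k : Fin N → ℤ) : fourierCoef (heat t f) k = heatCoef t f k :=
  fourierCoef_heat (memℓp_heatCoef ht f) k

theorem heat_zero (f : TorusL2 N) : heat 0 f = f := by
  refine (scalarCoords N).ext fun k => ?_
  rw [scalarCoords_coord, scalarCoords_coord, fourierCoef_heat (memℓp_heatCoef_zero f),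
    heatCoef_zero]

theorem hasL2Gradient_heat {t : ℝ} (ht : 0 < t) (f : UnitAddTorus (Fin N) → ℝ) :
    HasL2Gradient (heat t f) := by
  have hm (j : Fin N) : Memℓp (fun k => gradHeatCoef t f (j, k)) 2 := by
    classical
    have h (s : Finset (Fin N → ℤ)) := sum_gradHeatCoef_sq_le ht
      (sum_heatCoef_sq_le (half_pos ht) f) ({j} ×ˢ s : Finset (Fin N × (Fin N → ℤ)))
    simp only [Finset.sum_product, Finset.sum_singleton] at h
    exact memℓp_two_of_sum_le h
  obtain ⟨G, hG⟩ := exists_vector_of_component fun j => ofCoef _ (hm j)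
  refine ⟨G, fun j k => ?_⟩
  rw [← fourierCoef_congr (coeFn_component j G), hG, fourierCoef_ofCoef, fourierCoef_heat_of_pos ht,
    gradHeatCoef]
  -- The factor i k_j preserves the conjugate symmetry under k ↦ -k, so the components of the
  -- gradient are real.
  intro k
  have h2 : (starRingEnd ℂ) 2 = 2 := Complex.conj_ofNat 2
  simp [gradHeatCoef, heatCoef_neg, h2]

theorem isGradient_heat {t : ℝ} (ht : 0 < t) (f : UnitAddTorus (Fin N) → ℝ) :
    IsGradient (heat t f) (l2Gradient (heat t f)) := (hasL2Gradient_heat ht f).isGradient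

theorem coord_heat {t : ℝ} (ht : 0 < t) (f : UnitAddTorus (Fin N) → ℝ) (k : Fin N → ℤ) :
    (scalarCoords N).coord k (heat t f) = heatCoef t f k := by
  rw [scalarCoords_coord, fourierCoef_heat_of_pos ht]

theorem coord_l2Gradient_heat {t : ℝ} (ht : 0 < t) (f : UnitAddTorus (Fin N) → ℝ)
    (i : Fin N × (Fin N → ℤ)) :
    (vectorCoords N).coord i (l2Gradient (heat t f)) = gradHeatCoef t f i := by
  rw [isGradient_iff.1 (isGradient_heat ht f), coord_heat ht, gradHeatCoef]

theorem heatCoef_sub {f g : UnitAddTorus (Fin N) → ℝ} (hf : Integrable f (torusMeasure N))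
    (hg : Integrable g (torusMeasure N)) (t : ℝ) (k : Fin N → ℤ) :
    heatCoef t (fun x => f x - g x) k = heatCoef t f k - heatCoef t g k := by
  rw [heatCoef, fourierCoef_sub hf hg, mul_sub]; rfl

theorem heat_sub {t : ℝ} (ht : 0 < t) {f g : UnitAddTorus (Fin N) → ℝ}
    (hf : Integrable f (torusMeasure N)) (hg : Integrable g (torusMeasure N)) :
    heat t (fun x => f x - g x) = heat t f - heat t g := by
  refine (scalarCoords N).ext fun k => ?_
  rw [map_sub, coord_heat ht, coord_heat ht, coord_heat ht, heatCoef_sub hf hg]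

theorem l2Gradient_heat_sub {t : ℝ} (ht : 0 < t) {f g : UnitAddTorus (Fin N) → ℝ}
    (hf : Integrable f (torusMeasure N)) (hg : Integrable g (torusMeasure N)) :
    l2Gradient (heat t fun x => f x - g x) = l2Gradient (heat t f) - l2Gradient (heat t g) := by
  rw [heat_sub ht hf hg]
  exact ((isGradient_heat ht f).sub (isGradient_heat ht g)).l2Gradient_eq

theorem continuous_heatCoef (f : UnitAddTorus (Fin N) → ℝ) (k : Fin N → ℤ) :
    Continuous fun t => heatCoef t f k := by
  unfold heatCoef; fun_prop

/-- On (t/2, ∞) the coefficients are dominated by those at time t/2, which are square summable for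
every `f`. -/
theorem continuousAt_heat {t : ℝ} (ht : 0 < t) (f : UnitAddTorus (Fin N) → ℝ) :
    ContinuousAt (fun t => heat t f) t := by
  rw [← continuousWithinAt_univ, ← continuousWithinAt_inter (Ioi_mem_nhds (half_lt_self ht)),
    univ_inter]
  have hev : ∀ s ∈ Ioi (t / 2), ∀ k, (scalarCoords N).coord k (heat s f) = heatCoef s f k :=
    fun s hs k => coord_heat ((half_pos ht).trans hs) f k
  refine (scalarCoords N).continuousWithinAt
    (B := fun k => ‖(scalarCoords N).coord k (heat (t / 2) f)‖)
    ((scalarCoords N).parseval _).summable (fun k => ?_) ?_ (fun k => ?_)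
  · exact (continuous_heatCoef f k).continuousWithinAt.congr (fun s hs => hev s hs k)
      (hev t (half_lt_self ht) k)
  · filter_upwards [self_mem_nhdsWithin] with s hs k
    rw [hev s hs, coord_heat (half_pos ht)]
    exact norm_heatCoef_le_of_le (le_of_lt hs) f k
  · rw [coord_heat ht, coord_heat (half_pos ht)]
    exact norm_heatCoef_le_of_le (half_le_self ht.le) f k

theorem continuousAt_l2Gradient_heat {t : ℝ} (ht : 0 < t) (f : UnitAddTorus (Fin N) → ℝ) :
    ContinuousAt (fun t => l2Gradient (heat t f)) t := by
  rw [← continuousWithinAt_univ, ← continuousWithinAt_inter (Ioi_mem_nhds (half_lt_self ht)),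
    univ_inter]
  have hev : ∀ s ∈ Ioi (t / 2), ∀ k,
      (vectorCoords N).coord k (l2Gradient (heat s f)) = gradHeatCoef s f k :=
    fun s hs k => coord_l2Gradient_heat ((half_pos ht).trans hs) f k
  refine (vectorCoords N).continuousWithinAt
    (B := fun k => ‖(vectorCoords N).coord k (l2Gradient (heat (t / 2) f))‖)
    ((vectorCoords N).parseval _).summable (fun k => ?_) ?_ (fun k => ?_)
  · exact ((continuous_heatCoef f k.2).const_mul _).continuousWithinAt.congr
      (fun s hs => hev s hs k) (hev t (half_lt_self ht) k)
  · filter_upwards [self_mem_nhdsWithin] with s hs k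
    rw [hev s hs, coord_l2Gradient_heat (half_pos ht)]
    exact norm_gradHeatCoef_le_of_le (le_of_lt hs) f k
  · rw [coord_l2Gradient_heat ht, coord_l2Gradient_heat (half_pos ht)]
    exact norm_gradHeatCoef_le_of_le (half_le_self ht.le) f k

end

/-! ### Smoothing estimates from L^{2/p}. -/

noncomputable section

variable {N : ℕ}

/-- The trigonometric polynomial with coefficients `c` on the finite set `s`. -/
def trigPoly (s : Finset (Fin N → ℤ)) (c : (Fin N → ℤ) → ℂ) : C(UnitAddTorus (Fin N), ℂ) :=
  ∑ k ∈ s, c k • mFourier k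

theorem trigPoly_apply (s : Finset (Fin N → ℤ)) (c : (Fin N → ℤ) → ℂ)
    (x : UnitAddTorus (Fin N)) : trigPoly s c x = ∑ k ∈ s, c k * mFourier k x := by
  simp [trigPoly, ContinuousMap.sum_apply]

theorem norm_trigPoly_apply_le (s : Finset (Fin N → ℤ)) (c : (Fin N → ℤ) → ℂ)
    (x : UnitAddTorus (Fin N)) : ‖trigPoly s c x‖ ≤ ∑ k ∈ s, ‖c k‖ := by
  rw [trigPoly_apply]
  refine (norm_sum_le _ _).trans_eq (Finset.sum_congr rfl fun k _ => ?_)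
  rw [norm_mul, norm_mFourier_apply, mul_one]

theorem torusBasis_apply (k : Fin N → ℤ) :
    torusBasis N k = ContinuousMap.toLp (E := ℂ) 2 (torusMeasure N) ℂ (mFourier k) :=
  congrFun coe_mFourierBasis k

theorem integral_norm_trigPoly_sq (s : Finset (Fin N → ℤ)) (c : (Fin N → ℤ) → ℂ) :
    ∫ x, ‖trigPoly s c x‖ ^ 2 ∂(torusMeasure N) = ∑ k ∈ s, ‖c k‖ ^ 2 := by
  have h1 : ContinuousMap.toLp (E := ℂ) 2 (torusMeasure N) ℂ (trigPoly s c) =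
      ∑ k ∈ s, c k • torusBasis N k := by
    simp only [trigPoly, map_sum, map_smul, torusBasis_apply]
  have h2 : ‖∑ k ∈ s, c k • torusBasis N k‖ ^ 2 = ∑ k ∈ s, ‖c k‖ ^ 2 := by
    have h3 := (torusBasis N).orthonormal.inner_sum c c s
    rw [inner_self_eq_norm_sq_to_K] at h3
    have h4 : ∀ k ∈ s, (starRingEnd ℂ) (c k) * c k = ((‖c k‖ ^ 2 : ℝ) : ℂ) := fun k _ => by
      rw [Complex.conj_mul']; push_cast; rfl
    rw [Finset.sum_congr rfl h4] at h3
    refine Complex.ofReal_injective ?_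
    push_cast at h3 ⊢
    exact h3
  rw [← h2, ← h1, norm_sq_eq_integral]
  refine integral_congr_ae ?_
  filter_upwards [ContinuousMap.coeFn_toLp (p := 2) (𝕜 := ℂ) (torusMeasure N) (trigPoly s c)] with x hx
  rw [hx]

theorem integral_mul_conj_trigPoly {f : UnitAddTorus (Fin N) → ℝ}
    (hf : Integrable f (torusMeasure N)) (s : Finset (Fin N → ℤ)) (c : (Fin N → ℤ) → ℂ) :
    ∫ x, (f x : ℂ) * (starRingEnd ℂ) (trigPoly s c x) ∂(torusMeasure N) =
      ∑ k ∈ s, (starRingEnd ℂ) (c k) * fourierCoef f k := by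
  simp_rw [fourierCoef_eq_integral, ← integral_const_mul]
  rw [← integral_finsetSum s fun k _ => (integrable_mFourier_mul_ofReal hf _).const_mul _]
  refine integral_congr_ae (Eventually.of_forall fun x => ?_)
  simp only [trigPoly_apply, map_sum, map_mul, Finset.mul_sum, mFourier_neg]
  refine Finset.sum_congr rfl fun k _ => ?_
  ring

theorem ENNReal_two_div_ofReal {p : ℝ} (hp : 0 < p) :
    (2 : ℝ≥0∞) / ENNReal.ofReal p = ENNReal.ofReal (2 / p) := by
  rw [ENNReal.ofReal_div_of_pos hp, ENNReal.ofReal_ofNat]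

theorem one_le_two_div_ofReal {p : ℝ} (hp : 0 < p) (hp2 : p ≤ 2) :
    (1 : ℝ≥0∞) ≤ 2 / ENNReal.ofReal p := by
  rw [ENNReal_two_div_ofReal hp, ENNReal.one_le_ofReal, le_div_iff₀ hp]
  linarith

/-- Hölder's inequality with q = 2/(2-p), the exponent dual to 2/p. The L^q norm of g is
interpolated between L^∞ and L², which gives (AB)^{p-1} B^{2-p} = A^{p-1} B. -/
theorem integral_norm_mul_trigPoly_le {p A B : ℝ} (hp1 : 1 ≤ p) (hp2 : p < 2)
    {f : UnitAddTorus (Fin N) → ℝ} (hf : MemLp f (2 / ENNReal.ofReal p) (torusMeasure N))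
    (g : C(UnitAddTorus (Fin N), ℂ)) (hA : 0 ≤ A) (hB : 0 < B) (hgA : ∀ x, ‖g x‖ ≤ A * B)
    (hgB : ∫ x, ‖g x‖ ^ 2 ∂(torusMeasure N) ≤ B ^ 2) :
    ∫ x, ‖f x‖ * ‖g x‖ ∂(torusMeasure N) ≤
      (eLpNorm f (2 / ENNReal.ofReal p) (torusMeasure N)).toReal * (A ^ (p - 1) * B) := by
  have hp0 : 0 < p := by linarith
  have hq0 : 0 < 2 - p := by linarith
  set q : ℝ := 2 / (2 - p) with hq
  have hq2 : 2 ≤ q := by rw [hq, le_div_iff₀ hq0]; linarith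
  have hqinv : 1 / q = (2 - p) / 2 := by rw [hq, one_div_div]
  have hpq : (2 / p).HolderConjugate q := by
    refine Real.holderConjugate_iff.2 ⟨by rw [lt_div_iff₀ hp0]; linarith, ?_⟩
    rw [hq, inv_div, inv_div]; ring
  rw [ENNReal_two_div_ofReal hp0] at hf ⊢
  have hfn : (eLpNorm f (ENNReal.ofReal (2 / p)) (torusMeasure N)).toReal =
      (∫ x, ‖f x‖ ^ (2 / p) ∂(torusMeasure N)) ^ (1 / (2 / p)) := by
    have hr : 0 < 2 / p := by positivity
    rw [hf.eLpNorm_eq_integral_rpow_norm (by simpa using hr) ENNReal.ofReal_ne_top,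
      ENNReal.toReal_ofReal (by positivity), ENNReal.toReal_ofReal hr.le, one_div]
  have hgm : MemLp g (ENNReal.ofReal q) (torusMeasure N) :=
    MemLp.of_bound g.continuous.aestronglyMeasurable (A * B) (Eventually.of_forall hgA)
  have h1 := integral_mul_norm_le_Lp_mul_Lq hpq hf.norm hgm.norm
  simp only [norm_norm] at h1
  refine h1.trans ?_
  rw [hfn]
  refine mul_le_mul_of_nonneg_left ?_ (by positivity)
  have hint : Integrable (fun x => ‖g x‖ ^ 2) (torusMeasure N) :=
    (MemLp.of_bound (p := 2) g.continuous.aestronglyMeasurable (A * B)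
      (Eventually.of_forall hgA)).integrable_norm_pow two_ne_zero
  have h2 : ∫ x, ‖g x‖ ^ q ∂(torusMeasure N) ≤ (A * B) ^ (q - 2) * B ^ 2 := by
    calc ∫ x, ‖g x‖ ^ q ∂(torusMeasure N)
        ≤ ∫ x, (A * B) ^ (q - 2) * ‖g x‖ ^ 2 ∂(torusMeasure N) := by
          refine integral_mono_of_nonneg (Eventually.of_forall fun x => by positivity)
            (hint.const_mul _) (Eventually.of_forall fun x => ?_)
          have h3 : ‖g x‖ ^ q = ‖g x‖ ^ (q - 2) * ‖g x‖ ^ 2 := by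
            rw [← Real.rpow_natCast, ← Real.rpow_add_of_nonneg (norm_nonneg _) (by linarith)
              (by positivity)]
            congr 1; push_cast; ring
          simp only [h3]
          exact mul_le_mul_of_nonneg_right (Real.rpow_le_rpow (norm_nonneg _) (hgA x) (by linarith))
            (by positivity)
      _ ≤ _ := by rw [integral_const_mul]; gcongr
  calc (∫ x, ‖g x‖ ^ q ∂(torusMeasure N)) ^ (1 / q)
      ≤ ((A * B) ^ (q - 2) * B ^ 2) ^ (1 / q) := by gcongr
    _ = A ^ (p - 1) * B := by
        have h4 : (q - 2) * (1 / q) = p - 1 := by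
          have : q ≠ 0 := by linarith
          have h5 : (q - 2) * (1 / q) = 1 - 2 * (1 / q) := by field_simp
          rw [h5, hqinv]; ring
        rw [Real.mul_rpow (by positivity) (by positivity), ← Real.rpow_mul (by positivity), h4,
          Real.mul_rpow hA hB.le, mul_assoc, ← Real.rpow_natCast B 2, ← Real.rpow_mul hB.le,
          ← Real.rpow_add hB, hqinv]
        have h6 : p - 1 + ((2 : ℕ) : ℝ) * ((2 - p) / 2) = 1 := by push_cast; ring
        rw [h6, Real.rpow_one]

/-- A Hausdorff-Young type bound: square summability of a multiplier trades integrability. -/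
theorem sum_multiplier_sq_le {p A : ℝ} (hp1 : 1 ≤ p) (hp2 : p < 2)
    {f : UnitAddTorus (Fin N) → ℝ} (hf : MemLp f (2 / ENNReal.ofReal p) (torusMeasure N))
    {m : (Fin N → ℤ) → ℝ} (hm0 : ∀ k, 0 ≤ m k) (hm1 : ∀ k, m k ≤ 1) (hA : 0 ≤ A)
    (s : Finset (Fin N → ℤ)) (hmA : ∑ k ∈ s, m k ^ 2 ≤ A ^ 2) :
    ∑ k ∈ s, (m k * ‖fourierCoef f k‖) ^ 2 ≤
      (A ^ (p - 1) * (eLpNorm f (2 / ENNReal.ofReal p) (torusMeasure N)).toReal) ^ 2 := by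
  set S := ∑ k ∈ s, (m k * ‖fourierCoef f k‖) ^ 2 with hS
  have hS0 : 0 ≤ S := Finset.sum_nonneg fun k _ => by positivity
  rcases hS0.eq_or_lt with h0 | hpos
  · rw [← h0]; positivity
  set F := (eLpNorm f (2 / ENNReal.ofReal p) (torusMeasure N)).toReal
  -- With the weight m² the pairing of f with this polynomial is exactly S. Its sup norm is at most
  -- A√S by Cauchy–Schwarz, and its L² norm is at most √S because m ≤ 1. Hence S ≤ A^{p-1} F √S.
  set c : (Fin N → ℤ) → ℂ := fun k => (m k ^ 2 : ℝ) * fourierCoef f k with hc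
  have hcn (k : Fin N → ℤ) : ‖c k‖ = m k * (m k * ‖fourierCoef f k‖) := by
    rw [hc, norm_mul, Complex.norm_real, Real.norm_of_nonneg (by positivity)]; ring
  have hfi : Integrable f (torusMeasure N) :=
    hf.integrable (one_le_two_div_ofReal (by linarith) hp2.le)
  have hsup (x : UnitAddTorus (Fin N)) : ‖trigPoly s c x‖ ≤ A * √S := by
    refine (norm_trigPoly_apply_le s c x).trans ?_
    simp_rw [hcn]
    refine (Real.sum_mul_le_sqrt_mul_sqrt s _ _).trans ?_
    gcongr
    exact (Real.sqrt_le_sqrt hmA).trans_eq (Real.sqrt_sq hA)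
  have hL2 : ∫ x, ‖trigPoly s c x‖ ^ 2 ∂(torusMeasure N) ≤ √S ^ 2 := by
    rw [integral_norm_trigPoly_sq, Real.sq_sqrt hS0]
    refine Finset.sum_le_sum fun k _ => ?_
    rw [hcn]
    have := hm0 k
    gcongr
    exact mul_le_of_le_one_left (by positivity) (hm1 k)
  have h1 : S ≤ ∫ x, ‖f x‖ * ‖trigPoly s c x‖ ∂(torusMeasure N) := by
    have h2 := integral_mul_conj_trigPoly hfi s c
    have h3 : ∑ k ∈ s, (starRingEnd ℂ) (c k) * fourierCoef f k = (S : ℂ) := by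
      rw [hS]; push_cast
      refine Finset.sum_congr rfl fun k _ => ?_
      rw [hc]
      simp only [map_mul, Complex.conj_ofReal]
      rw [mul_assoc, Complex.conj_mul', mul_pow]
      push_cast; rfl
    rw [h3] at h2
    calc S = ‖(S : ℂ)‖ := by rw [Complex.norm_real, Real.norm_of_nonneg hS0]
      _ ≤ ∫ x, ‖(f x : ℂ) * (starRingEnd ℂ) (trigPoly s c x)‖ ∂(torusMeasure N) := by
        rw [← h2]; exact norm_integral_le_integral_norm _
      _ = _ := by simp
  have h4 := h1.trans (integral_norm_mul_trigPoly_le hp1 hp2 hf (trigPoly s c) hA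
    (Real.sqrt_pos.2 hpos) hsup hL2)
  have h5 : √S ≤ A ^ (p - 1) * F := by
    have h6 : √S * √S ≤ A ^ (p - 1) * F * √S := by
      rw [Real.mul_self_sqrt hS0]; linarith
    exact le_of_mul_le_mul_right h6 (Real.sqrt_pos.2 hpos)
  calc S = √S ^ 2 := (Real.sq_sqrt hS0).symm
    _ ≤ _ := by gcongr

/-- The multiplier e^{-λt} has ℓ² norm at most A = (1 + t^{-1/2})^{N/2}, and the factor here is
A^{p-1}. -/
theorem sum_heatCoef_sq_le_eLpNorm {p t : ℝ} (hp1 : 1 ≤ p) (hp2 : p < 2) (ht : 0 < t)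
    {f : UnitAddTorus (Fin N) → ℝ} (hf : MemLp f (2 / ENNReal.ofReal p) (torusMeasure N))
    (s : Finset (Fin N → ℤ)) : ∑ k ∈ s, ‖heatCoef t f k‖ ^ 2 ≤
      ((1 + t ^ (-(1 / 2) : ℝ)) ^ (N * (p - 1) / 2) *
        (eLpNorm f (2 / ENNReal.ofReal p) (torusMeasure N)).toReal) ^ 2 := by
  have h0 : 0 ≤ 1 + t ^ (-(1 / 2) : ℝ) := by positivity
  have h := sum_multiplier_sq_le (A := (1 + t ^ (-(1 / 2) : ℝ)) ^ ((N : ℝ) / 2)) hp1 hp2 hf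
    (m := fun k => Real.exp (-(laplaceEigenvalue k * t))) (fun k => (Real.exp_pos _).le)
    (fun k => Real.exp_le_one_iff.2 (neg_nonpos.2 (mul_nonneg (laplaceEigenvalue_nonneg k) ht.le)))
    (by positivity) s (by
      refine (sum_exp_laplaceEigenvalue_sq_le ht s).trans_eq ?_
      rw [← Real.rpow_natCast, ← Real.rpow_natCast, ← Real.rpow_mul h0]
      congr 1; push_cast; ring)
  rw [← Real.rpow_mul h0] at h
  simp_rw [norm_heatCoef]
  convert h using 4
  ring

/-- For t ≤ T the summand 1 is at most √T t^{-1/2}, so on a bounded time interval the bound becomes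
a pure power of t. -/
theorem one_add_rpow_le {t T a : ℝ} (ha : 0 ≤ a) (ht : 0 < t) (htT : t ≤ T) :
    (1 + t ^ (-(1 / 2) : ℝ)) ^ (2 * a) ≤ (1 + √T) ^ (2 * a) * t ^ (-a) := by
  have h1 : 1 + t ^ (-(1 / 2) : ℝ) ≤ (1 + √T) * t ^ (-(1 / 2) : ℝ) := by
    have h2 : 1 ≤ √T * t ^ (-(1 / 2) : ℝ) := by
      rw [Real.rpow_neg ht.le, ← Real.sqrt_eq_rpow, ← div_eq_mul_inv, one_le_div (Real.sqrt_pos.2 ht)]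
      exact Real.sqrt_le_sqrt htT
    linarith
  calc (1 + t ^ (-(1 / 2) : ℝ)) ^ (2 * a) ≤ ((1 + √T) * t ^ (-(1 / 2) : ℝ)) ^ (2 * a) := by
        gcongr
    _ = _ := by
        rw [Real.mul_rpow (by positivity) (by positivity), ← Real.rpow_mul ht.le]
        congr 2; ring

/-- The smoothing effect of the heat semigroup from `L^{2/p}` to `L²`. -/
theorem norm_heat_le {p t T : ℝ} (hp1 : 1 ≤ p) (hp2 : p < 2) (ht : 0 < t) (htT : t ≤ T)
    {f : UnitAddTorus (Fin N) → ℝ} (hf : MemLp f (2 / ENNReal.ofReal p) (torusMeasure N)) :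
    ‖heat t f‖ ≤ (1 + √T) ^ (2 * (N * (p - 1) / 4)) * t ^ (-(N * (p - 1) / 4)) *
      (eLpNorm f (2 / ENNReal.ofReal p) (torusMeasure N)).toReal := by
  have ha : 0 ≤ N * (p - 1) / 4 := by
    have : 0 ≤ p - 1 := by linarith
    positivity
  refine (scalarCoords N).norm_le_of_sum_le (by positivity) fun s => ?_
  simp_rw [coord_heat ht]
  refine (sum_heatCoef_sq_le_eLpNorm hp1 hp2 ht hf s).trans ?_
  have h1 := one_add_rpow_le ha ht htT
  have h2 : 2 * (N * (p - 1) / 4) = N * (p - 1) / 2 := by ring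
  rw [h2] at h1 ⊢
  gcongr

/-- The smoothing effect of the heat semigroup from `L^{2/p}` to `H¹`. -/
theorem norm_l2Gradient_heat_le {p t T : ℝ} (hp1 : 1 ≤ p) (hp2 : p < 2) (hN : N * (p - 1) / 4 ≤ 1)
    (ht : 0 < t) (htT : t ≤ T)
    {f : UnitAddTorus (Fin N) → ℝ} (hf : MemLp f (2 / ENNReal.ofReal p) (torusMeasure N)) :
    ‖l2Gradient (heat t f)‖ ≤ 2 * (1 + √T) ^ (2 * (N * (p - 1) / 4)) *
      t ^ (-(N * (p - 1) / 4 + 1 / 2)) *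
      (eLpNorm f (2 / ENNReal.ofReal p) (torusMeasure N)).toReal := by
  set a := N * (p - 1) / 4 with ha'
  have ha : 0 ≤ a := by
    have : 0 ≤ p - 1 := by linarith
    positivity
  refine (vectorCoords N).norm_le_of_sum_le (by positivity) fun s => ?_
  simp_rw [coord_l2Gradient_heat ht]
  refine (sum_gradHeatCoef_sq_le ht
    (sum_heatCoef_sq_le_eLpNorm hp1 hp2 (half_pos ht) hf) s).trans ?_
  have h1 := one_add_rpow_le ha (half_pos ht) ((half_le_self ht.le).trans htT)
  have h2 : N * (p - 1) / 2 = 2 * a := by rw [ha']; ring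
  -- The gradient bound uses the flow at time t/2; this loses 2^a ≤ 2 and explains the leading 2 in
  -- the statement.
  have h3 : (t / 2) ^ (-a) ≤ 2 * t ^ (-a) := by
    rw [Real.div_rpow ht.le zero_le_two, Real.rpow_neg zero_le_two, div_inv_eq_mul, mul_comm]
    gcongr
    calc (2 : ℝ) ^ a ≤ 2 ^ (1 : ℝ) := Real.rpow_le_rpow_of_exponent_le one_le_two hN
      _ = 2 := Real.rpow_one 2
  have h4 : t⁻¹ = (t ^ (-(1 / 2) : ℝ)) ^ 2 := by
    rw [← Real.rpow_natCast, ← Real.rpow_mul ht.le, ← Real.rpow_neg_one]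
    congr 1; norm_num
  have h5 : t ^ (-(a + 1 / 2)) = t ^ (-a) * t ^ (-(1 / 2) : ℝ) := by
    rw [← Real.rpow_add ht]; congr 1; ring
  rw [h2, h4, ← mul_pow, h5]
  set F := (eLpNorm f (2 / ENNReal.ofReal p) (torusMeasure N)).toReal
  refine pow_le_pow_left₀ (by positivity) ?_ 2
  calc t ^ (-(1 / 2) : ℝ) * ((1 + (t / 2) ^ (-(1 / 2) : ℝ)) ^ (2 * a) * F)
      ≤ t ^ (-(1 / 2) : ℝ) * ((1 + √T) ^ (2 * a) * (2 * t ^ (-a)) * F) := by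
        gcongr
        exact h1.trans (by gcongr)
    _ = _ := by ring

/-- For square integrable data the heat flow is continuous up to time `0`. -/
theorem continuousOn_heat (f : TorusL2 N) : ContinuousOn (fun t => heat t f) (Ici 0) := by
  have hev : ∀ t ∈ Ici (0 : ℝ), ∀ k, (scalarCoords N).coord k (heat t f) = heatCoef t f k := by
    intro t ht k
    rcases (mem_Ici.1 ht).eq_or_lt with rfl | ht
    · rw [scalarCoords_coord, fourierCoef_heat (memℓp_heatCoef_zero f)]
    · exact coord_heat ht f k
  intro t ht
  have hle : ∀ t ∈ Ici (0 : ℝ), ∀ k,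
      ‖(scalarCoords N).coord k (heat t f)‖ ≤ ‖(scalarCoords N).coord k f‖ := by
    intro t ht k
    rw [hev t ht, scalarCoords_coord, ← heatCoef_zero]
    exact norm_heatCoef_le_of_le ht f k
  refine (scalarCoords N).continuousWithinAt (B := fun k => ‖(scalarCoords N).coord k f‖)
    ((scalarCoords N).parseval f).summable (fun k => ?_) ?_ (hle t ht)
  · exact (continuous_heatCoef f k).continuousWithinAt.congr (fun s hs => hev s hs k) (hev t ht k)
  · filter_upwards [self_mem_nhdsWithin] with s hs k using hle s hs k

/-- For square integrable data the weighted gradient `t^{1/2} ∇ e^{tΔ} f` is continuous up to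
time `0`. -/
theorem continuousOn_sqrt_smul_l2Gradient_heat (f : TorusL2 N) :
    ContinuousOn (fun t => √t • l2Gradient (heat t f)) (Ici 0) := by
  have hev : ∀ t ∈ Ici (0 : ℝ), ∀ i,
      (vectorCoords N).coord i (√t • l2Gradient (heat t f)) = √t • gradHeatCoef t f i := by
    intro t ht i
    rw [map_smul]
    rcases (mem_Ici.1 ht).eq_or_lt with rfl | ht
    -- At t = 0 the factor √0 removes the gradient of the datum, which need not exist in L².
    · simp
    · rw [coord_l2Gradient_heat ht]
  have hle : ∀ t ∈ Ici (0 : ℝ), ∀ i,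
      ‖(vectorCoords N).coord i (√t • l2Gradient (heat t f))‖ ≤
        ‖(scalarCoords N).coord i.2 f‖ := by
    intro t ht i
    rw [hev t ht]
    rcases (mem_Ici.1 ht).eq_or_lt with rfl | ht
    · simp
    refine (sq_le_sq₀ (norm_nonneg _) (norm_nonneg _)).1 ?_
    rw [norm_smul, mul_pow, Real.norm_of_nonneg (Real.sqrt_nonneg t), Real.sq_sqrt ht.le]
    have h1 : ‖gradHeatCoef t f i‖ ^ 2 ≤ ∑ j, ‖gradHeatCoef t f (j, i.2)‖ ^ 2 :=
      Finset.single_le_sum (f := fun j => ‖gradHeatCoef t f (j, i.2)‖ ^ 2)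
        (fun j _ => by positivity) (Finset.mem_univ i.1)
    have h2 : ‖heatCoef (t / 2) f i.2‖ ≤ ‖(scalarCoords N).coord i.2 f‖ := by
      rw [scalarCoords_coord, ← heatCoef_zero]
      exact norm_heatCoef_le_of_le (half_pos ht).le f _
    rw [sum_gradHeatCoef_sq] at h1
    calc t * ‖gradHeatCoef t f i‖ ^ 2 ≤ t * (t⁻¹ * ‖heatCoef (t / 2) f i.2‖ ^ 2) := by
          gcongr
          exact h1.trans (laplaceEigenvalue_mul_heatCoef_le ht f i.2)
      _ = ‖heatCoef (t / 2) f i.2‖ ^ 2 := by field_simp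
      _ ≤ _ := by gcongr
  have hsum : Summable fun i : Fin N × (Fin N → ℤ) => ‖(scalarCoords N).coord i.2 f‖ ^ 2 :=
    (summable_prod_of_nonneg fun i => by positivity).2
      ⟨fun _ => ((scalarCoords N).parseval f).summable, (hasSum_fintype _).summable⟩
  intro t ht
  refine (vectorCoords N).continuousWithinAt
    (B := fun i => ‖(scalarCoords N).coord i.2 f‖) hsum (fun i => ?_) ?_ (hle t ht)
  · have h : Continuous fun t => √t • gradHeatCoef t f i :=
      Real.continuous_sqrt.smul ((continuous_heatCoef f i.2).const_mul _)
    exact h.continuousWithinAt.congr (fun s hs => hev s hs i) (hev t ht i)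
  · filter_upwards [self_mem_nhdsWithin] with s hs i using hle s hs i

end

/-! ### Weakly singular Volterra equations. -/

noncomputable section

/-- The weakly singular weight `(t - τ)^{-b} + τ^{-b}`. -/
def singularWeight (b t τ : ℝ) : ℝ := (t - τ) ^ (-b) + τ ^ (-b)

theorem singularWeight_nonneg {b t τ : ℝ} (h0 : 0 ≤ τ) (h : τ ≤ t) : 0 ≤ singularWeight b t τ :=
  add_nonneg (Real.rpow_nonneg (sub_nonneg.2 h) _) (Real.rpow_nonneg h0 _)

theorem intervalIntegrable_singularWeight {b : ℝ} (hb : b < 1) (t s₁ s₂ : ℝ) :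
    IntervalIntegrable (singularWeight b t) volume s₁ s₂ := by
  have h1 : ∀ u v : ℝ, IntervalIntegrable (fun x : ℝ => x ^ (-b)) volume u v :=
    fun u v => intervalIntegral.intervalIntegrable_rpow' (by linarith)
  have h2 := (h1 (t - s₁) (t - s₂)).comp_sub_left t
  simp only [sub_sub_cancel] at h2
  exact h2.add (h1 _ _)

/-- The part singular at τ = 0 contributes t^{1-b} - s^{1-b}, at most (t-s)^{1-b} by subadditivity.
The bound thus depends only on the length of the interval. -/
theorem integral_singularWeight_le {b s t : ℝ} (hb0 : 0 ≤ b) (hb : b < 1) (hs : 0 ≤ s)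
    (hst : s ≤ t) :
    ∫ τ in s..t, singularWeight b t τ ≤ 2 / (1 - b) * (t - s) ^ (1 - b) := by
  have h1 : ∀ u v : ℝ, IntervalIntegrable (fun x : ℝ => x ^ (-b)) volume u v :=
    fun u v => intervalIntegral.intervalIntegrable_rpow' (by linarith)
  have h2 := (h1 (t - s) (t - t)).comp_sub_left t
  simp only [sub_sub_cancel] at h2
  have hb1 : 0 < 1 - b := by linarith
  unfold singularWeight
  rw [intervalIntegral.integral_add h2 (h1 _ _),
    intervalIntegral.integral_comp_sub_left (fun x : ℝ => x ^ (-b)) t,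
    integral_rpow (Or.inl (by linarith)), integral_rpow (Or.inl (by linarith))]
  have h3 : -b + 1 = 1 - b := by ring
  rw [h3, sub_self, Real.zero_rpow hb1.ne', sub_zero]
  have h4 : t ^ (1 - b) ≤ (t - s) ^ (1 - b) + s ^ (1 - b) := by
    have := Real.rpow_add_le_add_rpow (sub_nonneg.2 hst) hs hb1.le (by linarith)
    simpa using this
  rw [← add_div, div_mul_eq_mul_div, div_le_div_iff_of_pos_right hb1]
  linarith

/-- On the last stretch of length e before t the weight has a small integral; earlier the
exponential is at most e^{-le}, which is small for large l. This yields the contraction factor 1/2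
without any smallness of T. -/
theorem exists_exp_weight {b : ℝ} (hb0 : 0 ≤ b) (hb : b < 1) {C : ℝ} (hC : 0 ≤ C) (T : ℝ) :
    ∃ l : ℝ, ∀ t ∈ Icc 0 T,
      ∫ τ in (0 : ℝ)..t, C * (singularWeight b t τ * Real.exp (-(l * (t - τ)))) ≤ 1 / 2 := by
  have hb1 : 0 < 1 - b := by linarith
  set D := C * (2 / (1 - b)) with hD
  have hD0 : 0 ≤ D := by positivity
  obtain ⟨e, he, heD⟩ : ∃ e : ℝ, 0 < e ∧ D * e ^ (1 - b) ≤ 1 / 4 := by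
    have h1 : Tendsto (fun e : ℝ => D * e ^ (1 - b)) (𝓝[>] 0) (𝓝 (D * 0 ^ (1 - b))) :=
      ((Real.continuousAt_rpow_const 0 (1 - b) (Or.inr hb1.le)).tendsto.mono_left
        nhdsWithin_le_nhds).const_mul D
    rw [Real.zero_rpow hb1.ne', mul_zero] at h1
    obtain ⟨e, he1, he2⟩ := ((h1.eventually (gt_mem_nhds (by norm_num : (0 : ℝ) < 1 / 4))).and
      self_mem_nhdsWithin).exists
    exact ⟨e, he2, he1.le⟩
  obtain ⟨l, hl0, hl⟩ : ∃ l : ℝ, 0 ≤ l ∧ Real.exp (-(l * e)) * (D * |T| ^ (1 - b)) ≤ 1 / 4 := by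
    have h1 : Tendsto (fun l : ℝ => Real.exp (-(l * e)) * (D * |T| ^ (1 - b))) atTop
        (𝓝 (0 * (D * |T| ^ (1 - b)))) :=
      (Real.tendsto_exp_neg_atTop_nhds_zero.comp (tendsto_id.atTop_mul_const he)).mul_const _
    rw [zero_mul] at h1
    obtain ⟨l, h2, h3⟩ := ((h1.eventually (gt_mem_nhds (by norm_num : (0 : ℝ) < 1 / 4))).and
      (eventually_ge_atTop 0)).exists
    exact ⟨l, h3, h2.le⟩
  refine ⟨l, fun t ht => ?_⟩
  set s := max 0 (t - e)
  have hs0 : 0 ≤ s := le_max_left _ _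
  have hst : s ≤ t := max_le ht.1 (by linarith)
  have hse : t - s ≤ e := by linarith [le_max_right 0 (t - e)]
  have hint (u v : ℝ) : IntervalIntegrable
      (fun τ => C * (singularWeight b t τ * Real.exp (-(l * (t - τ))))) volume u v :=
    ((intervalIntegrable_singularWeight hb t u v).mul_continuousOn
      (by fun_prop : Continuous fun τ => Real.exp (-(l * (t - τ)))).continuousOn).const_mul C
  rw [← intervalIntegral.integral_add_adjacent_intervals (hint 0 s) (hint s t)]
  have hA : ∫ τ in s..t, C * (singularWeight b t τ * Real.exp (-(l * (t - τ)))) ≤ 1 / 4 := by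
    calc _ ≤ ∫ τ in s..t, C * singularWeight b t τ := by
          refine intervalIntegral.integral_mono_on hst (hint s t)
            ((intervalIntegrable_singularWeight hb t s t).const_mul C) fun τ hτ => ?_
          refine mul_le_mul_of_nonneg_left ?_ hC
          refine mul_le_of_le_one_right (singularWeight_nonneg (hs0.trans hτ.1) hτ.2) ?_
          exact Real.exp_le_one_iff.2 (neg_nonpos.2 (mul_nonneg hl0 (sub_nonneg.2 hτ.2)))
      _ ≤ C * (2 / (1 - b) * (t - s) ^ (1 - b)) := by
          rw [intervalIntegral.integral_const_mul]
          exact mul_le_mul_of_nonneg_left (integral_singularWeight_le hb0 hb hs0 hst) hC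
      _ ≤ D * e ^ (1 - b) := by
          rw [← mul_assoc]
          have := sub_nonneg.2 hst
          gcongr
      _ ≤ 1 / 4 := heD
  have hB : ∫ τ in (0 : ℝ)..s, C * (singularWeight b t τ * Real.exp (-(l * (t - τ)))) ≤ 1 / 4 := by
    rcases le_total t e with hte | hte
    · have : s = 0 := max_eq_left (by linarith)
      rw [this, intervalIntegral.integral_same]; norm_num
    have hs : s = t - e := max_eq_right (by linarith)
    calc _ ≤ ∫ τ in (0 : ℝ)..s, Real.exp (-(l * e)) * (C * singularWeight b t τ) := by
          refine intervalIntegral.integral_mono_on hs0 (hint 0 s)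
            (((intervalIntegrable_singularWeight hb t 0 s).const_mul C).const_mul _) fun τ hτ => ?_
          have h1 : Real.exp (-(l * (t - τ))) ≤ Real.exp (-(l * e)) := by
            refine Real.exp_le_exp.2 (neg_le_neg (mul_le_mul_of_nonneg_left ?_ hl0))
            linarith [hτ.2]
          have h2 := singularWeight_nonneg (b := b) hτ.1 (hτ.2.trans hst)
          calc C * (singularWeight b t τ * Real.exp (-(l * (t - τ))))
              ≤ C * (singularWeight b t τ * Real.exp (-(l * e))) := by gcongr
            _ = _ := by ring
      _ ≤ ∫ τ in (0 : ℝ)..t, Real.exp (-(l * e)) * (C * singularWeight b t τ) := by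
          refine intervalIntegral.integral_mono_interval le_rfl hs0 hst ?_
            (((intervalIntegrable_singularWeight hb t 0 t).const_mul C).const_mul _)
          filter_upwards [ae_restrict_mem measurableSet_Ioc] with τ hτ
          have := singularWeight_nonneg (b := b) hτ.1.le hτ.2
          positivity
      _ ≤ Real.exp (-(l * e)) * (D * |T| ^ (1 - b)) := by
          rw [intervalIntegral.integral_const_mul, intervalIntegral.integral_const_mul]
          refine mul_le_mul_of_nonneg_left ?_ (Real.exp_pos _).le
          rw [hD, mul_assoc]
          refine mul_le_mul_of_nonneg_left ?_ hC
          refine (integral_singularWeight_le hb0 hb le_rfl ht.1).trans ?_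
          rw [sub_zero]
          have := ht.1
          gcongr
          exact ht.2.trans (le_abs_self T)
      _ ≤ 1 / 4 := hl
  linarith

theorem intervalIntegrable_of_norm_le_singularWeight {Z : Type*} [NormedAddCommGroup Z]
    {b t D : ℝ} (hb : b < 1) {k : ℝ → Z}
    (ht : 0 ≤ t) (hle : ∀ τ, 0 < τ → τ < t → ‖k τ‖ ≤ D * singularWeight b t τ)
    (hm : AEStronglyMeasurable k (volume.restrict (Ioc 0 t))) :
    IntervalIntegrable k volume 0 t := by
  refine ((intervalIntegrable_singularWeight hb t 0 t).const_mul D).mono_fun' ?_ ?_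
  · rwa [uIoc_of_le ht]
  · rw [uIoc_of_le ht, ← restrict_Ioo_eq_restrict_Ioc]
    filter_upwards [ae_restrict_mem measurableSet_Ioo] with τ hτ using hle τ hτ.1 hτ.2

section

variable {Z : Type*} [NormedAddCommGroup Z] [NormedSpace ℝ Z]

/-- Stopping the integral at t - eₙ avoids the singularity at τ = t. The cut-off integrals are
continuous by dominated convergence, and the error is O(eₙ^{1-b}) uniformly in t. -/
theorem continuousOn_integral_of_norm_le_singularWeight {b T D : ℝ} (hb0 : 0 ≤ b) (hb : b < 1)
    (hD : 0 ≤ D) {k : ℝ → ℝ → Z}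
    (hle : ∀ t τ, 0 < τ → τ < t → t ≤ T → ‖k t τ‖ ≤ D * singularWeight b t τ)
    (hc : ∀ t τ, 0 < τ → τ < t → ContinuousAt (fun t => k t τ) t)
    (hm : ∀ t ∈ Ioc 0 T, AEStronglyMeasurable (k t) (volume.restrict (Ioc 0 t))) :
    ContinuousOn (fun t => ∫ τ in (0 : ℝ)..t, k t τ) (Icc 0 T) := by
  have hb1 : 0 < 1 - b := by linarith
  have hm' : ∀ t ∈ Icc 0 T, AEStronglyMeasurable (k t) (volume.restrict (Ioc 0 t)) := by
    intro t ht
    rcases ht.1.eq_or_lt with rfl | h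
    · simp
    · exact hm t ⟨h, ht.2⟩
  have hint : ∀ t ∈ Icc 0 T, IntervalIntegrable (k t) volume 0 t := fun t ht =>
    intervalIntegrable_of_norm_le_singularWeight hb ht.1 (fun τ h0 h1 => hle t τ h0 h1 ht.2)
      (hm' t ht)
  set e : ℕ → ℝ := fun n => 1 / ((n : ℝ) + 1) with he
  have he0 (n : ℕ) : 0 < e n := by simp only [he]; positivity
  -- The indicator moves all cut-off integrals to the fixed interval (0,T], so only the integrand
  -- depends on t.
  refine TendstoUniformlyOn.continuousOn (p := atTop)
    (F := fun n t => ∫ τ in Ioc 0 T, (Iio (t - e n)).indicator (k t) τ) ?_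
    (Frequently.of_forall fun n => ?_)
  · have hlim : Tendsto (fun n => D * (2 / (1 - b) * e n ^ (1 - b))) atTop (𝓝 0) := by
      have h1 := ((tendsto_one_div_add_atTop_nhds_zero_nat (𝕜 := ℝ)).rpow_const
        (p := 1 - b) (Or.inr hb1.le)).const_mul (2 / (1 - b)) |>.const_mul D
      simpa [he, Real.zero_rpow hb1.ne'] using h1
    rw [Metric.tendstoUniformlyOn_iff]
    intro η hη
    filter_upwards [hlim.eventually (gt_mem_nhds hη)] with n hn t ht
    refine lt_of_le_of_lt ?_ hn
    set s := max 0 (t - e n) with hs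
    have hs0 : 0 ≤ s := le_max_left _ _
    have hst : s ≤ t := max_le ht.1 (by linarith [he0 n])
    have h1 : ∫ τ in Ioc 0 T, (Iio (t - e n)).indicator (k t) τ = ∫ τ in (0 : ℝ)..s, k t τ := by
      have hset : Ioc 0 T ∩ Iio (t - e n) = Ioo 0 s := by
        ext τ
        simp only [mem_inter_iff, mem_Ioc, mem_Iio, mem_Ioo, hs, lt_max_iff]
        constructor
        · rintro ⟨⟨h1, h2⟩, h3⟩
          exact ⟨h1, Or.inr h3⟩
        · rintro ⟨h1, h2 | h2⟩
          · exact absurd h1 h2.not_gt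
          · exact ⟨⟨h1, by linarith [ht.2, he0 n]⟩, h2⟩
      rw [intervalIntegral.integral_of_le hs0, setIntegral_indicator measurableSet_Iio, hset,
        integral_Ioc_eq_integral_Ioo]
    have h2 := hint t ht
    rw [h1, dist_eq_norm, ← intervalIntegral.integral_add_adjacent_intervals
      (h2.mono_set (by rw [uIcc_of_le hs0, uIcc_of_le ht.1]; exact Icc_subset_Icc_right hst))
      (h2.mono_set (by rw [uIcc_of_le hst, uIcc_of_le ht.1]; exact Icc_subset_Icc_left hs0)),
      add_sub_cancel_left]
    have h3 : ‖∫ τ in s..t, k t τ‖ ≤ ∫ τ in s..t, D * singularWeight b t τ := by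
      refine intervalIntegral.norm_integral_le_of_norm_le hst ?_
        ((intervalIntegrable_singularWeight hb t s t).const_mul D)
      have h4 : ∀ᵐ τ : ℝ, τ ≠ t := by simp [ae_iff]
      filter_upwards [h4] with τ hτ hτ'
      exact hle t τ (hs0.trans_lt hτ'.1) (lt_of_le_of_ne hτ'.2 hτ) ht.2
    refine h3.trans ?_
    rw [intervalIntegral.integral_const_mul]
    refine mul_le_mul_of_nonneg_left ?_ hD
    refine (integral_singularWeight_le hb0 hb hs0 hst).trans ?_
    have := sub_nonneg.2 hst
    gcongr
    linarith [le_max_right 0 (t - e n)]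
  · intro t₀ ht₀
    refine continuousWithinAt_of_dominated (bound := fun τ => D * ((e n) ^ (-b) + τ ^ (-b)))
      ?_ ?_ ?_ ?_
    · filter_upwards [self_mem_nhdsWithin] with t ht
      rw [aestronglyMeasurable_indicator_iff measurableSet_Iio,
        Measure.restrict_restrict measurableSet_Iio]
      refine (hm' t ht).mono_measure (Measure.restrict_mono ?_ le_rfl)
      rintro τ ⟨h1, h2⟩
      exact ⟨h2.1, by linarith [mem_Iio.1 h1, he0 n]⟩
    · filter_upwards [self_mem_nhdsWithin] with t ht
      filter_upwards [ae_restrict_mem measurableSet_Ioc] with τ hτ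
      have h0 : 0 ≤ τ ^ (-b) := Real.rpow_nonneg hτ.1.le _
      have h0' : 0 ≤ e n ^ (-b) := Real.rpow_nonneg (he0 n).le _
      by_cases h : τ ∈ Iio (t - e n)
      · rw [indicator_of_mem h]
        have h' := mem_Iio.1 h
        refine (hle t τ hτ.1 (by linarith [he0 n]) ht.2).trans ?_
        refine mul_le_mul_of_nonneg_left ?_ hD
        refine add_le_add_left ?_ _
        exact Real.rpow_le_rpow_of_nonpos (he0 n) (by linarith) (by linarith)
      · rw [indicator_of_notMem h, norm_zero]; positivity
    · have h1 : IntervalIntegrable (fun τ => D * ((e n) ^ (-b) + τ ^ (-b))) volume 0 T :=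
        (intervalIntegrable_const.add
          (intervalIntegral.intervalIntegrable_rpow' (by linarith))).const_mul D
      exact (intervalIntegrable_iff_integrableOn_Ioc_of_le (ht₀.1.trans ht₀.2)).1 h1
    · have h4 : ∀ᵐ τ : ℝ ∂(volume.restrict (Ioc 0 T)), τ ≠ t₀ - e n :=
        ae_restrict_of_ae (by simp [ae_iff])
      filter_upwards [h4, ae_restrict_mem measurableSet_Ioc] with τ hτ hτ'
      refine ContinuousAt.continuousWithinAt ?_
      rcases lt_or_gt_of_ne hτ with h | h
      · refine (hc t₀ τ hτ'.1 (by linarith [he0 n])).congr ?_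
        filter_upwards [lt_mem_nhds (by linarith : τ + e n < t₀)] with t ht
        rw [indicator_of_mem (mem_Iio.2 (by linarith))]
      · refine (continuousAt_const (y := (0 : Z))).congr ?_
        filter_upwards [gt_mem_nhds (by linarith : t₀ < τ + e n)] with t ht
        rw [indicator_of_notMem (by rw [mem_Iio]; linarith)]


end

/-- A weakly singular Volterra kernel, globally Lipschitz in the unknown. -/
structure IsVolterraKernel {Z : Type*} [NormedAddCommGroup Z]
    (b C T : ℝ) (K : ℝ → ℝ → Z → Z) : Prop where
  lipschitz : ∀ t τ, 0 < τ → τ < t → t ≤ T → ∀ z z',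
    ‖K t τ z - K t τ z'‖ ≤ C * singularWeight b t τ * ‖z - z'‖
  norm_zero : ∀ t τ, 0 < τ → τ < t → t ≤ T → ‖K t τ 0‖ ≤ C * singularWeight b t τ
  continuousAt : ∀ t τ z, 0 < τ → τ < t → ContinuousAt (fun t => K t τ z) t
  measurable : ∀ t ∈ Ioc 0 T, ∀ z : ℝ → Z, ContinuousOn z (Icc 0 T) →
    AEStronglyMeasurable (fun τ => K t τ (z τ)) (volume.restrict (Ioc 0 t))

namespace IsVolterraKernel

variable {Z : Type*} [NormedAddCommGroup Z] {b C T : ℝ} {K : ℝ → ℝ → Z → Z}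

theorem norm_le (hK : IsVolterraKernel b C T K) (hC : 0 ≤ C) {M t τ : ℝ} (h0 : 0 < τ) (h1 : τ < t)
    (h2 : t ≤ T) {z : Z} (hz : ‖z‖ ≤ M) : ‖K t τ z‖ ≤ C * (M + 1) * singularWeight b t τ := by
  have h3 := hK.lipschitz t τ h0 h1 h2 z 0
  rw [sub_zero] at h3
  have h4 := singularWeight_nonneg (b := b) h0.le h1.le
  calc ‖K t τ z‖ = ‖(K t τ z - K t τ 0) + K t τ 0‖ := by rw [sub_add_cancel]
    _ ≤ C * singularWeight b t τ * ‖z‖ + C * singularWeight b t τ :=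
      (norm_add_le _ _).trans (add_le_add h3 (hK.norm_zero t τ h0 h1 h2))
    _ ≤ C * singularWeight b t τ * M + C * singularWeight b t τ := by gcongr
    _ = _ := by ring

theorem intervalIntegrable (hK : IsVolterraKernel b C T K) (hb : b < 1) (hC : 0 ≤ C) {M t : ℝ}
    (ht : t ∈ Ioc 0 T) {z : ℝ → Z} (hz : ∀ τ ∈ Ioc 0 T, ‖z τ‖ ≤ M)
    (hm : AEStronglyMeasurable (fun τ => K t τ (z τ)) (volume.restrict (Ioc 0 t))) :
    IntervalIntegrable (fun τ => K t τ (z τ)) volume 0 t :=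
  intervalIntegrable_of_norm_le_singularWeight hb ht.1.le (fun τ h0 h1 =>
    hK.norm_le hC h0 h1 ht.2 (hz τ ⟨h0, h1.le.trans ht.2⟩)) hm

variable [NormedSpace ℝ Z]

theorem continuousOn_integral (hK : IsVolterraKernel b C T K) (hb0 : 0 ≤ b) (hb : b < 1)
    (hC : 0 ≤ C) {z : ℝ → Z} (hz : ContinuousOn z (Icc 0 T)) :
    ContinuousOn (fun t => ∫ τ in (0 : ℝ)..t, K t τ (z τ)) (Icc 0 T) := by
  obtain ⟨M, hM⟩ := isCompact_Icc.exists_bound_of_continuousOn hz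
  have hM0 : ∀ τ ∈ Ioc 0 T, ‖z τ‖ ≤ |M| := fun τ hτ =>
    (hM τ (Ioc_subset_Icc_self hτ)).trans (le_abs_self M)
  exact continuousOn_integral_of_norm_le_singularWeight hb0 hb
    (by positivity : 0 ≤ C * (|M| + 1))
    (fun t τ h0 h1 h2 => hK.norm_le hC h0 h1 h2 (hM0 τ ⟨h0, h1.le.trans h2⟩))
    (fun t τ h0 h1 => hK.continuousAt t τ (z τ) h0 h1) (fun t ht => hK.measurable t ht z hz)

theorem norm_integral_sub_le (hK : IsVolterraKernel b C T K) (hb : b < 1) {l D t : ℝ}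
    (hl : ∀ t ∈ Icc 0 T,
      ∫ τ in (0 : ℝ)..t, C * (singularWeight b t τ * Real.exp (-(l * (t - τ)))) ≤ 1 / 2)
    (hC : 0 ≤ C) (hD : 0 ≤ D) (ht : t ∈ Ioc 0 T) {z z' : ℝ → Z}
    (hz : IntervalIntegrable (fun τ => K t τ (z τ)) volume 0 t)
    (hz' : IntervalIntegrable (fun τ => K t τ (z' τ)) volume 0 t)
    (hle : ∀ τ ∈ Ioc 0 T, ‖z τ - z' τ‖ ≤ Real.exp (l * τ) * D) :
    ‖(∫ τ in (0 : ℝ)..t, K t τ (z τ)) - ∫ τ in (0 : ℝ)..t, K t τ (z' τ)‖ ≤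
      Real.exp (l * t) * (D / 2) := by
  rw [← intervalIntegral.integral_sub hz hz']
  have h1 : ∀ᵐ τ : ℝ, τ ∈ Ioc 0 t → ‖K t τ (z τ) - K t τ (z' τ)‖ ≤ Real.exp (l * t) * D *
      (C * (singularWeight b t τ * Real.exp (-(l * (t - τ))))) := by
    have h4 : ∀ᵐ τ : ℝ, τ ≠ t := by simp [ae_iff]
    filter_upwards [h4] with τ hτ hτ'
    have h5 : τ < t := lt_of_le_of_ne hτ'.2 hτ
    refine (hK.lipschitz t τ hτ'.1 h5 ht.2 _ _).trans ?_
    have h6 := singularWeight_nonneg (b := b) hτ'.1.le hτ'.2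
    have h7 : Real.exp (l * τ) = Real.exp (l * t) * Real.exp (-(l * (t - τ))) := by
      rw [← Real.exp_add]; congr 1; ring
    calc C * singularWeight b t τ * ‖z τ - z' τ‖
        ≤ C * singularWeight b t τ * (Real.exp (l * τ) * D) := by
          gcongr
          exact hle τ ⟨hτ'.1, hτ'.2.trans ht.2⟩
      _ = _ := by rw [h7]; ring
  refine (intervalIntegral.norm_integral_le_of_norm_le ht.1.le h1 ?_).trans ?_
  · exact (((intervalIntegrable_singularWeight hb t 0 t).mul_continuousOn
      (by fun_prop : Continuous fun τ => Real.exp (-(l * (t - τ)))).continuousOn).const_mul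
        C).const_mul _
  · rw [intervalIntegral.integral_const_mul]
    calc _ ≤ Real.exp (l * t) * D * (1 / 2) := by
          gcongr
          exact hl t (Ioc_subset_Icc_self ht)
      _ = _ := by ring

/-- The supremum D of e^{-lt}‖z - z'‖ over (0,T] is finite and satisfies D ≤ D/2. Continuity is not
used, so this applies to weighted gradients of elements of X_T, of which only boundedness is known.
-/
theorem eqOn (hK : IsVolterraKernel b C T K) (hb0 : 0 ≤ b) (hb : b < 1) (hC : 0 ≤ C)
    {z₀ z z' : ℝ → Z} {M : ℝ}
    (hzM : ∀ τ ∈ Ioc 0 T, ‖z τ‖ ≤ M) (hzM' : ∀ τ ∈ Ioc 0 T, ‖z' τ‖ ≤ M)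
    (hz : ∀ t ∈ Ioc 0 T, IntervalIntegrable (fun τ => K t τ (z τ)) volume 0 t)
    (hz' : ∀ t ∈ Ioc 0 T, IntervalIntegrable (fun τ => K t τ (z' τ)) volume 0 t)
    (heq : ∀ t ∈ Ioc 0 T, z t = z₀ t + ∫ τ in (0 : ℝ)..t, K t τ (z τ))
    (heq' : ∀ t ∈ Ioc 0 T, z' t = z₀ t + ∫ τ in (0 : ℝ)..t, K t τ (z' τ)) :
    EqOn z z' (Ioc 0 T) := by
  obtain ⟨l, hl⟩ := exists_exp_weight hb0 hb hC T
  set d : ℝ → ℝ := fun t => Real.exp (-(l * t)) * ‖z t - z' t‖ with hd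
  have hbdd : BddAbove (d '' Ioc 0 T) := by
    refine ⟨Real.exp (|l| * T) * (2 * M), ?_⟩
    rintro _ ⟨t, ht, rfl⟩
    refine mul_le_mul (Real.exp_le_exp.2 ?_) ?_ (norm_nonneg _) (Real.exp_pos _).le
    · calc -(l * t) = -l * t := by ring
        _ ≤ |l| * t := mul_le_mul_of_nonneg_right (neg_le_abs l) ht.1.le
        _ ≤ |l| * T := mul_le_mul_of_nonneg_left ht.2 (abs_nonneg l)
    · exact (norm_sub_le _ _).trans (by linarith [hzM t ht, hzM' t ht])
  set D := sSup (d '' Ioc 0 T) with hDdef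
  have hdD : ∀ t ∈ Ioc 0 T, d t ≤ D := fun t ht => le_csSup hbdd (mem_image_of_mem d ht)
  intro t ht
  have hD0 : 0 ≤ D := le_trans (by positivity) (hdD t ht)
  have hexp (t : ℝ) : Real.exp (-(l * t)) * Real.exp (l * t) = 1 := by
    rw [← Real.exp_add]; simp
  have hhalf : ∀ s ∈ Ioc 0 T, d s ≤ D / 2 := by
    intro s hs
    have h1 := hK.norm_integral_sub_le hb hl hC hD0 hs (hz s hs) (hz' s hs) fun τ hτ => by
      calc ‖z τ - z' τ‖ = Real.exp (l * τ) * d τ := by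
            rw [hd]; dsimp only; rw [← mul_assoc, mul_comm (Real.exp (l * τ)), hexp, one_mul]
        _ ≤ _ := by gcongr; exact hdD τ hτ
    have h2 : z s - z' s =
        (∫ τ in (0 : ℝ)..s, K s τ (z τ)) - ∫ τ in (0 : ℝ)..s, K s τ (z' τ) := by
      rw [heq s hs, heq' s hs, add_sub_add_left_eq_sub]
    calc d s ≤ Real.exp (-(l * s)) * (Real.exp (l * s) * (D / 2)) := by
          rw [hd]; dsimp only; rw [h2]; gcongr
      _ = D / 2 := by rw [← mul_assoc, hexp, one_mul]
  have hDle : D ≤ D / 2 := by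
    refine csSup_le ⟨d t, mem_image_of_mem d ht⟩ ?_
    rintro _ ⟨s, hs, rfl⟩
    exact hhalf s hs
  have h3 : d t ≤ 0 := (hdD t ht).trans (by linarith)
  have h4 : ‖z t - z' t‖ ≤ 0 := by
    by_contra h
    exact absurd h3 (not_le.2 (mul_pos (Real.exp_pos _) (not_le.1 h)))
  exact sub_eq_zero.1 (norm_le_zero_iff.1 h4)

/-- The fixed point is sought for y = e^{-lt}z in C([0,T], Z): the weighted norm of z is then the
plain sup norm of y, and `E` recovers z from y. -/
theorem exists_solution [CompleteSpace Z] (hK : IsVolterraKernel b C T K) (hb0 : 0 ≤ b)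
    (hb : b < 1) (hC : 0 ≤ C) (hT : 0 ≤ T) {z₀ : ℝ → Z} (hz₀ : ContinuousOn z₀ (Icc 0 T)) :
    ∃ z : ℝ → Z, ContinuousOn z (Icc 0 T) ∧
      ∀ t ∈ Icc 0 T, z t = z₀ t + ∫ τ in (0 : ℝ)..t, K t τ (z τ) := by
  obtain ⟨l, hl⟩ := exists_exp_weight hb0 hb hC T
  set E : C(Icc 0 T, Z) → ℝ → Z := fun y t => Real.exp (l * t) • y (projIcc 0 T hT t) with hE
  have hEc (y : C(Icc 0 T, Z)) : Continuous (E y) :=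
    (by fun_prop : Continuous fun t => Real.exp (l * t)).smul
      (y.continuous.comp continuous_projIcc)
  have hcont (y : C(Icc 0 T, Z)) : ContinuousOn (fun t => Real.exp (-(l * t)) •
      (z₀ t + ∫ τ in (0 : ℝ)..t, K t τ (E y τ))) (Icc 0 T) :=
    (by fun_prop : Continuous fun t => Real.exp (-(l * t))).continuousOn.smul
      (hz₀.add (hK.continuousOn_integral hb0 hb hC (hEc y).continuousOn))
  set Ψ : C(Icc 0 T, Z) → C(Icc 0 T, Z) := fun y =>
    ⟨_, (hcont y).domRestrict⟩ with hΨ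
  have hexp (t : ℝ) : Real.exp (-(l * t)) * Real.exp (l * t) = 1 := by
    rw [← Real.exp_add]; simp
  have hint (y : C(Icc 0 T, Z)) : ∀ t ∈ Ioc 0 T,
      IntervalIntegrable (fun τ => K t τ (E y τ)) volume 0 t := by
    intro t ht
    obtain ⟨M, hM⟩ := isCompact_Icc.exists_bound_of_continuousOn (hEc y).continuousOn (s := Icc 0 T)
    exact hK.intervalIntegrable hb hC ht (fun τ hτ => hM τ (Ioc_subset_Icc_self hτ))
      (hK.measurable t ht _ (hEc y).continuousOn)
  have hΨc : ContractingWith (1 / 2) Ψ := by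
    refine ⟨by rw [div_lt_one (by norm_num)]; norm_num, LipschitzWith.of_dist_le_mul fun y y' => ?_⟩
    rw [ContinuousMap.dist_le (by positivity)]
    rintro ⟨t, ht⟩
    rcases ht.1.eq_or_lt with rfl | h0
    · have h1 : Ψ y ⟨0, ht⟩ = Ψ y' ⟨0, ht⟩ := by simp [hΨ]
      rw [h1, dist_self]; positivity
    have h1 := hK.norm_integral_sub_le hb hl hC (dist_nonneg (x := y) (y := y')) ⟨h0, ht.2⟩
      (hint y t ⟨h0, ht.2⟩) (hint y' t ⟨h0, ht.2⟩) fun τ hτ => by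
        simp only [hE]
        rw [← smul_sub, norm_smul, Real.norm_of_nonneg (Real.exp_pos _).le, ← dist_eq_norm]
        gcongr
        exact ContinuousMap.dist_apply_le_dist _
    have h2 : dist (Ψ y ⟨t, ht⟩) (Ψ y' ⟨t, ht⟩) = Real.exp (-(l * t)) *
        ‖(∫ τ in (0 : ℝ)..t, K t τ (E y τ)) - ∫ τ in (0 : ℝ)..t, K t τ (E y' τ)‖ := by
      simp only [hΨ, ContinuousMap.coe_mk, domRestrict_apply]
      rw [dist_eq_norm, ← smul_sub, norm_smul, Real.norm_of_nonneg (Real.exp_pos _).le,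
        add_sub_add_left_eq_sub]
    rw [h2]
    calc _ ≤ Real.exp (-(l * t)) * (Real.exp (l * t) * (dist y y' / 2)) := by gcongr
      _ = dist y y' / 2 := by rw [← mul_assoc, hexp, one_mul]
      _ = _ := by push_cast; ring
  obtain ⟨y, hy, -⟩ := hΨc.exists_fixedPoint 0 (edist_ne_top _ _)
  refine ⟨E y, (hEc y).continuousOn, fun t ht => ?_⟩
  have h1 : y ⟨t, ht⟩ = Real.exp (-(l * t)) • (z₀ t + ∫ τ in (0 : ℝ)..t, K t τ (E y τ)) := by
    conv_lhs => rw [← hy.eq]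
    simp only [hΨ, ContinuousMap.coe_mk, domRestrict_apply]
  rw [hE]
  dsimp only
  rw [projIcc_of_mem hT ht, h1, smul_smul, mul_comm, hexp, one_smul]

end IsVolterraKernel

end

/-! ### Radial truncation and estimates of the nonlinear terms. -/

noncomputable section

section BallRetraction

variable {E : Type*} [NormedAddCommGroup E] [NormedSpace ℝ E]

/-- The radial retraction onto the closed ball of radius `M`. -/
def ballRetraction (M : ℝ) (u : E) : E := (M / max M ‖u‖) • u

theorem ballRetraction_of_norm_le {M : ℝ} (hM : 0 < M) {u : E} (hu : ‖u‖ ≤ M) :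
    ballRetraction M u = u := by
  rw [ballRetraction, max_eq_left hu, div_self hM.ne', one_smul]

theorem norm_ballRetraction_le {M : ℝ} (hM : 0 < M) (u : E) : ‖ballRetraction M u‖ ≤ M := by
  have h : 0 < max M ‖u‖ := hM.trans_le (le_max_left _ _)
  rw [ballRetraction, norm_smul, Real.norm_of_nonneg (by positivity), div_mul_eq_mul_div,
    div_le_iff₀ h]
  exact mul_le_mul_of_nonneg_left (le_max_right _ _) hM.le

theorem norm_ballRetraction_sub_le {M : ℝ} (hM : 0 < M) (u w : E) :
    ‖ballRetraction M u - ballRetraction M w‖ ≤ 2 * ‖u - w‖ := by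
  have hu : 0 < max M ‖u‖ := hM.trans_le (le_max_left _ _)
  have hw : 0 < max M ‖w‖ := hM.trans_le (le_max_left _ _)
  -- One term changes the vector at a fixed factor, the other changes the factor; each costs ‖u -
  -- w‖, hence the constant 2.
  have h1 : ballRetraction M u - ballRetraction M w =
      (M / max M ‖u‖) • (u - w) + (M / max M ‖u‖ - M / max M ‖w‖) • w := by
    rw [ballRetraction, ballRetraction, smul_sub, sub_smul]; abel
  have h2 : ‖(M / max M ‖u‖) • (u - w)‖ ≤ ‖u - w‖ := by
    rw [norm_smul, Real.norm_of_nonneg (by positivity)]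
    exact mul_le_of_le_one_left (norm_nonneg _) ((div_le_one hu).2 (le_max_left _ _))
  have h3 : ‖(M / max M ‖u‖ - M / max M ‖w‖) • w‖ ≤ ‖u - w‖ := by
    have h4 : M / max M ‖u‖ - M / max M ‖w‖ =
        (max M ‖w‖ - max M ‖u‖) * (M / (max M ‖u‖ * max M ‖w‖)) := by
      field_simp
    have h5 : |max M ‖w‖ - max M ‖u‖| ≤ ‖u - w‖ := by
      refine (abs_max_sub_max_le_abs ‖w‖ ‖u‖ M |>.trans' ?_).trans ?_
      · rw [max_comm M, max_comm M]
      · rw [abs_sub_comm]; exact abs_norm_sub_norm_le u w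
    have h6 : M / (max M ‖u‖ * max M ‖w‖) * ‖w‖ ≤ 1 := by
      rw [div_mul_eq_mul_div, div_le_one (by positivity)]
      exact mul_le_mul (le_max_left _ _) (le_max_right _ _) (norm_nonneg _) hu.le
    rw [norm_smul, h4, norm_mul, Real.norm_eq_abs,
      Real.norm_of_nonneg (by positivity : 0 ≤ M / (max M ‖u‖ * max M ‖w‖)), mul_assoc]
    calc _ ≤ ‖u - w‖ * 1 := by gcongr
      _ = _ := mul_one _
  rw [h1]
  exact (norm_add_le _ _).trans (by linarith)

theorem continuous_ballRetraction {M : ℝ} (hM : 0 < M) :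
    Continuous (ballRetraction M : E → E) :=
  (LipschitzWith.of_dist_le_mul (K := 2) fun u w => by
    rw [dist_eq_norm, dist_eq_norm]; exact_mod_cast norm_ballRetraction_sub_le hM u w).continuous

end BallRetraction

/-- The graph of the convex function x^p lies above its tangent at x; for x > 0 this is Bernoulli's
inequality for y/x. -/
theorem rpow_sub_rpow_le {p x y : ℝ} (hp : 1 ≤ p) (hx : 0 ≤ x) (hy : 0 ≤ y) :
    x ^ p - y ^ p ≤ p * x ^ (p - 1) * (x - y) := by
  rcases hx.eq_or_lt with rfl | hx
  · rw [Real.zero_rpow (by linarith)]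
    rcases hp.eq_or_lt with rfl | hp
    · simp
    · rw [Real.zero_rpow (by linarith)]
      simpa using Real.rpow_nonneg hy p
  have h1 := one_add_mul_self_le_rpow_one_add (s := (y - x) / x)
    (by rw [le_div_iff₀ hx]; linarith) hp
  have h2 : 1 + (y - x) / x = y / x := by field_simp; ring
  rw [h2, Real.div_rpow hy hx.le, le_div_iff₀ (Real.rpow_pos_of_pos hx p)] at h1
  have h3 : x ^ p = x ^ (p - 1) * x := by
    rw [← Real.rpow_add_one hx.ne', sub_add_cancel]
  have h4 : (1 + p * ((y - x) / x)) * x ^ p = x ^ p - p * x ^ (p - 1) * (x - y) := by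
    rw [h3]; field_simp; ring
  linarith

theorem abs_abs_rpow_sub_abs_rpow_le {p : ℝ} (hp : 1 ≤ p) (a b : ℝ) :
    |(|a| ^ p - |b| ^ p)| ≤ p * (|a| ^ (p - 1) + |b| ^ (p - 1)) * |a - b| := by
  have h1 := rpow_sub_rpow_le hp (abs_nonneg a) (abs_nonneg b)
  have h2 := rpow_sub_rpow_le hp (abs_nonneg b) (abs_nonneg a)
  have h3 : |a| - |b| ≤ |a - b| := abs_sub_abs_le_abs_sub a b
  have h4 : |b| - |a| ≤ |a - b| := by rw [abs_sub_comm a b]; exact abs_sub_abs_le_abs_sub b a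
  have ha : 0 ≤ p * |a| ^ (p - 1) := by positivity
  have hb : 0 ≤ p * |b| ^ (p - 1) := by positivity
  have h5 := mul_le_mul_of_nonneg_left h3 ha
  have h6 := mul_le_mul_of_nonneg_left h4 hb
  have h7 := mul_nonneg ha (abs_nonneg (a - b))
  have h8 := mul_nonneg hb (abs_nonneg (a - b))
  rw [abs_le]
  constructor <;> nlinarith

variable {N : ℕ}

theorem holderTriple_two {p : ℝ} (hp : 1 ≤ p) :
    ENNReal.HolderTriple (2 / ENNReal.ofReal (p - 1)) 2 (2 / ENNReal.ofReal p) := by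
  refine ⟨?_⟩
  rw [ENNReal.inv_div (by simp) (by simp), ENNReal.inv_div (by simp) (by simp), ← one_div,
    ENNReal.div_add_div_same, ← ENNReal.ofReal_one, ← ENNReal.ofReal_add (by linarith) zero_le_one,
    sub_add_cancel]

theorem two_le_two_div_ofReal {p : ℝ} (hp2 : p ≤ 2) :
    (2 : ℝ≥0∞) ≤ 2 / ENNReal.ofReal (p - 1) := by
  have h : ENNReal.ofReal (p - 1) ≤ 1 := ENNReal.ofReal_le_one.2 (by linarith)
  calc (2 : ℝ≥0∞) = 2 / 1 := by simp
    _ ≤ _ := ENNReal.div_le_div_left h 2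

theorem memLp_absPow {p : ℝ} (hp : 1 ≤ p) (u : TorusL2 N) :
    MemLp (absPow p u) (2 / ENNReal.ofReal p) (torusMeasure N) := by
  have h := (Lp.memLp u).norm_rpow_div (ENNReal.ofReal p)
  rwa [ENNReal.toReal_ofReal (by linarith)] at h

theorem eLpNorm_abs_rpow_le {p M : ℝ} (hp : 1 ≤ p) {u : TorusL2 N} (hu : ‖u‖ ≤ M) :
    eLpNorm (fun x => |u x| ^ (p - 1)) (2 / ENNReal.ofReal (p - 1)) (torusMeasure N) ≤
      ENNReal.ofReal (M ^ (p - 1)) := by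
  rcases hp.eq_or_lt with rfl | hp
  -- For p = 1 the exponent is ∞ and |u|^0 is the constant 1, also where u vanishes.
  · simp only [sub_self, Real.rpow_zero]
    refine (eLpNorm_le_of_ae_bound (C := 1) (by simp)).trans ?_
    simp
  have hp0 : 0 < p - 1 := by linarith
  have h1 := eLpNorm_norm_rpow (μ := torusMeasure N) (p := 2 / ENNReal.ofReal (p - 1)) (u : _ → ℝ)
    hp0
  rw [ENNReal.div_mul_cancel (by simpa using hp0) (by simp)] at h1
  simp only [Real.norm_eq_abs] at h1
  rw [h1]
  have h2 : eLpNorm u 2 (torusMeasure N) = ENNReal.ofReal ‖u‖ := by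
    rw [Lp.norm_def, ENNReal.ofReal_toReal (Lp.eLpNorm_ne_top u)]
  rw [h2, ENNReal.ofReal_rpow_of_nonneg (norm_nonneg _) hp0.le]
  exact ENNReal.ofReal_le_ofReal (Real.rpow_le_rpow (norm_nonneg _) hu hp0.le)

/-- `u ↦ |u|^p` is Lipschitz on bounded sets from `L²` to `L^{2/p}`. -/
theorem toReal_eLpNorm_absPow_sub_le {p M : ℝ} (hp : 1 ≤ p) (hp2 : p ≤ 2) (hM : 0 ≤ M)
    {u w : TorusL2 N} (hu : ‖u‖ ≤ M) (hw : ‖w‖ ≤ M) :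
    (eLpNorm (fun x => absPow p u x - absPow p w x) (2 / ENNReal.ofReal p)
      (torusMeasure N)).toReal ≤ 2 * p * M ^ (p - 1) * ‖u - w‖ := by
  have := holderTriple_two hp
  set c : UnitAddTorus (Fin N) → ℝ := fun x => |u x| ^ (p - 1) + |w x| ^ (p - 1) with hc
  have hm (u : TorusL2 N) :
      AEStronglyMeasurable (fun x => |u x| ^ (p - 1)) (torusMeasure N) :=
    ((Lp.aestronglyMeasurable u).norm.aemeasurable.pow_const _).aestronglyMeasurable
  have h1 : eLpNorm c (2 / ENNReal.ofReal (p - 1)) (torusMeasure N) ≤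
      ENNReal.ofReal (2 * M ^ (p - 1)) := by
    refine (eLpNorm_add_le (hm u) (hm w)
      (one_le_two.trans (two_le_two_div_ofReal hp2))).trans ?_
    refine (add_le_add (eLpNorm_abs_rpow_le hp hu) (eLpNorm_abs_rpow_le hp hw)).trans_eq ?_
    rw [← ENNReal.ofReal_add (by positivity) (by positivity), two_mul]
  have hcm : AEStronglyMeasurable c (torusMeasure N) := (hm u).add (hm w)
  have h2 : eLpNorm (fun x => absPow p u x - absPow p w x) (2 / ENNReal.ofReal p)
      (torusMeasure N) ≤ ENNReal.ofReal p *
        eLpNorm (c • ((u - w : TorusL2 N) : _ → ℝ)) (2 / ENNReal.ofReal p) (torusMeasure N) := by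
    refine eLpNorm_le_mul_eLpNorm_of_ae_le_mul ?_ _
    filter_upwards [Lp.coeFn_sub u w] with x hx
    have h3 := abs_abs_rpow_sub_abs_rpow_le hp (u x) (w x)
    have h4 : 0 ≤ c x := by simp only [hc]; positivity
    simp only [Pi.smul_apply', hx, Pi.sub_apply, smul_eq_mul, norm_mul, Real.norm_eq_abs,
      absPow, abs_of_nonneg h4]
    rw [← mul_assoc]
    exact h3
  have h5 : eLpNorm (c • ((u - w : TorusL2 N) : _ → ℝ)) (2 / ENNReal.ofReal p) (torusMeasure N) ≤
      ENNReal.ofReal (2 * M ^ (p - 1)) * ENNReal.ofReal ‖u - w‖ := by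
    refine (eLpNorm_smul_le_mul_eLpNorm (p := 2 / ENNReal.ofReal (p - 1)) (q := 2)
      (Lp.aestronglyMeasurable _) hcm).trans ?_
    refine mul_le_mul' h1 (le_of_eq ?_)
    rw [Lp.norm_def, ENNReal.ofReal_toReal (Lp.eLpNorm_ne_top _)]
  refine ENNReal.toReal_le_of_le_ofReal (by positivity) (h2.trans ?_)
  refine (mul_le_mul_right h5 _).trans_eq ?_
  rw [← ENNReal.ofReal_mul (by positivity), ← ENNReal.ofReal_mul (by linarith)]
  congr 1; ring

/-- The pointwise inner product of two vector fields. -/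
def fieldInner (w : UnitAddTorus (Fin N) → EuclideanSpace ℝ (Fin N)) (G : TorusL2Vec N)
    (x : UnitAddTorus (Fin N)) : ℝ :=
  inner ℝ (w x) (G x)

theorem advect_eq_fieldInner (w : UnitAddTorus (Fin N) → EuclideanSpace ℝ (Fin N))
    (f : TorusL2 N) : advect w f = fieldInner w (l2Gradient f) := rfl

theorem eLpNorm_fieldInner_le {p : ℝ} (hp : 1 ≤ p)
    {w : UnitAddTorus (Fin N) → EuclideanSpace ℝ (Fin N)}
    (hw : AEStronglyMeasurable w (torusMeasure N)) (G : TorusL2Vec N) :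
    eLpNorm (fieldInner w G) (2 / ENNReal.ofReal p) (torusMeasure N) ≤
      eLpNorm w (2 / ENNReal.ofReal (p - 1)) (torusMeasure N) * ENNReal.ofReal ‖G‖ := by
  have := holderTriple_two hp
  have h := eLpNorm_le_eLpNorm_mul_eLpNorm_of_nnnorm (p := 2 / ENNReal.ofReal (p - 1)) (q := 2)
    (r := 2 / ENNReal.ofReal p) hw (Lp.aestronglyMeasurable G) (fun a b => inner ℝ a b) 1
    (Eventually.of_forall fun x => by
      simpa using nnnorm_inner_le_nnnorm (𝕜 := ℝ) (w x) (G x))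
  rw [Lp.norm_def, ENNReal.ofReal_toReal (Lp.eLpNorm_ne_top _)]
  simp only [ENNReal.coe_one, one_mul] at h
  exact h

theorem aestronglyMeasurable_fieldInner {w : UnitAddTorus (Fin N) → EuclideanSpace ℝ (Fin N)}
    (hw : AEStronglyMeasurable w (torusMeasure N)) (G : TorusL2Vec N) :
    AEStronglyMeasurable (fieldInner w G) (torusMeasure N) :=
  hw.inner (Lp.aestronglyMeasurable G)

theorem memLp_fieldInner {p : ℝ} (hp : 1 ≤ p)
    {w : UnitAddTorus (Fin N) → EuclideanSpace ℝ (Fin N)}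
    (hw : MemLp w (2 / ENNReal.ofReal (p - 1)) (torusMeasure N)) (G : TorusL2Vec N) :
    MemLp (fieldInner w G) (2 / ENNReal.ofReal p) (torusMeasure N) :=
  ⟨aestronglyMeasurable_fieldInner hw.1 G, (eLpNorm_fieldInner_le hp hw.1 G).trans_lt
    (ENNReal.mul_lt_top hw.2 ENNReal.ofReal_lt_top)⟩

theorem toReal_eLpNorm_fieldInner_le {p B : ℝ} (hp : 1 ≤ p)
    {w : UnitAddTorus (Fin N) → EuclideanSpace ℝ (Fin N)} (hB : 0 ≤ B)
    (hw : AEStronglyMeasurable w (torusMeasure N))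
    (hwB : eLpNorm w (2 / ENNReal.ofReal (p - 1)) (torusMeasure N) ≤ ENNReal.ofReal B)
    (G : TorusL2Vec N) :
    (eLpNorm (fieldInner w G) (2 / ENNReal.ofReal p) (torusMeasure N)).toReal ≤ B * ‖G‖ := by
  refine ENNReal.toReal_le_of_le_ofReal (by positivity)
    ((eLpNorm_fieldInner_le hp hw G).trans ?_)
  rw [ENNReal.ofReal_mul hB]
  gcongr

theorem fieldInner_sub (w : UnitAddTorus (Fin N) → EuclideanSpace ℝ (Fin N))
    (G G' : TorusL2Vec N) :
    fieldInner w (G - G') =ᵐ[torusMeasure N] fun x => fieldInner w G x - fieldInner w G' x := by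
  filter_upwards [Lp.coeFn_sub G G'] with x hx
  rw [fieldInner, hx, Pi.sub_apply, inner_sub_right]; rfl

end

/-! ### Measurability in time of the drift and of the Duhamel integrands. -/

noncomputable section

variable {N : ℕ}

/-- A jointly measurable time-dependent vector field, bounded in `L^q` at every time. -/
structure IsBoundedField (q : ℝ≥0∞) (B : ℝ)
    (v : ℝ → UnitAddTorus (Fin N) → EuclideanSpace ℝ (Fin N)) : Prop where
  stronglyMeasurable : StronglyMeasurable (Function.uncurry v)
  eLpNorm_le : ∀ τ, eLpNorm (v τ) q (torusMeasure N) ≤ ENNReal.ofReal B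

theorem IsBoundedField.aestronglyMeasurable {q : ℝ≥0∞} {B : ℝ}
    {v : ℝ → UnitAddTorus (Fin N) → EuclideanSpace ℝ (Fin N)} (hv : IsBoundedField q B v) (τ : ℝ) :
    AEStronglyMeasurable (v τ) (torusMeasure N) :=
  (hv.stronglyMeasurable.comp_measurable (measurable_prodMk_left (x := τ))).aestronglyMeasurable

theorem IsBoundedField.memLp {q : ℝ≥0∞} {B : ℝ}
    {v : ℝ → UnitAddTorus (Fin N) → EuclideanSpace ℝ (Fin N)} (hv : IsBoundedField q B v) (τ : ℝ) :
    MemLp (v τ) q (torusMeasure N) :=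
  ⟨hv.aestronglyMeasurable τ, (hv.eLpNorm_le τ).trans_lt ENNReal.ofReal_lt_top⟩

/-- The bad times lie in a measurable null set, where the field is replaced by 0, so that bound and
measurability hold at every time. Mild solutions do not notice the change
(`IsMildSolution.congr_field`). -/
theorem IsLInftyLq.exists_boundedField {q : ℝ≥0∞}
    {v : ℝ → UnitAddTorus (Fin N) → EuclideanSpace ℝ (Fin N)} (hv : IsLInftyLq q v) :
    ∃ B : ℝ, 0 ≤ B ∧ ∃ v', IsBoundedField q B v' ∧
      ∀ᵐ τ ∂(volume.restrict (Ioi (0 : ℝ))), v τ =ᵐ[torusMeasure N] v' τ := by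
  obtain ⟨hm, hb⟩ := hv
  set B := essSup (fun t => eLpNorm (v t) q (torusMeasure N)) (volume.restrict (Ioi (0 : ℝ)))
  have h1 : ∀ᵐ τ ∂(volume.restrict (Ioi (0 : ℝ))), eLpNorm (v τ) q (torusMeasure N) ≤ B :=
    ENNReal.ae_le_essSup _
  have h2 : ∀ᵐ τ ∂(volume.restrict (Ioi (0 : ℝ))),
      v τ =ᵐ[torusMeasure N] fun x => hm.mk _ (τ, x) :=
    Measure.ae_ae_of_ae_prod hm.ae_eq_mk
  obtain ⟨s, hs, hsm, hs0⟩ := exists_measurable_superset_of_null (ae_iff.1 (h1.and h2))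
  have hgood : ∀ τ, τ ∉ s → eLpNorm (v τ) q (torusMeasure N) ≤ B ∧
      v τ =ᵐ[torusMeasure N] fun x => hm.mk _ (τ, x) := by
    intro τ hτ
    by_contra h
    exact hτ (hs h)
  classical
  refine ⟨B.toReal, ENNReal.toReal_nonneg, fun τ x => if τ ∈ s then 0 else hm.mk _ (τ, x),
    ⟨?_, fun τ => ?_⟩, ?_⟩
  · exact StronglyMeasurable.ite (p := fun z : ℝ × UnitAddTorus (Fin N) => z.1 ∈ s)
      (measurable_fst hsm) stronglyMeasurable_const hm.stronglyMeasurable_mk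
  · rw [ENNReal.ofReal_toReal hb.ne]
    by_cases hτ : τ ∈ s
    · simp [hτ]
    · simp only [hτ, if_false]
      rw [← eLpNorm_congr_ae (hgood τ hτ).2]
      exact (hgood τ hτ).1
  · have h3 : ∀ᵐ τ ∂(volume.restrict (Ioi (0 : ℝ))), τ ∉ s := measure_eq_zero_iff_ae_notMem.1 hs0
    filter_upwards [h3] with τ hτ
    simp only [hτ, if_false]
    exact (hgood τ hτ).2

theorem secondCountableTopology_torusL2Vec (N : ℕ) : SecondCountableTopology (TorusL2Vec N) := by
  have : Fact ((2 : ℝ≥0∞) ≠ ⊤) := ⟨by simp⟩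
  have : MeasurableSpace.CountablyGenerated (UnitAddTorus (Fin N)) := inferInstance
  have : IsSeparable (torusMeasure N) := inferInstance
  exact MeasureTheory.Lp.SecondCountableTopology

theorem integral_norm_le_toReal_eLpNorm {f : UnitAddTorus (Fin N) → ℝ} {r : ℝ≥0∞} (hr : 1 ≤ r)
    (hf : MemLp f r (torusMeasure N)) :
    ∫ x, ‖f x‖ ∂(torusMeasure N) ≤ (eLpNorm f r (torusMeasure N)).toReal := by
  rw [integral_norm_eq_lintegral_enorm hf.1, ← eLpNorm_one_eq_lintegral_enorm]
  exact ENNReal.toReal_mono hf.2.ne (eLpNorm_le_eLpNorm_of_exponent_le hr hf.1)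

theorem continuous_fourierCoef_fieldInner {w : UnitAddTorus (Fin N) → EuclideanSpace ℝ (Fin N)}
    (hw : MemLp w 2 (torusMeasure N)) (k : Fin N → ℤ) :
    Continuous fun G : TorusL2Vec N => fourierCoef (fieldInner w G) k := by
  have hi (G : TorusL2Vec N) : Integrable (fieldInner w G) (torusMeasure N) := by
    -- Taking p = 2 in the Hölder estimate gives the exponents 2, 2 and 1.
    have h := memLp_fieldInner (p := 2) one_le_two (w := w) (by norm_num; exact hw) G
    exact h.integrable (one_le_two_div_ofReal two_pos le_rfl)
  refine (LipschitzWith.of_dist_le_mul (K := (eLpNorm w 2 (torusMeasure N)).toNNReal)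
    fun G G' => ?_).continuous
  rw [dist_eq_norm, dist_eq_norm, ← fourierCoef_sub (hi G) (hi G'),
    ← fourierCoef_congr (fieldInner_sub w G G')]
  refine (norm_fourierCoef_le _ _).trans ?_
  have h2 := memLp_fieldInner (p := 2) one_le_two (w := w) (by norm_num; exact hw) (G - G')
  refine (integral_norm_le_toReal_eLpNorm (one_le_two_div_ofReal two_pos le_rfl) h2).trans ?_
  refine toReal_eLpNorm_fieldInner_le one_le_two (by positivity) hw.1 ?_ (G - G')
  norm_num
  rw [ENNReal.coe_toNNReal hw.2.ne]

/-- A Carathéodory argument: continuity in G, which ranges over a second countable space, and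
measurability in τ give joint measurability. -/
theorem stronglyMeasurable_fourierCoef_fieldInner {q : ℝ≥0∞} {B : ℝ} (hq : 2 ≤ q)
    {v : ℝ → UnitAddTorus (Fin N) → EuclideanSpace ℝ (Fin N)} (hv : IsBoundedField q B v)
    (k : Fin N → ℤ) [MeasurableSpace (TorusL2Vec N)] [BorelSpace (TorusL2Vec N)] :
    StronglyMeasurable (Function.uncurry fun (G : TorusL2Vec N) (τ : ℝ) =>
      fourierCoef (fieldInner (v τ) G) k) := by
  have := secondCountableTopology_torusL2Vec N
  refine stronglyMeasurable_uncurry_of_continuous_of_stronglyMeasurable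
    (fun τ => continuous_fourierCoef_fieldInner ((hv.memLp τ).mono_exponent hq) k) fun G => ?_
  simp_rw [fourierCoef_eq_integral]
  refine StronglyMeasurable.integral_prod_right'
    (f := fun z : ℝ × UnitAddTorus (Fin N) => mFourier (-k) z.2 * (fieldInner (v z.1) G z.2 : ℂ)) ?_
  refine StronglyMeasurable.mul ?_ ?_
  · exact ((mFourier (-k)).continuous.stronglyMeasurable).comp_measurable measurable_snd
  · exact Complex.continuous_ofReal.comp_stronglyMeasurable
      (hv.stronglyMeasurable.inner ((Lp.stronglyMeasurable G).comp_measurable measurable_snd))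

theorem aestronglyMeasurable_fourierCoef_fieldInner {q : ℝ≥0∞} {B : ℝ} (hq : 2 ≤ q)
    {v : ℝ → UnitAddTorus (Fin N) → EuclideanSpace ℝ (Fin N)} (hv : IsBoundedField q B v)
    {μ : Measure ℝ} {G : ℝ → TorusL2Vec N} (hG : AEStronglyMeasurable G μ) (k : Fin N → ℤ) :
    AEStronglyMeasurable (fun τ => fourierCoef (fieldInner (v τ) (G τ)) k) μ := by
  borelize (TorusL2Vec N)
  have h := stronglyMeasurable_fourierCoef_fieldInner hq hv k
  exact h.aestronglyMeasurable.comp_aemeasurable (f := fun τ => (G τ, τ))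
    (hG.aemeasurable.prodMk aemeasurable_id)

theorem integrable_of_memLp_two_div {p : ℝ} (hp : 1 ≤ p) (hp2 : p ≤ 2)
    {f : UnitAddTorus (Fin N) → ℝ} (hf : MemLp f (2 / ENNReal.ofReal p) (torusMeasure N)) :
    Integrable f (torusMeasure N) :=
  hf.integrable (one_le_two_div_ofReal (by linarith) hp2)

theorem integrable_absPow {p : ℝ} (hp : 1 ≤ p) (hp2 : p ≤ 2) (u : TorusL2 N) :
    Integrable (absPow p u) (torusMeasure N) :=
  integrable_of_memLp_two_div hp hp2 (memLp_absPow hp u)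

theorem integral_norm_absPow_sub_le {p M : ℝ} (hp : 1 ≤ p) (hp2 : p ≤ 2) (hM : 0 ≤ M)
    {u w : TorusL2 N} (hu : ‖u‖ ≤ M) (hw : ‖w‖ ≤ M) :
    ∫ x, ‖absPow p u x - absPow p w x‖ ∂(torusMeasure N) ≤ 2 * p * M ^ (p - 1) * ‖u - w‖ :=
  (integral_norm_le_toReal_eLpNorm (one_le_two_div_ofReal (by linarith) hp2)
    ((memLp_absPow hp u).sub (memLp_absPow hp w))).trans
    (toReal_eLpNorm_absPow_sub_le hp hp2 hM hu hw)

theorem abs_integral_absPow_sub_le {p M : ℝ} (hp : 1 ≤ p) (hp2 : p ≤ 2) (hM : 0 ≤ M)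
    {u w : TorusL2 N} (hu : ‖u‖ ≤ M) (hw : ‖w‖ ≤ M) :
    |(∫ x, absPow p u x ∂(torusMeasure N)) - ∫ x, absPow p w x ∂(torusMeasure N)| ≤
      2 * p * M ^ (p - 1) * ‖u - w‖ := by
  rw [← integral_sub (integrable_absPow hp hp2 u) (integrable_absPow hp hp2 w)]
  exact (norm_integral_le_integral_norm _).trans (integral_norm_absPow_sub_le hp hp2 hM hu hw)

theorem continuous_of_norm_sub_le_on_balls {E F : Type*} [NormedAddCommGroup E]
    [NormedAddCommGroup F] {f : E → F} {L : ℝ → ℝ}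
    (h : ∀ M, 0 ≤ M → ∀ u w, ‖u‖ ≤ M → ‖w‖ ≤ M → ‖f u - f w‖ ≤ L M * ‖u - w‖) :
    Continuous f := by
  refine continuous_iff_continuousAt.2 fun u => ?_
  rw [ContinuousAt, tendsto_iff_norm_sub_tendsto_zero]
  have h1 : Tendsto (fun w => L (‖u‖ + 1) * ‖w - u‖) (𝓝 u) (𝓝 0) := by
    have h2 : Continuous fun w => L (‖u‖ + 1) * ‖w - u‖ := by fun_prop
    simpa using h2.tendsto u
  refine squeeze_zero' (Eventually.of_forall fun _ => norm_nonneg _) ?_ h1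
  have h3 : ∀ᶠ w in 𝓝 u, ‖w‖ < ‖u‖ + 1 := continuous_norm.continuousAt.eventually_lt
    continuousAt_const (by linarith)
  filter_upwards [h3] with w hw
  exact h _ (by positivity) w u hw.le (by linarith)

theorem continuous_integral_absPow {p : ℝ} (hp : 1 ≤ p) (hp2 : p ≤ 2) :
    Continuous fun u : TorusL2 N => ∫ x, absPow p u x ∂(torusMeasure N) :=
  continuous_of_norm_sub_le_on_balls fun _ hM _ _ hu hw =>
    abs_integral_absPow_sub_le hp hp2 hM hu hw

theorem continuous_fourierCoef_absPow {p : ℝ} (hp : 1 ≤ p) (hp2 : p ≤ 2) (k : Fin N → ℤ) :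
    Continuous fun u : TorusL2 N => fourierCoef (absPow p u) k := by
  refine continuous_of_norm_sub_le_on_balls (L := fun M => 2 * p * M ^ (p - 1))
    fun _ hM u w hu hw => ?_
  rw [← fourierCoef_sub (integrable_absPow hp hp2 u) (integrable_absPow hp hp2 w)]
  exact (norm_fourierCoef_le _ _).trans (integral_norm_absPow_sub_le hp hp2 hM hu hw)

/-- Measurability in time of a Duhamel integrand. -/
theorem aestronglyMeasurable_heat {t : ℝ} {f : ℝ → UnitAddTorus (Fin N) → ℝ}
    (hf : ∀ k, AEStronglyMeasurable (fun τ => fourierCoef (f τ) k) (volume.restrict (Ioc 0 t))) :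
    AEStronglyMeasurable (fun τ => heat (t - τ) (f τ)) (volume.restrict (Ioc 0 t)) := by
  -- The endpoint τ = t is discarded: there the heat time is 0 and the data need not be in L².
  rw [← restrict_Ioo_eq_restrict_Ioc] at *
  refine (scalarCoords N).aestronglyMeasurable fun k => ?_
  have hc : Continuous fun τ => (Real.exp (-(laplaceEigenvalue k * (t - τ))) : ℂ) := by fun_prop
  refine (hc.aestronglyMeasurable.mul (hf k)).congr ?_
  filter_upwards [ae_restrict_mem measurableSet_Ioo] with τ hτ
  rw [coord_heat (sub_pos.2 hτ.2)]; rfl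

theorem aestronglyMeasurable_l2Gradient_heat {t : ℝ} {f : ℝ → UnitAddTorus (Fin N) → ℝ}
    (hf : ∀ k, AEStronglyMeasurable (fun τ => fourierCoef (f τ) k) (volume.restrict (Ioc 0 t))) :
    AEStronglyMeasurable (fun τ => l2Gradient (heat (t - τ) (f τ)))
      (volume.restrict (Ioc 0 t)) := by
  rw [← restrict_Ioo_eq_restrict_Ioc] at *
  refine (vectorCoords N).aestronglyMeasurable fun i => ?_
  have hc : Continuous fun τ => 2 * Real.pi * Complex.I * (i.2 i.1 : ℂ) *
    (Real.exp (-(laplaceEigenvalue i.2 * (t - τ))) : ℂ) := by fun_prop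
  refine (hc.aestronglyMeasurable.mul (hf i.2)).congr ?_
  filter_upwards [ae_restrict_mem measurableSet_Ioo] with τ hτ
  rw [coord_l2Gradient_heat (sub_pos.2 hτ.2)]
  exact mul_assoc _ _ _

theorem heat_congr {t : ℝ} {f g : UnitAddTorus (Fin N) → ℝ} (h : f =ᵐ[torusMeasure N] g) :
    heat t f = heat t g := by
  have h1 : heatCoef t f = heatCoef t g := by
    funext k
    rw [heatCoef, heatCoef, fourierCoef_congr h]
  by_cases h2 : Memℓp (heatCoef t f) 2
  · rw [heat_eq_ofCoef h2, heat_eq_ofCoef (h1 ▸ h2)]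
    simp only [h1]
  · rw [heat, dif_neg h2, heat, dif_neg (h1 ▸ h2)]

end

/-! ### The truncated Duhamel kernel. -/

noncomputable section

variable {N : ℕ}

theorem isGradient_zero : IsGradient (0 : TorusL2 N) 0 := by
  rw [isGradient_iff]; intro i; simp

theorem heat_zero_right {t : ℝ} (ht : 0 < t) : heat t (0 : UnitAddTorus (Fin N) → ℝ) = 0 := by
  refine (scalarCoords N).ext fun k => ?_
  rw [coord_heat ht, heatCoef, fourierCoef_eq_integral]
  simp

/-- The spare factor 2 lets this bound and the gradient bound share one constant. -/
theorem norm_heat_sub_le {p s T d : ℝ} (hp1 : 1 ≤ p) (hp2 : p < 2) (hs : 0 < s) (hsT : s ≤ T)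
    {f g : UnitAddTorus (Fin N) → ℝ} (hf : MemLp f (2 / ENNReal.ofReal p) (torusMeasure N))
    (hg : MemLp g (2 / ENNReal.ofReal p) (torusMeasure N))
    (hd : (eLpNorm (fun x => f x - g x) (2 / ENNReal.ofReal p) (torusMeasure N)).toReal ≤ d) :
    ‖heat s f - heat s g‖ ≤
      2 * (1 + √T) ^ (2 * (N * (p - 1) / 4)) * s ^ (-(N * (p - 1) / 4)) * d := by
  rw [← heat_sub hs (integrable_of_memLp_two_div hp1 hp2.le hf)
    (integrable_of_memLp_two_div hp1 hp2.le hg)]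
  refine (norm_heat_le hp1 hp2 hs hsT (hf.sub hg)).trans ?_
  have hd0 : 0 ≤ d := ENNReal.toReal_nonneg.trans hd
  calc _ ≤ (1 + √T) ^ (2 * (N * (p - 1) / 4)) * s ^ (-(N * (p - 1) / 4)) * d := by gcongr; exact hd
    _ ≤ _ := by
      gcongr
      exact le_mul_of_one_le_left (by positivity) one_le_two

theorem norm_l2Gradient_heat_sub_le {p s T d : ℝ} (hp1 : 1 ≤ p) (hp2 : p < 2)
    (hN : N * (p - 1) / 4 ≤ 1) (hs : 0 < s) (hsT : s ≤ T)
    {f g : UnitAddTorus (Fin N) → ℝ} (hf : MemLp f (2 / ENNReal.ofReal p) (torusMeasure N))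
    (hg : MemLp g (2 / ENNReal.ofReal p) (torusMeasure N))
    (hd : (eLpNorm (fun x => f x - g x) (2 / ENNReal.ofReal p) (torusMeasure N)).toReal ≤ d) :
    ‖l2Gradient (heat s f) - l2Gradient (heat s g)‖ ≤
      2 * (1 + √T) ^ (2 * (N * (p - 1) / 4)) * s ^ (-(N * (p - 1) / 4 + 1 / 2)) * d := by
  rw [← l2Gradient_heat_sub hs (integrable_of_memLp_two_div hp1 hp2.le hf)
    (integrable_of_memLp_two_div hp1 hp2.le hg)]
  refine (norm_l2Gradient_heat_le hp1 hp2 hN hs hsT (hf.sub hg)).trans ?_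
  gcongr
  exact hd

/-- √t is the weight of the gradient at time t, and 1/√τ undoes the weight at time τ. If τ ≤ t/2,
then √t is absorbed by (t-τ)^{1/2}, and (t-τ)^{1/2-b} ≤ τ^{1/2-b} because b ≥ 1/2. Otherwise √t is
absorbed by √τ. -/
theorem sqrt_mul_rpow_mul_inv_sqrt_le {b t τ : ℝ} (hb : 1 / 2 ≤ b) (h0 : 0 < τ) (h1 : τ < t) :
    √t * (t - τ) ^ (-b) * (√τ)⁻¹ ≤ 2 * singularWeight b t τ := by
  have hs : 0 < t - τ := sub_pos.2 h1
  have hτ : 0 < √τ := Real.sqrt_pos.2 h0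
  have hA : 0 ≤ (t - τ) ^ (-b) := by positivity
  have hB : 0 ≤ τ ^ (-b) := by positivity
  unfold singularWeight
  rcases le_total τ (t - τ) with h | h
  · have h2 : √t ≤ 2 * √(t - τ) := by
      refine Real.sqrt_le_iff.2 ⟨by positivity, ?_⟩
      rw [mul_pow, Real.sq_sqrt hs.le]; linarith
    have h3 : √(t - τ) * (t - τ) ^ (-b) = (t - τ) ^ (1 / 2 - b) := by
      rw [Real.sqrt_eq_rpow, ← Real.rpow_add hs, ← sub_eq_add_neg]
    have h4 : (t - τ) ^ (1 / 2 - b) ≤ τ ^ (1 / 2 - b) :=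
      Real.rpow_le_rpow_of_nonpos h0 h (by linarith)
    have h5 : τ ^ (1 / 2 - b) * (√τ)⁻¹ = τ ^ (-b) := by
      rw [Real.sqrt_eq_rpow, ← Real.rpow_neg h0.le, ← Real.rpow_add h0]
      congr 1; ring
    calc √t * (t - τ) ^ (-b) * (√τ)⁻¹ ≤ 2 * √(t - τ) * (t - τ) ^ (-b) * (√τ)⁻¹ := by gcongr
      _ = 2 * ((t - τ) ^ (1 / 2 - b) * (√τ)⁻¹) := by rw [← h3]; ring
      _ ≤ 2 * (τ ^ (1 / 2 - b) * (√τ)⁻¹) := by gcongr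
      _ ≤ _ := by rw [h5]; linarith
  · have h2 : √t ≤ 2 * √τ := by
      refine Real.sqrt_le_iff.2 ⟨by positivity, ?_⟩
      rw [mul_pow, Real.sq_sqrt h0.le]; linarith
    calc √t * (t - τ) ^ (-b) * (√τ)⁻¹ ≤ 2 * √τ * (t - τ) ^ (-b) * (√τ)⁻¹ := by gcongr
      _ = 2 * (t - τ) ^ (-b) := by field_simp
      _ ≤ _ := by linarith

/-- The `L²` part of the Duhamel kernel, in terms of `u` and `G = ∇u`. -/
def duhamelKernel (p : ℝ) (v : ℝ → UnitAddTorus (Fin N) → EuclideanSpace ℝ (Fin N)) (t τ : ℝ)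
    (u : TorusL2 N) (G : TorusL2Vec N) : TorusL2 N :=
  heat (t - τ) (absPow p u) - heat (t - τ) (fieldInner (v τ) G) -
    Lp.const 2 (torusMeasure N) (∫ x, absPow p u x ∂(torusMeasure N))

/-- The gradient of the Duhamel kernel. -/
def gradDuhamelKernel (p : ℝ) (v : ℝ → UnitAddTorus (Fin N) → EuclideanSpace ℝ (Fin N)) (t τ : ℝ)
    (u : TorusL2 N) (G : TorusL2Vec N) : TorusL2Vec N :=
  l2Gradient (heat (t - τ) (absPow p u)) - l2Gradient (heat (t - τ) (fieldInner (v τ) G))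

theorem fourierCoef_const {k : Fin N → ℤ} (hk : k ≠ 0) (c : ℝ) :
    fourierCoef (Function.const (UnitAddTorus (Fin N)) c) k = 0 := by
  have h := (torusBasis N).orthonormal.2 hk
  simp only [torusBasis_apply, ContinuousMap.inner_toLp, mFourier_zero, ContinuousMap.one_apply,
    one_mul, ← mFourier_neg] at h
  rw [fourierCoef_eq_integral]
  simp only [Function.const_apply]
  rw [integral_mul_const, h, zero_mul]

/-- This accounts for the absence of the spatial mean from `gradDuhamelKernel`. -/
theorem isGradient_const (c : ℝ) : IsGradient (Lp.const 2 (torusMeasure N) c) 0 := by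
  rw [isGradient_iff]
  intro i
  rw [map_zero, scalarCoords_coord, fourierCoef_congr (Lp.coeFn_const _ _ _)]
  by_cases hi : i.2 = 0
  · simp [hi]
  · rw [fourierCoef_const hi, mul_zero]

theorem isGradient_duhamelKernel (p : ℝ)
    (v : ℝ → UnitAddTorus (Fin N) → EuclideanSpace ℝ (Fin N)) {t τ : ℝ} (h : τ < t)
    (u : TorusL2 N) (G : TorusL2Vec N) :
    IsGradient (duhamelKernel p v t τ u G) (gradDuhamelKernel p v t τ u G) := by
  have hs := sub_pos.2 h
  have h1 := ((isGradient_heat hs (absPow p u)).sub (isGradient_heat hs (fieldInner (v τ) G))).sub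
    (isGradient_const (∫ x, absPow p u x ∂(torusMeasure N)))
  rwa [sub_zero] at h1

theorem norm_duhamelKernel_sub_le {p M B T : ℝ} (hp1 : 1 ≤ p) (hp2 : p < 2)
    (hM : 0 ≤ M) (hB : 0 ≤ B) {v : ℝ → UnitAddTorus (Fin N) → EuclideanSpace ℝ (Fin N)}
    (hv : IsBoundedField (2 / ENNReal.ofReal (p - 1)) B v) {t τ : ℝ} (h0 : 0 < τ) (h1 : τ < t)
    (h2 : t ≤ T) {u u' : TorusL2 N} (hu : ‖u‖ ≤ M) (hu' : ‖u'‖ ≤ M) (G G' : TorusL2Vec N) :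
    ‖duhamelKernel p v t τ u G - duhamelKernel p v t τ u' G'‖ ≤
      2 * (1 + √T) ^ (2 * (N * (p - 1) / 4)) * (t - τ) ^ (-(N * (p - 1) / 4)) *
        (2 * p * M ^ (p - 1) * ‖u - u'‖ + B * ‖G - G'‖) + 2 * p * M ^ (p - 1) * ‖u - u'‖ := by
  have hs := sub_pos.2 h1
  have hsT : t - τ ≤ T := by linarith
  have e1 := norm_heat_sub_le hp1 hp2 hs hsT (memLp_absPow hp1 u) (memLp_absPow hp1 u')
    (toReal_eLpNorm_absPow_sub_le hp1 hp2.le hM hu hu')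
  have hF := toReal_eLpNorm_fieldInner_le hp1 hB (hv.aestronglyMeasurable τ) (hv.eLpNorm_le τ)
    (G - G')
  rw [eLpNorm_congr_ae (fieldInner_sub (v τ) G G')] at hF
  have e2 := norm_heat_sub_le hp1 hp2 hs hsT (memLp_fieldInner hp1 (hv.memLp τ) G)
    (memLp_fieldInner hp1 (hv.memLp τ) G') hF
  have e3 := abs_integral_absPow_sub_le hp1 hp2.le hM hu hu'
  have e4 : ‖Lp.const 2 (torusMeasure N) (∫ x, absPow p u x ∂(torusMeasure N)) -
      Lp.const 2 (torusMeasure N) (∫ x, absPow p u' x ∂(torusMeasure N))‖ ≤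
      2 * p * M ^ (p - 1) * ‖u - u'‖ := by
    rw [← map_sub]
    refine (Lp.norm_const_le _ _ _).trans ?_
    simpa using e3
  have e5 : duhamelKernel p v t τ u G - duhamelKernel p v t τ u' G' =
      (heat (t - τ) (absPow p u) - heat (t - τ) (absPow p u')) -
      (heat (t - τ) (fieldInner (v τ) G) - heat (t - τ) (fieldInner (v τ) G')) -
      (Lp.const 2 (torusMeasure N) (∫ x, absPow p u x ∂(torusMeasure N)) -
      Lp.const 2 (torusMeasure N) (∫ x, absPow p u' x ∂(torusMeasure N))) := by
    unfold duhamelKernel; abel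
  rw [e5]
  refine (norm_sub_le _ _).trans (add_le_add ((norm_sub_le _ _).trans ?_) e4)
  rw [mul_add]
  exact add_le_add e1 e2

theorem norm_gradDuhamelKernel_sub_le {p M B T : ℝ} (hp1 : 1 ≤ p) (hp2 : p < 2)
    (hN : N * (p - 1) / 4 ≤ 1)
    (hM : 0 ≤ M) (hB : 0 ≤ B) {v : ℝ → UnitAddTorus (Fin N) → EuclideanSpace ℝ (Fin N)}
    (hv : IsBoundedField (2 / ENNReal.ofReal (p - 1)) B v) {t τ : ℝ} (h0 : 0 < τ) (h1 : τ < t)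
    (h2 : t ≤ T) {u u' : TorusL2 N} (hu : ‖u‖ ≤ M) (hu' : ‖u'‖ ≤ M) (G G' : TorusL2Vec N) :
    ‖gradDuhamelKernel p v t τ u G - gradDuhamelKernel p v t τ u' G'‖ ≤
      2 * (1 + √T) ^ (2 * (N * (p - 1) / 4)) * (t - τ) ^ (-(N * (p - 1) / 4 + 1 / 2)) *
        (2 * p * M ^ (p - 1) * ‖u - u'‖ + B * ‖G - G'‖) := by
  have hs := sub_pos.2 h1
  have hsT : t - τ ≤ T := by linarith
  have e1 := norm_l2Gradient_heat_sub_le hp1 hp2 hN hs hsT (memLp_absPow hp1 u)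
    (memLp_absPow hp1 u') (toReal_eLpNorm_absPow_sub_le hp1 hp2.le hM hu hu')
  have hF := toReal_eLpNorm_fieldInner_le hp1 hB (hv.aestronglyMeasurable τ) (hv.eLpNorm_le τ)
    (G - G')
  rw [eLpNorm_congr_ae (fieldInner_sub (v τ) G G')] at hF
  have e2 := norm_l2Gradient_heat_sub_le hp1 hp2 hN hs hsT (memLp_fieldInner hp1 (hv.memLp τ) G)
    (memLp_fieldInner hp1 (hv.memLp τ) G') hF
  have e5 : gradDuhamelKernel p v t τ u G - gradDuhamelKernel p v t τ u' G' =
      (l2Gradient (heat (t - τ) (absPow p u)) - l2Gradient (heat (t - τ) (absPow p u'))) -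
      (l2Gradient (heat (t - τ) (fieldInner (v τ) G)) -
        l2Gradient (heat (t - τ) (fieldInner (v τ) G'))) := by
    unfold gradDuhamelKernel; abel
  rw [e5]
  refine (norm_sub_le _ _).trans ?_
  rw [mul_add]
  exact add_le_add e1 e2

/-- The Duhamel kernel with truncated nonlinearity, acting on pairs `(u, t^{1/2} ∇u)`. -/
def truncatedKernel (p M : ℝ) (v : ℝ → UnitAddTorus (Fin N) → EuclideanSpace ℝ (Fin N)) (t τ : ℝ)
    (z : TorusL2 N × TorusL2Vec N) : TorusL2 N × TorusL2Vec N :=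
  (duhamelKernel p v t τ (ballRetraction M z.1) ((√τ)⁻¹ • z.2),
    √t • gradDuhamelKernel p v t τ (ballRetraction M z.1) ((√τ)⁻¹ • z.2))

theorem truncatedKernel_zero {p : ℝ} (hp : 1 ≤ p) (M : ℝ)
    (v : ℝ → UnitAddTorus (Fin N) → EuclideanSpace ℝ (Fin N)) {t τ : ℝ} (h : τ < t) :
    truncatedKernel p M v t τ 0 = 0 := by
  have h1 : absPow p (0 : TorusL2 N) =ᵐ[torusMeasure N] 0 := by
    filter_upwards [Lp.coeFn_zero ℝ 2 (torusMeasure N)] with x hx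
    rw [absPow, hx]
    simp [Real.zero_rpow (by linarith : p ≠ 0)]
  have h2 : fieldInner (v τ) 0 =ᵐ[torusMeasure N] 0 := by
    filter_upwards [Lp.coeFn_zero (EuclideanSpace ℝ (Fin N)) 2 (torusMeasure N)] with x hx
    rw [fieldInner, hx]
    simp
  have h3 : ballRetraction M (0 : TorusL2 N) = 0 := by simp [ballRetraction]
  have h4 : ∫ x, absPow p (0 : TorusL2 N) x ∂(torusMeasure N) = 0 := by
    rw [integral_congr_ae h1]; simp
  simp only [truncatedKernel, duhamelKernel, gradDuhamelKernel, Prod.fst_zero, Prod.snd_zero,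
    smul_zero, h3, heat_congr h1, heat_congr h2, h4, heat_zero_right (sub_pos.2 h),
    isGradient_zero.l2Gradient_eq, map_zero, sub_zero]
  rfl

theorem aestronglyMeasurable_duhamelKernel {p B : ℝ} {q : ℝ≥0∞} (hp1 : 1 ≤ p) (hp2 : p ≤ 2)
    (hq : 2 ≤ q) {v : ℝ → UnitAddTorus (Fin N) → EuclideanSpace ℝ (Fin N)}
    (hv : IsBoundedField q B v) {t : ℝ} {u : ℝ → TorusL2 N} {G : ℝ → TorusL2Vec N}
    (hu : AEStronglyMeasurable u (volume.restrict (Ioc 0 t)))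
    (hG : AEStronglyMeasurable G (volume.restrict (Ioc 0 t))) :
    AEStronglyMeasurable (fun τ => duhamelKernel p v t τ (u τ) (G τ))
      (volume.restrict (Ioc 0 t)) ∧
    AEStronglyMeasurable (fun τ => gradDuhamelKernel p v t τ (u τ) (G τ))
      (volume.restrict (Ioc 0 t)) := by
  have h1 (k : Fin N → ℤ) := (continuous_fourierCoef_absPow hp1 hp2 k).comp_aestronglyMeasurable hu
  have h2 (k : Fin N → ℤ) := aestronglyMeasurable_fourierCoef_fieldInner hq hv hG k
  have h3 := (continuous_integral_absPow hp1 hp2).comp_aestronglyMeasurable hu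
  exact ⟨((aestronglyMeasurable_heat h1).sub (aestronglyMeasurable_heat h2)).sub
    ((Lp.constL 2 (torusMeasure N) ℝ (E := ℝ)).continuous.comp_aestronglyMeasurable h3),
    (aestronglyMeasurable_l2Gradient_heat h1).sub (aestronglyMeasurable_l2Gradient_heat h2)⟩

/-- Retracting u alone suffices: the kernel is affine in G, so its Lipschitz constant in G requires
no bound on G. -/
theorem isVolterraKernel_truncatedKernel {p M B : ℝ} (hp1 : 1 ≤ p) (hp2 : p < 2)
    (hN : N * (p - 1) / 4 ≤ 1) (hM : 0 < M) (hB : 0 ≤ B)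
    {v : ℝ → UnitAddTorus (Fin N) → EuclideanSpace ℝ (Fin N)}
    (hv : IsBoundedField (2 / ENNReal.ofReal (p - 1)) B v) (T : ℝ) :
    ∃ C : ℝ, 0 ≤ C ∧ IsVolterraKernel (N * (p - 1) / 4 + 1 / 2) C T (truncatedKernel p M v) := by
  set a := N * (p - 1) / 4 with ha
  have ha0 : 0 ≤ a := by
    have : 0 ≤ p - 1 := by linarith
    positivity
  set L := 2 * (2 * p * M ^ (p - 1)) with hL
  have hL0 : 0 ≤ L := by positivity
  set C₁ := 2 * (1 + √T) ^ (2 * a) with hC₁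
  have hC₁0 : 0 ≤ C₁ := by positivity
  -- C₁ is the heat constant; L, which includes the Lipschitz constant 2 of the retraction, and B
  -- bound the two nonlinearities; √T pays for extracting 1/√τ; the term with |T| is the spatial
  -- mean; the outer 2 comes from `sqrt_mul_rpow_mul_inv_sqrt_le`.
  refine ⟨2 * (C₁ * (L * √T + B) + L * |T| ^ (a + 1 / 2)), by positivity, ?_, ?_, ?_, ?_⟩
  · intro t τ h0 h1 h2 z z'
    have hs := sub_pos.2 h1
    have ht : 0 < t := h0.trans h1
    have hτ : 0 < √τ := Real.sqrt_pos.2 h0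
    set d := ‖z - z'‖
    set W := √t * (t - τ) ^ (-(a + 1 / 2)) * (√τ)⁻¹ with hW
    have hW0 : 0 ≤ W := by positivity
    have hWle : W ≤ 2 * singularWeight (a + 1 / 2) t τ :=
      sqrt_mul_rpow_mul_inv_sqrt_le (by linarith) h0 h1
    have hd1 : 2 * p * M ^ (p - 1) * ‖ballRetraction M z.1 - ballRetraction M z'.1‖ ≤ L * d := by
      have h3 : ‖z.1 - z'.1‖ ≤ d := norm_fst_le (z - z')
      calc _ ≤ 2 * p * M ^ (p - 1) * (2 * d) := by
            gcongr
            exact (norm_ballRetraction_sub_le hM _ _).trans (by linarith)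
        _ = L * d := by rw [hL]; ring
    have hd2 : ‖(√τ)⁻¹ • z.2 - (√τ)⁻¹ • z'.2‖ ≤ (√τ)⁻¹ * d := by
      rw [← smul_sub, norm_smul, Real.norm_of_nonneg (by positivity)]
      gcongr
      exact norm_snd_le (z - z')
    have hτT : 1 ≤ √T * (√τ)⁻¹ := by
      rw [← div_eq_mul_inv, one_le_div hτ]
      exact Real.sqrt_le_sqrt (h1.le.trans h2)
    have hd3 : 2 * p * M ^ (p - 1) * ‖ballRetraction M z.1 - ballRetraction M z'.1‖ +
        B * ‖(√τ)⁻¹ • z.2 - (√τ)⁻¹ • z'.2‖ ≤ (L * √T + B) * (√τ)⁻¹ * d := by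
      have h3 : L * d ≤ L * d * (√T * (√τ)⁻¹) := le_mul_of_one_le_right (by positivity) hτT
      have h4 := mul_le_mul_of_nonneg_left hd2 hB
      calc _ ≤ L * d * (√T * (√τ)⁻¹) + B * ((√τ)⁻¹ * d) := by linarith
        _ = _ := by ring
    have hpow : (t - τ) ^ (-a) ≤ √t * (t - τ) ^ (-(a + 1 / 2)) := by
      have h3 : (t - τ) ^ (-a) = √(t - τ) * (t - τ) ^ (-(a + 1 / 2)) := by
        rw [Real.sqrt_eq_rpow, ← Real.rpow_add hs]; congr 1; ring
      rw [h3]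
      gcongr
      linarith
    -- The mean carries no heat kernel; multiplying it by this factor fits it under the singular
    -- weight.
    have hone : 1 ≤ |T| ^ (a + 1 / 2) * W := by
      have h3 : 1 ≤ √t * (√τ)⁻¹ := by
        rw [← div_eq_mul_inv, one_le_div hτ]
        exact Real.sqrt_le_sqrt h1.le
      have h4 : 1 ≤ |T| ^ (a + 1 / 2) * (t - τ) ^ (-(a + 1 / 2)) := by
        rw [Real.rpow_neg hs.le, ← div_eq_mul_inv, one_le_div (by positivity)]
        exact Real.rpow_le_rpow hs.le ((by linarith : t - τ ≤ T).trans (le_abs_self T))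
          (by linarith)
      calc (1 : ℝ) = 1 * 1 := (mul_one 1).symm
        _ ≤ (|T| ^ (a + 1 / 2) * (t - τ) ^ (-(a + 1 / 2))) * (√t * (√τ)⁻¹) :=
          mul_le_mul h4 h3 zero_le_one (by positivity)
        _ = _ := by rw [hW]; ring
    have hd0 : 0 ≤ d := norm_nonneg _
    have hfin : (C₁ * (L * √T + B) + L * |T| ^ (a + 1 / 2)) * W * d ≤
        2 * (C₁ * (L * √T + B) + L * |T| ^ (a + 1 / 2)) *
          singularWeight (a + 1 / 2) t τ * d := by
      calc _ ≤ (C₁ * (L * √T + B) + L * |T| ^ (a + 1 / 2)) *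
            (2 * singularWeight (a + 1 / 2) t τ) * d := by gcongr
        _ = _ := by ring
    refine le_trans (max_le ?_ ?_) hfin
    · refine (norm_duhamelKernel_sub_le hp1 hp2 hM.le hB hv h0 h1 h2
        (norm_ballRetraction_le hM _) (norm_ballRetraction_le hM _) _ _).trans ?_
      calc _ ≤ C₁ * (√t * (t - τ) ^ (-(a + 1 / 2))) * ((L * √T + B) * (√τ)⁻¹ * d) +
            L * d * (|T| ^ (a + 1 / 2) * W) := by
            refine add_le_add ?_ (hd1.trans (le_mul_of_one_le_right (by positivity) hone))
            gcongr
        _ = _ := by rw [hW]; ring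
    · change ‖√t • _ - √t • _‖ ≤ _
      rw [← smul_sub, norm_smul, Real.norm_of_nonneg (Real.sqrt_nonneg t)]
      calc _ ≤ √t * (C₁ * (t - τ) ^ (-(a + 1 / 2)) * ((L * √T + B) * (√τ)⁻¹ * d)) := by
            refine mul_le_mul_of_nonneg_left ?_ (Real.sqrt_nonneg t)
            refine (norm_gradDuhamelKernel_sub_le hp1 hp2 hN hM.le hB hv h0 h1 h2
              (norm_ballRetraction_le hM _) (norm_ballRetraction_le hM _) _ _).trans ?_
            gcongr
        _ = C₁ * (L * √T + B) * W * d := by rw [hW]; ring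
        _ ≤ _ := by
            gcongr
            exact le_add_of_nonneg_right (by positivity)
  · intro t τ h0 h1 h2
    rw [truncatedKernel_zero hp1 M v h1, norm_zero]
    have := singularWeight_nonneg (b := a + 1 / 2) h0.le h1.le
    positivity
  · intro t τ z h0 h1
    have hs := sub_pos.2 h1
    have hsub : ContinuousAt (fun t => t - τ) t := by fun_prop
    have c1 (f : UnitAddTorus (Fin N) → ℝ) : ContinuousAt (fun t => heat (t - τ) f) t :=
      (continuousAt_heat hs f).comp (f := fun t => t - τ) hsub
    have c2 (f : UnitAddTorus (Fin N) → ℝ) :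
        ContinuousAt (fun t => l2Gradient (heat (t - τ) f)) t :=
      (continuousAt_l2Gradient_heat hs f).comp (f := fun t => t - τ) hsub
    exact (((c1 _).sub (c1 _)).sub continuousAt_const).prodMk
      (Real.continuous_sqrt.continuousAt.smul ((c2 _).sub (c2 _)))
  · intro t ht z hz
    have hzc : ContinuousOn z (Ioc 0 t) :=
      hz.mono fun τ hτ => ⟨hτ.1.le, hτ.2.trans ht.2⟩
    have hz1 : AEStronglyMeasurable (fun τ => ballRetraction M (z τ).1)
        (volume.restrict (Ioc 0 t)) :=
      ((continuous_ballRetraction hM).comp_continuousOn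
        (continuous_fst.comp_continuousOn hzc)).aestronglyMeasurable measurableSet_Ioc
    have hz2 : AEStronglyMeasurable (fun τ => (√τ)⁻¹ • (z τ).2) (volume.restrict (Ioc 0 t)) := by
      refine ContinuousOn.aestronglyMeasurable ?_ measurableSet_Ioc
      have h1 : ContinuousOn (fun τ => (√τ)⁻¹) (Ioc 0 t) :=
        Real.continuous_sqrt.continuousOn.inv₀ fun τ hτ => (Real.sqrt_pos.2 hτ.1).ne'
      have h2 : ContinuousOn (fun τ => (z τ).2) (Ioc 0 t) := continuous_snd.comp_continuousOn hzc
      exact h1.smul h2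
    obtain ⟨m1, m2⟩ := aestronglyMeasurable_duhamelKernel hp1 hp2.le
      (two_le_two_div_ofReal hp2.le) hv hz1 hz2
    exact m1.prodMk (m2.const_smul (√t))

end

/-! ### Mild solutions and the truncated Volterra equation. -/

noncomputable section

variable {N : ℕ}

/-- The pair `(u, t^{1/2} ∇u)`. -/
def weightedPair (u : ℝ → TorusL2 N) (t : ℝ) : TorusL2 N × TorusL2Vec N :=
  (u t, √t • l2Gradient (u t))

theorem truncatedKernel_of_norm_le {p M : ℝ} (hM : 0 < M)
    (v : ℝ → UnitAddTorus (Fin N) → EuclideanSpace ℝ (Fin N)) (t : ℝ) {τ : ℝ} (hτ : 0 < τ)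
    {u : TorusL2 N} (hu : ‖u‖ ≤ M) (G : TorusL2Vec N) :
    truncatedKernel p M v t τ (u, √τ • G) =
      (duhamelKernel p v t τ u G, √t • gradDuhamelKernel p v t τ u G) := by
  simp only [truncatedKernel]
  rw [ballRetraction_of_norm_le hM hu, inv_smul_smul₀ (Real.sqrt_pos.2 hτ).ne']

theorem intervalIntegral_prodMk {E F : Type*} [NormedAddCommGroup E] [NormedSpace ℝ E]
    [CompleteSpace E] [NormedAddCommGroup F] [NormedSpace ℝ F] [CompleteSpace F] {f : ℝ → E}
    {g : ℝ → F} {s t : ℝ} (hst : s ≤ t) (hf : IntervalIntegrable f volume s t)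
    (hg : IntervalIntegrable g volume s t) :
    ∫ τ in s..t, (f τ, g τ) = (∫ τ in s..t, f τ, ∫ τ in s..t, g τ) := by
  simp only [intervalIntegral.integral_of_le hst]
  exact integral_pair hf.1 hg.1

theorem IsGradient.intervalIntegral {f : ℝ → TorusL2 N} {F : ℝ → TorusL2Vec N} {t : ℝ}
    (ht : 0 ≤ t) (hf : IntervalIntegrable f volume 0 t) (hF : IntervalIntegrable F volume 0 t)
    (h : ∀ τ, 0 < τ → τ < t → IsGradient (f τ) (F τ)) :
    IsGradient (∫ τ in (0 : ℝ)..t, f τ) (∫ τ in (0 : ℝ)..t, F τ) := by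
  simp only [intervalIntegral.integral_of_le ht]
  refine IsGradient.integral hf.1 hF.1 ?_
  rw [← restrict_Ioo_eq_restrict_Ioc]
  filter_upwards [ae_restrict_mem measurableSet_Ioo] with τ hτ using h τ hτ.1 hτ.2

theorem intervalIntegrable_const_Lp {m : ℝ → ℝ} {t : ℝ} (h : IntervalIntegrable m volume 0 t) :
    IntervalIntegrable (fun τ => Lp.const 2 (torusMeasure N) (m τ)) volume 0 t :=
  ⟨(Lp.constL 2 (torusMeasure N) ℝ (E := ℝ)).integrable_comp h.1,
    (Lp.constL 2 (torusMeasure N) ℝ (E := ℝ)).integrable_comp h.2⟩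

theorem intervalIntegral_const_Lp {m : ℝ → ℝ} {t : ℝ} (h : IntervalIntegrable m volume 0 t) :
    ∫ τ in (0 : ℝ)..t, Lp.const 2 (torusMeasure N) (m τ) =
      Lp.const 2 (torusMeasure N) (∫ τ in (0 : ℝ)..t, m τ) :=
  (Lp.constL 2 (torusMeasure N) ℝ (E := ℝ)).intervalIntegral_comp_comm h

theorem aestronglyMeasurable_l2Gradient {u : ℝ → TorusL2 N} {t : ℝ}
    (hu : ContinuousOn u (Ioc 0 t)) (hg : ∀ τ ∈ Ioc 0 t, HasL2Gradient (u τ)) :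
    AEStronglyMeasurable (fun τ => l2Gradient (u τ)) (volume.restrict (Ioc 0 t)) := by
  refine (vectorCoords N).aestronglyMeasurable fun i => ?_
  have h1 : AEStronglyMeasurable
      (fun τ => 2 * Real.pi * Complex.I * (i.2 i.1 : ℂ) * (scalarCoords N).coord i.2 (u τ))
      (volume.restrict (Ioc 0 t)) :=
    ((((scalarCoords N).coord i.2).continuous.comp_continuousOn hu).aestronglyMeasurable
      measurableSet_Ioc).const_mul _
  refine h1.congr ?_
  filter_upwards [ae_restrict_mem measurableSet_Ioc] with τ hτ
  exact (isGradient_iff.1 (hg τ hτ).isGradient i).symm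

section Mild

variable {p M B T : ℝ} {v : ℝ → UnitAddTorus (Fin N) → EuclideanSpace ℝ (Fin N)}
  {u₀ : TorusL2 N}

theorem IsMildSolution.zero {w : ℝ → TorusL2 N} (hw : IsMildSolution p v u₀ T w) : w 0 = u₀ := by
  have h := hw.eq 0 ⟨le_rfl, hw.pos.le⟩
  simpa [heat_zero] using h

theorem IsMildSolution.eq_integral_duhamelKernel {w : ℝ → TorusL2 N}
    (hw : IsMildSolution p v u₀ T w) {t : ℝ} (ht : t ∈ Icc 0 T) :
    IntervalIntegrable (fun τ => duhamelKernel p v t τ (w τ) (l2Gradient (w τ))) volume 0 t ∧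
      w t = heat t u₀ + ∫ τ in (0 : ℝ)..t, duhamelKernel p v t τ (w τ) (l2Gradient (w τ)) := by
  have h1 := hw.integrable_power t ht
  have h2 := hw.integrable_advect t ht
  have h3 := hw.integrable_mean t ht
  simp only [advect_eq_fieldInner] at h2
  have h4 := intervalIntegrable_const_Lp (N := N) h3
  refine ⟨(h1.sub h2).sub h4, ?_⟩
  have h5 := hw.eq t ht
  simp only [advect_eq_fieldInner] at h5
  unfold duhamelKernel
  rw [intervalIntegral.integral_sub (h1.sub h2) h4, intervalIntegral.integral_sub h1 h2,
    intervalIntegral_const_Lp h3, h5]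
  abel

/-- The second component is the gradient of Duhamel's formula. Integrability of the gradient kernel
is not part of being mild; it follows from the X_T bound and the kernel estimate. -/
theorem IsMildSolution.volterra (hp1 : 1 ≤ p) (hp2 : p < 2)
    (hN : N * (p - 1) / 4 < 1 / 2) (hM : 0 < M) (hB : 0 ≤ B)
    (hv : IsBoundedField (2 / ENNReal.ofReal (p - 1)) B v) {w : ℝ → TorusL2 N}
    (hw : IsMildSolution p v u₀ T w) (hX : MemX T w) (hwM : ∀ t ∈ Icc 0 T, ‖w t‖ ≤ M) :
    (∃ M', ∀ t ∈ Ioc 0 T, ‖weightedPair w t‖ ≤ M') ∧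
    (∀ t ∈ Ioc 0 T, IntervalIntegrable (fun τ => truncatedKernel p M v t τ (weightedPair w τ))
      volume 0 t) ∧
    ∀ t ∈ Ioc 0 T, weightedPair w t = weightedPair (fun t => heat t u₀) t +
      ∫ τ in (0 : ℝ)..t, truncatedKernel p M v t τ (weightedPair w τ) := by
  obtain ⟨C, hC, hK⟩ := isVolterraKernel_truncatedKernel hp1 hp2 (by linarith) hM hB hv T
  obtain ⟨hwc, hwg, C', hC'⟩ := hX
  have hbd : ∀ t ∈ Ioc 0 T, ‖weightedPair w t‖ ≤ max M C' := fun t ht => by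
    refine max_le_max (hwM t (Ioc_subset_Icc_self ht)) ?_
    change ‖√t • _‖ ≤ _
    rw [norm_smul, Real.norm_of_nonneg (Real.sqrt_nonneg t), Real.sqrt_eq_rpow]
    exact hC' t ht
  have hker : ∀ t τ, t ∈ Ioc 0 T → τ ∈ Ioc 0 t → truncatedKernel p M v t τ (weightedPair w τ) =
      (duhamelKernel p v t τ (w τ) (l2Gradient (w τ)),
        √t • gradDuhamelKernel p v t τ (w τ) (l2Gradient (w τ))) := fun t τ ht hτ =>
    truncatedKernel_of_norm_le hM v t hτ.1 (hwM τ ⟨hτ.1.le, hτ.2.trans ht.2⟩) _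
  have hmeas : ∀ t ∈ Ioc 0 T,
      AEStronglyMeasurable (fun τ => truncatedKernel p M v t τ (weightedPair w τ))
        (volume.restrict (Ioc 0 t)) := by
    intro t ht
    have hc : ContinuousOn w (Ioc 0 t) := hwc.mono fun τ hτ => ⟨hτ.1.le, hτ.2.trans ht.2⟩
    obtain ⟨m1, m2⟩ := aestronglyMeasurable_duhamelKernel (t := t) hp1 hp2.le
      (two_le_two_div_ofReal hp2.le) hv (hc.aestronglyMeasurable measurableSet_Ioc)
      (aestronglyMeasurable_l2Gradient hc fun τ hτ => hwg τ ⟨hτ.1, hτ.2.trans ht.2⟩)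
    refine (m1.prodMk (m2.const_smul (√t))).congr ?_
    filter_upwards [ae_restrict_mem measurableSet_Ioc] with τ hτ
    exact (hker t τ ht hτ).symm
  have hint : ∀ t ∈ Ioc 0 T, IntervalIntegrable
      (fun τ => truncatedKernel p M v t τ (weightedPair w τ)) volume 0 t := fun t ht =>
    hK.intervalIntegrable (by linarith) hC ht hbd (hmeas t ht)
  refine ⟨⟨_, hbd⟩, hint, fun t ht => ?_⟩
  obtain ⟨h1, h2⟩ := hw.eq_integral_duhamelKernel (Ioc_subset_Icc_self ht)
  have ht0 : √t ≠ 0 := (Real.sqrt_pos.2 ht.1).ne'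
  have h3 : IntervalIntegrable
      (fun τ => √t • gradDuhamelKernel p v t τ (w τ) (l2Gradient (w τ))) volume 0 t := by
    rw [intervalIntegrable_iff_integrableOn_Ioc_of_le ht.1.le]
    have h4 := ((intervalIntegrable_iff_integrableOn_Ioc_of_le ht.1.le).1 (hint t ht)).snd
    refine h4.congr ?_
    filter_upwards [ae_restrict_mem measurableSet_Ioc] with τ hτ
    rw [hker t τ ht hτ]
  have h5 : IntervalIntegrable
      (fun τ => gradDuhamelKernel p v t τ (w τ) (l2Gradient (w τ))) volume 0 t := by
    have h6 := h3.smul (√t)⁻¹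
    refine h6.congr (fun τ _ => ?_)
    exact inv_smul_smul₀ ht0 _
  have h7 := IsGradient.intervalIntegral ht.1.le h1 h5
    fun τ _ hτ => isGradient_duhamelKernel p v hτ (w τ) (l2Gradient (w τ))
  have h8 := ((isGradient_heat ht.1 u₀).add h7).l2Gradient_eq
  rw [← h2] at h8
  have h9 : ∫ τ in (0 : ℝ)..t, truncatedKernel p M v t τ (weightedPair w τ) =
      (∫ τ in (0 : ℝ)..t, duhamelKernel p v t τ (w τ) (l2Gradient (w τ)),
        √t • ∫ τ in (0 : ℝ)..t, gradDuhamelKernel p v t τ (w τ) (l2Gradient (w τ))) := by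
    rw [← intervalIntegral.integral_smul, ← intervalIntegral_prodMk ht.1.le h1 h3]
    refine intervalIntegral.integral_congr_ae (Eventually.of_forall fun τ hτ => ?_)
    rw [uIoc_of_le ht.1.le] at hτ
    exact hker t τ ht hτ
  rw [h9]
  refine Prod.ext ?_ ?_
  · exact h2
  · change √t • l2Gradient (w t) = √t • l2Gradient (heat t u₀) + √t • _
    rw [← smul_add, h8]

theorem IsMildSolution.eqOn_of_boundedField (hp1 : 1 ≤ p) (hp2 : p < 2)
    (hN : N * (p - 1) / 4 < 1 / 2) (hB : 0 ≤ B)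
    (hv : IsBoundedField (2 / ENNReal.ofReal (p - 1)) B v) {w w' : ℝ → TorusL2 N}
    (hw : IsMildSolution p v u₀ T w) (hX : MemX T w)
    (hw' : IsMildSolution p v u₀ T w') (hX' : MemX T w') : EqOn w w' (Icc 0 T) := by
  obtain ⟨M₁, hM₁⟩ := isCompact_Icc.exists_bound_of_continuousOn hw.continuousOn
  obtain ⟨M₂, hM₂⟩ := isCompact_Icc.exists_bound_of_continuousOn hw'.continuousOn
  -- At a level above both solutions, both solve the same truncated equation.
  set M := max (max M₁ M₂) 1
  have hM : 0 < M := lt_of_lt_of_le one_pos (le_max_right _ _)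
  obtain ⟨⟨C₁, hb₁⟩, hi₁, he₁⟩ := hw.volterra hp1 hp2 hN hM hB hv hX fun t ht =>
    (hM₁ t ht).trans ((le_max_left _ _).trans (le_max_left _ _))
  obtain ⟨⟨C₂, hb₂⟩, hi₂, he₂⟩ := hw'.volterra hp1 hp2 hN hM hB hv hX' fun t ht =>
    (hM₂ t ht).trans ((le_max_right _ _).trans (le_max_left _ _))
  obtain ⟨C, hC, hK⟩ := isVolterraKernel_truncatedKernel hp1 hp2 (by linarith) hM hB hv T
  have ha0 : 0 ≤ N * (p - 1) / 4 := by
    have : 0 ≤ p - 1 := by linarith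
    positivity
  have h := hK.eqOn (by linarith) (by linarith) hC
    (fun τ hτ => (hb₁ τ hτ).trans (le_max_left C₁ C₂))
    (fun τ hτ => (hb₂ τ hτ).trans (le_max_right C₁ C₂)) hi₁ hi₂ he₁ he₂
  intro t ht
  rcases ht.1.eq_or_lt with rfl | h0
  · rw [hw.zero, hw'.zero]
  · exact congrArg Prod.fst (h ⟨h0, ht.2⟩)

theorem continuousOn_weightedPair_heat (u₀ : TorusL2 N) (s : Set ℝ) (hs : s ⊆ Ici 0) :
    ContinuousOn (weightedPair fun t => heat t u₀) s :=
  ((continuousOn_heat u₀).mono hs).prodMk ((continuousOn_sqrt_smul_l2Gradient_heat u₀).mono hs)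

theorem intervalIntegrable_heat_absPow (hp1 : 1 ≤ p) (hp2 : p < 2)
    (hN : N * (p - 1) / 4 < 1) (hM : 0 ≤ M) {w : ℝ → TorusL2 N} {t : ℝ} (ht : 0 ≤ t)
    (hw : ContinuousOn w (Icc 0 t)) (hwM : ∀ τ ∈ Icc 0 t, ‖w τ‖ ≤ M) :
    IntervalIntegrable (fun τ => heat (t - τ) (absPow p (w τ))) volume 0 t := by
  have hm : AEStronglyMeasurable (fun τ => heat (t - τ) (absPow p (w τ)))
      (volume.restrict (Ioc 0 t)) := aestronglyMeasurable_heat fun k =>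
    (continuous_fourierCoef_absPow hp1 hp2.le k).comp_aestronglyMeasurable
      ((hw.mono Ioc_subset_Icc_self).aestronglyMeasurable measurableSet_Ioc)
  -- Comparison with the zero function turns the Lipschitz estimate into a growth bound.
  have h0 : absPow p (0 : TorusL2 N) =ᵐ[torusMeasure N] 0 := by
    filter_upwards [Lp.coeFn_zero ℝ 2 (torusMeasure N)] with x hx
    rw [absPow, hx]
    simp [Real.zero_rpow (by linarith : p ≠ 0)]
  set C := 2 * (1 + √t) ^ (2 * (N * (p - 1) / 4))
  refine intervalIntegrable_of_norm_le_singularWeight (b := N * (p - 1) / 4)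
    (D := C * (2 * p * M ^ (p - 1) * M)) hN ht (fun τ h1 h2 => ?_) hm
  have hs := sub_pos.2 h2
  have hτ := hwM τ ⟨h1.le, h2.le⟩
  have h3 := norm_heat_sub_le hp1 hp2 hs (by linarith : t - τ ≤ t) (memLp_absPow hp1 (w τ))
    (memLp_absPow hp1 0) (toReal_eLpNorm_absPow_sub_le hp1 hp2.le hM hτ (by simpa using hM))
  rw [heat_congr h0, heat_zero_right hs, sub_zero, sub_zero] at h3
  refine h3.trans ?_
  have h4 : (t - τ) ^ (-(N * (p - 1) / 4)) ≤ singularWeight (N * (p - 1) / 4) t τ :=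
    le_add_of_nonneg_right (Real.rpow_nonneg h1.le _)
  calc _ ≤ C * singularWeight (N * (p - 1) / 4) t τ * (2 * p * M ^ (p - 1) * M) := by
        have := singularWeight_nonneg (b := N * (p - 1) / 4) h1.le h2.le
        gcongr
    _ = _ := by ring

/-- A solution of the truncated Volterra equation is a mild solution as long as it does not
exceed the truncation level. -/
theorem isMildSolution_of_volterra (hp1 : 1 ≤ p) (hp2 : p < 2)
    (hN : N * (p - 1) / 4 < 1 / 2) (hM : 0 < M) (hB : 0 ≤ B)
    (hv : IsBoundedField (2 / ENNReal.ofReal (p - 1)) B v)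
    {z : ℝ → TorusL2 N × TorusL2Vec N} (hz : ContinuousOn z (Icc 0 T))
    (heq : ∀ t ∈ Icc 0 T, z t = weightedPair (fun t => heat t u₀) t +
      ∫ τ in (0 : ℝ)..t, truncatedKernel p M v t τ (z τ))
    {T' : ℝ} (hT'0 : 0 < T') (hT' : T' ≤ T) (hzM : ∀ t ∈ Icc 0 T', ‖(z t).1‖ ≤ M) :
    IsMildSolution p v u₀ T' (fun t => (z t).1) ∧ MemX T' (fun t => (z t).1) := by
  obtain ⟨C, hC, hK⟩ := isVolterraKernel_truncatedKernel hp1 hp2 (by linarith) hM hB hv T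
  obtain ⟨R, hR⟩ := isCompact_Icc.exists_bound_of_continuousOn hz
  have hint : ∀ t ∈ Ioc 0 T,
      IntervalIntegrable (fun τ => truncatedKernel p M v t τ (z τ)) volume 0 t := fun t ht =>
    hK.intervalIntegrable (by linarith) hC ht (fun τ hτ => hR τ (Ioc_subset_Icc_self hτ))
      (hK.measurable t ht z hz)
  have hcont : ContinuousOn (fun t => (z t).1) (Icc 0 T') :=
    continuous_fst.comp_continuousOn (hz.mono (Icc_subset_Icc_right hT'))
  have hcomp : ∀ t ∈ Ioc 0 T,
      IntervalIntegrable (fun τ => (truncatedKernel p M v t τ (z τ)).1) volume 0 t ∧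
      IntervalIntegrable (fun τ => (truncatedKernel p M v t τ (z τ)).2) volume 0 t ∧
      (z t).1 = heat t u₀ + ∫ τ in (0 : ℝ)..t, (truncatedKernel p M v t τ (z τ)).1 ∧
      (z t).2 = √t • l2Gradient (heat t u₀) +
        ∫ τ in (0 : ℝ)..t, (truncatedKernel p M v t τ (z τ)).2 := by
    intro t ht
    have h0 := (intervalIntegrable_iff_integrableOn_Ioc_of_le ht.1.le).1 (hint t ht)
    have h1 : IntervalIntegrable (fun τ => (truncatedKernel p M v t τ (z τ)).1) volume 0 t :=
      (intervalIntegrable_iff_integrableOn_Ioc_of_le ht.1.le).2 h0.fst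
    have h2 : IntervalIntegrable (fun τ => (truncatedKernel p M v t τ (z τ)).2) volume 0 t :=
      (intervalIntegrable_iff_integrableOn_Ioc_of_le ht.1.le).2 h0.snd
    have h3 := heq t (Ioc_subset_Icc_self ht)
    have h4 := intervalIntegral_prodMk ht.1.le h1 h2
    simp only [Prod.mk.eta] at h4
    rw [h4] at h3
    exact ⟨h1, h2, congrArg Prod.fst h3, congrArg Prod.snd h3⟩
  -- That the second component is √t times the gradient of the first is a consequence of the
  -- equation, because the kernel has this structure; it holds even where the truncation acts.
  have hgrad : ∀ t ∈ Ioc 0 T, IsGradient (z t).1 ((√t)⁻¹ • (z t).2) := by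
    intro t ht
    obtain ⟨h1, h2, h3, h4⟩ := hcomp t ht
    have ht0 : √t ≠ 0 := (Real.sqrt_pos.2 ht.1).ne'
    have h5 := IsGradient.intervalIntegral ht.1.le h1 (h2.smul (√t)⁻¹) fun τ _ hτ => by
      have h6 := isGradient_duhamelKernel p v hτ (ballRetraction M (z τ).1) ((√τ)⁻¹ • (z τ).2)
      simp only [truncatedKernel, Pi.smul_apply, inv_smul_smul₀ ht0]
      exact h6
    have h7 := (isGradient_heat ht.1 u₀).add h5
    rw [h3, h4, smul_add, inv_smul_smul₀ ht0]
    simp only [Pi.smul_apply, intervalIntegral.integral_smul] at h7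
    exact h7
  have hIoc : Ioc 0 T' ⊆ Ioc 0 T := Ioc_subset_Ioc_right hT'
  have hgrad' : ∀ t ∈ Ioc 0 T', l2Gradient (z t).1 = (√t)⁻¹ • (z t).2 := fun t ht =>
    (hgrad t (hIoc ht)).l2Gradient_eq
  have hhas : ∀ t ∈ Ioc 0 T', HasL2Gradient (z t).1 := fun t ht => ⟨_, hgrad t (hIoc ht)⟩
  have hker : ∀ t τ, t ∈ Ioc 0 T' → τ ∈ Ioc 0 t → (truncatedKernel p M v t τ (z τ)).1 =
      duhamelKernel p v t τ (z τ).1 (l2Gradient (z τ).1) := by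
    intro t τ ht hτ
    have hτ' : τ ∈ Ioc 0 T' := ⟨hτ.1, hτ.2.trans ht.2⟩
    simp only [truncatedKernel]
    rw [ballRetraction_of_norm_le hM (hzM τ (Ioc_subset_Icc_self hτ')), hgrad' τ hτ']
  have hpow : ∀ t ∈ Icc 0 T', IntervalIntegrable (fun τ => heat (t - τ) (absPow p (z τ).1))
      volume 0 t := fun t ht =>
    intervalIntegrable_heat_absPow hp1 hp2 (by linarith) hM.le ht.1
      (hcont.mono (Icc_subset_Icc_right ht.2)) fun τ hτ => hzM τ ⟨hτ.1, hτ.2.trans ht.2⟩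
  have hmean : ∀ t ∈ Icc 0 T',
      IntervalIntegrable (fun τ => ∫ x, absPow p (z τ).1 x ∂(torusMeasure N)) volume 0 t := by
    intro t ht
    refine ContinuousOn.intervalIntegrable ?_
    rw [uIcc_of_le ht.1]
    exact (continuous_integral_absPow hp1 hp2.le).comp_continuousOn
      (hcont.mono (Icc_subset_Icc_right ht.2))
  have hduh : ∀ t ∈ Ioc 0 T', IntervalIntegrable
      (fun τ => duhamelKernel p v t τ (z τ).1 (l2Gradient (z τ).1)) volume 0 t := by
    intro t ht
    refine (hcomp t (hIoc ht)).1.congr ?_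
    rw [uIoc_of_le ht.1.le]
    exact fun τ hτ => hker t τ ht hτ
  -- The drift term is the power term minus the mean minus the whole Duhamel kernel, all three of
  -- which are already known to be integrable.
  have hadv : ∀ t ∈ Icc 0 T',
      IntervalIntegrable (fun τ => heat (t - τ) (advect (v τ) (z τ).1)) volume 0 t := by
    intro t ht
    rcases ht.1.eq_or_lt with rfl | h0
    · exact IntervalIntegrable.refl
    have h1 := ((hpow t ht).sub (intervalIntegrable_const_Lp (N := N) (hmean t ht))).sub
      (hduh t ⟨h0, ht.2⟩)
    refine h1.congr fun τ _ => ?_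
    simp only [duhamelKernel, advect_eq_fieldInner]
    abel
  refine ⟨⟨hT'0, hcont, hhas, hpow, hadv, hmean, fun t ht => ?_⟩, hcont, hhas, R, fun t ht => ?_⟩
  · rcases ht.1.eq_or_lt with rfl | h0
    · have h1 := congrArg Prod.fst (heq 0 ⟨le_rfl, ht.1.trans (ht.2.trans hT')⟩)
      simpa [weightedPair] using h1
    obtain ⟨-, -, h3, -⟩ := hcomp t ⟨h0, ht.2.trans hT'⟩
    have h4 : ∫ τ in (0 : ℝ)..t, (truncatedKernel p M v t τ (z τ)).1 =
        ∫ τ in (0 : ℝ)..t, duhamelKernel p v t τ (z τ).1 (l2Gradient (z τ).1) := by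
      refine intervalIntegral.integral_congr_ae (Eventually.of_forall fun τ hτ => ?_)
      rw [uIoc_of_le ht.1] at hτ
      exact hker t τ ⟨h0, ht.2⟩ hτ
    have h5 := hadv t ht
    have h6 := intervalIntegrable_const_Lp (N := N) (hmean t ht)
    rw [h3, h4]
    unfold duhamelKernel
    simp only [advect_eq_fieldInner] at h5 ⊢
    rw [intervalIntegral.integral_sub ((hpow t ht).sub h5) h6,
      intervalIntegral.integral_sub (hpow t ht) h5, intervalIntegral_const_Lp (hmean t ht)]
    abel
  · have ht0 : 0 < √t := Real.sqrt_pos.2 ht.1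
    dsimp only
    rw [hgrad' t ht, ← Real.sqrt_eq_rpow, norm_smul, norm_inv, Real.norm_of_nonneg ht0.le,
      mul_inv_cancel_left₀ ht0.ne']
    exact (norm_snd_le _).trans (hR t ⟨ht.1.le, ht.2.trans hT'⟩)

end Mild

end

/-! ### The maximal solution and the blow-up alternative. -/

noncomputable section

variable {N : ℕ} {p M B T : ℝ} {v v' : ℝ → UnitAddTorus (Fin N) → EuclideanSpace ℝ (Fin N)}
  {u₀ : TorusL2 N} {u w : ℝ → TorusL2 N}

theorem IsMildSolution.mono (h : IsMildSolution p v u₀ T u) {T' : ℝ} (h0 : 0 < T') (hT : T' ≤ T) :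
    IsMildSolution p v u₀ T' u := by
  have h1 : Icc 0 T' ⊆ Icc 0 T := Icc_subset_Icc_right hT
  exact ⟨h0, h.continuousOn.mono h1, fun t ht => h.hasGradient t ⟨ht.1, ht.2.trans hT⟩,
    fun t ht => h.integrable_power t (h1 ht), fun t ht => h.integrable_advect t (h1 ht),
    fun t ht => h.integrable_mean t (h1 ht), fun t ht => h.eq t (h1 ht)⟩

theorem MemX.mono (h : MemX T u) {T' : ℝ} (hT : T' ≤ T) : MemX T' u := by
  obtain ⟨h1, h2, C, h3⟩ := h
  have h4 : Ioc 0 T' ⊆ Ioc 0 T := Ioc_subset_Ioc_right hT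
  exact ⟨h1.mono (Icc_subset_Icc_right hT), fun t ht => h2 t (h4 ht), C, fun t ht => h3 t (h4 ht)⟩

theorem IsMildSolution.congr (h : IsMildSolution p v u₀ T u) (huw : EqOn u w (Icc 0 T)) :
    IsMildSolution p v u₀ T w := by
  have hτ : ∀ t ∈ Icc 0 T, ∀ τ ∈ uIoc 0 t, u τ = w τ := by
    intro t ht τ hτ
    rw [uIoc_of_le ht.1] at hτ
    exact huw ⟨hτ.1.le, hτ.2.trans ht.2⟩
  refine ⟨h.pos, h.continuousOn.congr huw.symm, fun t ht => ?_, fun t ht => ?_, fun t ht => ?_,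
    fun t ht => ?_, fun t ht => ?_⟩
  · rw [← huw (Ioc_subset_Icc_self ht)]; exact h.hasGradient t ht
  · exact (h.integrable_power t ht).congr fun τ h' => by simp only [hτ t ht τ h']
  · exact (h.integrable_advect t ht).congr fun τ h' => by simp only [hτ t ht τ h']
  · exact (h.integrable_mean t ht).congr fun τ h' => by simp only [hτ t ht τ h']
  · rw [← huw ht, h.eq t ht]
    congr 1
    · congr 1
      · congr 1
        exact intervalIntegral.integral_congr_ae (Eventually.of_forall fun τ h' => by
          simp only [hτ t ht τ h'])
      · exact intervalIntegral.integral_congr_ae (Eventually.of_forall fun τ h' => by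
          simp only [hτ t ht τ h'])
    · congr 1
      exact intervalIntegral.integral_congr_ae (Eventually.of_forall fun τ h' => by
        simp only [hτ t ht τ h'])

theorem MemX.congr (h : MemX T u) (huw : EqOn u w (Icc 0 T)) : MemX T w := by
  obtain ⟨h1, h2, C, h3⟩ := h
  refine ⟨h1.congr huw.symm, fun t ht => ?_, C, fun t ht => ?_⟩
  · rw [← huw (Ioc_subset_Icc_self ht)]; exact h2 t ht
  · rw [← huw (Ioc_subset_Icc_self ht)]; exact h3 t ht

/-- The drift enters only through time integrals and through its almost everywhere class in space.
-/
theorem IsMildSolution.congr_field (h : IsMildSolution p v u₀ T u)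
    (hv : ∀ᵐ τ ∂(volume.restrict (Ioi (0 : ℝ))), v τ =ᵐ[torusMeasure N] v' τ) :
    IsMildSolution p v' u₀ T u := by
  have h1 : ∀ t, 0 ≤ t → ∀ᵐ τ : ℝ, τ ∈ uIoc 0 t →
      heat (t - τ) (advect (v τ) (u τ)) = heat (t - τ) (advect (v' τ) (u τ)) := by
    intro t ht
    filter_upwards [(ae_restrict_iff' measurableSet_Ioi).1 hv] with τ hτ hτ'
    rw [uIoc_of_le ht] at hτ'
    refine heat_congr ?_
    filter_upwards [hτ hτ'.1] with x hx
    rw [advect, advect, hx]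
  refine ⟨h.pos, h.continuousOn, h.hasGradient, h.integrable_power, fun t ht => ?_,
    h.integrable_mean, fun t ht => ?_⟩
  · exact (h.integrable_advect t ht).congr_ae
      ((ae_restrict_iff' measurableSet_uIoc).2 (h1 t ht.1))
  · rw [← intervalIntegral.integral_congr_ae (h1 t ht.1)]
    exact h.eq t ht

/-- A mild solution in the class `X_T`. -/
def IsSolution (p : ℝ) (v : ℝ → UnitAddTorus (Fin N) → EuclideanSpace ℝ (Fin N))
    (u₀ : TorusL2 N) (T : ℝ) (u : ℝ → TorusL2 N) : Prop :=
  IsMildSolution p v u₀ T u ∧ MemX T u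

theorem IsSolution.le_maximalTime (h : IsSolution p v u₀ T u) :
    ENNReal.ofReal T ≤ maximalTime p v u₀ :=
  le_sSup ⟨T, u, h.1, h.2, rfl⟩

theorem exists_isSolution_of_lt_maximalTime (h0 : 0 ≤ T)
    (h : ENNReal.ofReal T < maximalTime p v u₀) :
    ∃ T', T < T' ∧ ∃ u, IsSolution p v u₀ T' u := by
  obtain ⟨_, ⟨T', u, h1, h2, rfl⟩, h3⟩ := lt_sSup_iff.1 h
  exact ⟨T', (ENNReal.ofReal_lt_ofReal_iff_of_nonneg h0).1 h3, u, h1, h2⟩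

/-- Subcriticality of the exponent and boundedness of the drift. -/
structure IsAdmissible (p B : ℝ) (v : ℝ → UnitAddTorus (Fin N) → EuclideanSpace ℝ (Fin N)) :
    Prop where
  one_le : 1 ≤ p
  lt_two : p < 2
  subcritical : N * (p - 1) / 4 < 1 / 2
  nonneg : 0 ≤ B
  field : IsBoundedField (2 / ENNReal.ofReal (p - 1)) B v

theorem IsSolution.eqOn (ha : IsAdmissible p B v) {T' : ℝ} (hu : IsSolution p v u₀ T u)
    (hw : IsSolution p v u₀ T' w) : EqOn u w (Icc 0 (min T T')) := by
  have h0 : 0 < min T T' := lt_min hu.1.pos hw.1.pos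
  exact (hu.1.mono h0 (min_le_left _ _)).eqOn_of_boundedField ha.one_le ha.lt_two ha.subcritical
    ha.nonneg ha.field (hu.2.mono (min_le_left _ _)) (hw.1.mono h0 (min_le_right _ _))
    (hw.2.mono (min_le_right _ _))

theorem IsAdmissible.exists_truncated (ha : IsAdmissible p B v) (hM : 0 < M) (hT : 0 ≤ T)
    (u₀ : TorusL2 N) : ∃ z : ℝ → TorusL2 N × TorusL2Vec N, ContinuousOn z (Icc 0 T) ∧
      ∀ t ∈ Icc 0 T, z t = weightedPair (fun t => heat t u₀) t +
        ∫ τ in (0 : ℝ)..t, truncatedKernel p M v t τ (z τ) := by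
  have h1 := ha.subcritical
  obtain ⟨C, hC, hK⟩ := isVolterraKernel_truncatedKernel ha.one_le ha.lt_two (by linarith) hM
    ha.nonneg ha.field T
  have ha0 : 0 ≤ N * (p - 1) / 4 := by
    have : 0 ≤ p - 1 := by linarith [ha.one_le]
    positivity
  exact hK.exists_solution (by linarith) (by linarith) hC hT
    (continuousOn_weightedPair_heat u₀ _ fun t ht => ht.1)

/-- A solution of the truncated equation agrees with a solution below the truncation level. -/
theorem IsSolution.eqOn_truncated (ha : IsAdmissible p B v) (hM : 0 < M)
    (hu : IsSolution p v u₀ T u) (huM : ∀ t ∈ Icc 0 T, ‖u t‖ ≤ M) {T' : ℝ} (hT : T ≤ T')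
    {z : ℝ → TorusL2 N × TorusL2Vec N} (hz : ContinuousOn z (Icc 0 T'))
    (heq : ∀ t ∈ Icc 0 T', z t = weightedPair (fun t => heat t u₀) t +
        ∫ τ in (0 : ℝ)..t, truncatedKernel p M v t τ (z τ)) :
    ∀ t ∈ Ioc 0 T, u t = (z t).1 := by
  have h1 := ha.subcritical
  obtain ⟨C, hC, hK⟩ := isVolterraKernel_truncatedKernel ha.one_le ha.lt_two (by linarith) hM
    ha.nonneg ha.field T
  have ha0 : 0 ≤ N * (p - 1) / 4 := by
    have : 0 ≤ p - 1 := by linarith [ha.one_le]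
    positivity
  obtain ⟨⟨C₁, hb₁⟩, hi₁, he₁⟩ := hu.1.volterra ha.one_le ha.lt_two h1 hM ha.nonneg ha.field
    hu.2 huM
  have hzT : ContinuousOn z (Icc 0 T) := hz.mono (Icc_subset_Icc_right hT)
  obtain ⟨R, hR⟩ := isCompact_Icc.exists_bound_of_continuousOn hzT
  have hR' : ∀ τ ∈ Ioc 0 T, ‖z τ‖ ≤ R := fun τ hτ => hR τ (Ioc_subset_Icc_self hτ)
  intro t ht
  exact congrArg Prod.fst (hK.eqOn (by linarith) (by linarith) hC
    (fun τ hτ => (hb₁ τ hτ).trans (le_max_left C₁ R))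
    (fun τ hτ => (hR' τ hτ).trans (le_max_right C₁ R)) hi₁
    (fun t ht => hK.intervalIntegrable (by linarith) hC ht hR' (hK.measurable t ht z hzT)) he₁
    (fun t ht => heq t ⟨ht.1.le, ht.2.trans hT⟩) ht)

/-- Local existence. -/
theorem IsAdmissible.maximalTime_pos (ha : IsAdmissible p B v) (u₀ : TorusL2 N) :
    0 < maximalTime p v u₀ := by
  have hM : 0 < ‖u₀‖ + 1 := by positivity
  obtain ⟨z, hz, heq⟩ := ha.exists_truncated hM zero_le_one u₀
  have hz0 : (z 0).1 = u₀ := by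
    have h := congrArg Prod.fst (heq 0 ⟨le_rfl, zero_le_one⟩)
    simpa [weightedPair, heat_zero] using h
  have hc : ContinuousWithinAt (fun t => ‖(z t).1‖) (Icc 0 1) 0 :=
    (continuous_norm.comp continuous_fst).continuousAt.comp_continuousWithinAt
      (hz 0 ⟨le_rfl, zero_le_one⟩)
  have hev : ∀ᶠ t in 𝓝[≥] (0 : ℝ), ‖(z t).1‖ < ‖u₀‖ + 1 := by
    rw [← nhdsWithin_Icc_eq_nhdsGE zero_lt_one]
    refine hc.eventually (gt_mem_nhds ?_)
    dsimp only
    rw [hz0]; linarith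
  obtain ⟨d, hd0, hd⟩ := (mem_nhdsGE_iff_exists_Icc_subset).1 hev
  have hd1 : 0 < min d 1 := lt_min hd0 one_pos
  have h := isMildSolution_of_volterra ha.one_le ha.lt_two ha.subcritical hM ha.nonneg ha.field hz
    heq hd1 (min_le_right _ _) fun t ht => (hd ⟨ht.1, ht.2.trans (min_le_left _ _)⟩).le
  exact (ENNReal.ofReal_pos.2 hd1).trans_le (IsSolution.le_maximalTime h)

/-- A solution that stays bounded up to a finite time extends past it. -/
theorem IsAdmissible.lt_maximalTime_of_bounded (ha : IsAdmissible p B v) (hT : 0 < T)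
    (hu : ∀ t, 0 < t → t < T → IsSolution p v u₀ t u) (hM : ∀ t ∈ Ico 0 T, ‖u t‖ ≤ M) :
    ENNReal.ofReal T < maximalTime p v u₀ := by
  have hM0 : 0 ≤ M := (norm_nonneg _).trans (hM 0 ⟨le_rfl, hT⟩)
  have hM1 : 0 < M + 1 := by linarith
  -- The spare 1 in the level keeps the truncation inactive slightly beyond T; the spare 1 in time
  -- gives room to continue.
  obtain ⟨z, hz, heq⟩ := ha.exists_truncated hM1 (by linarith : 0 ≤ T + 1) u₀
  have huz : ∀ t ∈ Ioo 0 T, ‖(z t).1‖ ≤ M := by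
    intro t ht
    have h1 := (hu t ht.1 ht.2).eqOn_truncated ha hM1
      (fun s hs => (hM s ⟨hs.1, hs.2.trans_lt ht.2⟩).trans (by linarith)) (by linarith [ht.2]) hz heq
      t ⟨ht.1, le_rfl⟩
    rw [← h1]
    exact hM t ⟨ht.1.le, ht.2⟩
  have hzc : ContinuousOn (fun t => ‖(z t).1‖) (Icc 0 (T + 1)) :=
    (continuous_norm.comp continuous_fst).comp_continuousOn hz
  have huz' : ∀ t ∈ Icc 0 T, ‖(z t).1‖ ≤ M := by
    have h1 : Icc 0 T ⊆ closure (Ioo 0 T) := by rw [closure_Ioo hT.ne]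
    refine fun t ht => le_on_closure (f := fun t => ‖(z t).1‖) (g := fun _ => M) huz ?_
      continuousOn_const (h1 ht)
    rw [closure_Ioo hT.ne]
    exact hzc.mono (Icc_subset_Icc_right (by linarith))
  have hat : ContinuousAt (fun t => ‖(z t).1‖) T :=
    hzc.continuousAt (Icc_mem_nhds hT (by linarith))
  have hev : ∀ᶠ t in 𝓝 T, ‖(z t).1‖ < M + 1 :=
    hat.eventually (gt_mem_nhds (by linarith [huz' T ⟨hT.le, le_rfl⟩]))
  obtain ⟨d, hd0, hd⟩ := Metric.eventually_nhds_iff.1 hev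
  set e := min (d / 2) 1
  have he0 : 0 < e := lt_min (half_pos hd0) one_pos
  have h := isMildSolution_of_volterra ha.one_le ha.lt_two ha.subcritical hM1 ha.nonneg ha.field hz
    heq (T' := T + e) (by linarith) (by linarith [min_le_right (d / 2) 1]) fun t ht => by
      rcases le_total t T with h | h
      · exact (huz' t ⟨ht.1, h⟩).trans (by linarith)
      · refine (hd ?_).le
        rw [Real.dist_eq, abs_of_nonneg (by linarith)]
        linarith [ht.2, min_le_left (d / 2) 1]
  exact ((ENNReal.ofReal_lt_ofReal_iff (by linarith)).2 (by linarith)).trans_le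
    (IsSolution.le_maximalTime h)

theorem IsAdmissible.exists_maximal (ha : IsAdmissible p B v) (u₀ : TorusL2 N) :
    ∃ u : ℝ → TorusL2 N,
      (∀ T : ℝ, 0 < T → ENNReal.ofReal T < maximalTime p v u₀ → IsSolution p v u₀ T u) ∧
      ∀ (T : ℝ) (w : ℝ → TorusL2 N), IsSolution p v u₀ T w → EqOn w u (Ico 0 T) := by
  classical
  -- At each t the value is taken from some solution living beyond t; by uniqueness the choice is
  -- immaterial.
  set u : ℝ → TorusL2 N := fun t =>
    if h : ∃ w : ℝ → TorusL2 N, ∃ T, t < T ∧ IsSolution p v u₀ T w then h.choose t else 0 with hu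
  have huniq : ∀ (T : ℝ) (w : ℝ → TorusL2 N), IsSolution p v u₀ T w → EqOn w u (Ico 0 T) := by
    intro T w hw t ht
    have h : ∃ w : ℝ → TorusL2 N, ∃ T, t < T ∧ IsSolution p v u₀ T w := ⟨w, T, ht.2, hw⟩
    obtain ⟨T', hT', hw'⟩ := h.choose_spec
    rw [hu]
    dsimp only
    rw [dif_pos h]
    exact hw.eqOn ha hw' ⟨ht.1, le_min ht.2.le hT'.le⟩
  refine ⟨u, fun T hT hlt => ?_, huniq⟩
  obtain ⟨T', hT', w, hw⟩ := exists_isSolution_of_lt_maximalTime hT.le hlt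
  have hwu : EqOn w u (Icc 0 T) := (huniq T' w hw).mono (Icc_subset_Ico_right hT')
  exact ⟨(hw.1.mono hT hT'.le).congr hwu, (hw.2.mono hT'.le).congr hwu⟩

theorem IsAdmissible.not_bounded (ha : IsAdmissible p B v)
    (hu : ∀ T : ℝ, 0 < T → ENNReal.ofReal T < maximalTime p v u₀ → IsSolution p v u₀ T u)
    (hfin : maximalTime p v u₀ < ⊤) :
    ¬ ∃ M : ℝ, ∀ t ∈ Ico 0 (maximalTime p v u₀).toReal, ‖u t‖ ≤ M := by
  rintro ⟨M, hM⟩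
  have hpos : 0 < (maximalTime p v u₀).toReal :=
    ENNReal.toReal_pos (ha.maximalTime_pos u₀).ne' hfin.ne
  have h := ha.lt_maximalTime_of_bounded hpos (fun t h0 ht => hu t h0 ?_) hM
  · rw [ENNReal.ofReal_toReal hfin.ne] at h
    exact lt_irrefl _ h
  · exact (ENNReal.ofReal_lt_iff_lt_toReal h0.le hfin.ne).2 ht

/-- A finite limsup bounds the norm near T*, and continuity on a compact interval bounds it before;
together they contradict `IsAdmissible.not_bounded`. -/
theorem IsAdmissible.limsup_eq_top (ha : IsAdmissible p B v)
    (hu : ∀ T : ℝ, 0 < T → ENNReal.ofReal T < maximalTime p v u₀ → IsSolution p v u₀ T u)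
    (hfin : maximalTime p v u₀ < ⊤) :
    limsup (fun t => ‖u t‖ₑ) (𝓝[<] (maximalTime p v u₀).toReal) = ⊤ := by
  have hpos : 0 < (maximalTime p v u₀).toReal :=
    ENNReal.toReal_pos (ha.maximalTime_pos u₀).ne' hfin.ne
  by_contra hne
  obtain ⟨R, hR1, hR2⟩ := exists_between (lt_top_iff_ne_top.2 hne)
  have hev := eventually_lt_of_limsup_lt hR1
  obtain ⟨s, hs, hsub⟩ := (mem_nhdsLT_iff_exists_Ioo_subset' hpos).1 hev
  -- The maximum with half of T* makes s' positive, as an existence time must be.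
  set s' := max s (max 0 ((maximalTime p v u₀).toReal / 2))
  have hs'0 : 0 < s' := (half_pos hpos).trans_le ((le_max_right _ _).trans (le_max_right _ _))
  have hs'T : s' < (maximalTime p v u₀).toReal :=
    max_lt hs (max_lt hpos (half_lt_self hpos))
  have hsol := hu s' hs'0 ((ENNReal.ofReal_lt_iff_lt_toReal hs'0.le hfin.ne).2 hs'T)
  obtain ⟨M, hM⟩ := isCompact_Icc.exists_bound_of_continuousOn hsol.1.continuousOn
  refine ha.not_bounded hu hfin ⟨max M R.toReal, fun t ht => ?_⟩
  rcases le_or_gt t s' with h | h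
  · exact (hM t ⟨ht.1, h⟩).trans (le_max_left _ _)
  · have h1 : ‖u t‖ₑ < R := hsub ⟨(le_max_left _ _).trans_lt h, ht.2⟩
    refine le_trans ?_ (le_max_right _ _)
    rw [← toReal_enorm]
    exact ENNReal.toReal_mono hR2.ne h1.le

end

theorem mainTheorem4 (N : ℕ) (hN : 2 ≤ N) (p : ℝ) (hp1 : 1 ≤ p) (hp2 : p < 1 + 2 / (N : ℝ))
    (u₀ : TorusL2 N) (v : ℝ → UnitAddTorus (Fin N) → EuclideanSpace ℝ (Fin N))
    (hv : IsLInftyLq (2 / ENNReal.ofReal (p - 1)) v) :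
    0 < maximalTime p v u₀ ∧
    ∃ u : ℝ → TorusL2 N,
      -- `u` is a mild solution on `[0, T]`, in `X_T`, for every finite `T < T*`
      (∀ T : ℝ, 0 < T → ENNReal.ofReal T < maximalTime p v u₀ →
        IsMildSolution p v u₀ T u ∧ MemX T u) ∧
      -- `u` is the only mild solution
      (∀ (T : ℝ) (w : ℝ → TorusL2 N), IsMildSolution p v u₀ T w → MemX T w →
        EqOn w u (Ico 0 T)) ∧
      -- blow-up of the `L²` norm at a finite maximal time
      (maximalTime p v u₀ < ⊤ →
        limsup (fun t => ‖u t‖ₑ) (𝓝[<] (maximalTime p v u₀).toReal) = ⊤) ∧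
      -- the solution persists as long as its `L²` norm stays bounded
      ((∀ T : ℝ, 0 < T → ENNReal.ofReal T ≤ maximalTime p v u₀ →
          ∃ M : ℝ, ∀ t ∈ Ico 0 T, ‖u t‖ ≤ M) →
        maximalTime p v u₀ = ⊤) := by
  obtain ⟨B, hB, v', hv', hvv'⟩ := hv.exists_boundedField
  have hN0 : (2 : ℝ) ≤ N := by exact_mod_cast hN
  have hNp : N * (p - 1) < 2 := by
    have h1 : p - 1 < 2 / N := by linarith
    rwa [lt_div_iff₀ (by linarith), mul_comm] at h1
  -- N(p-1) < 2 gives N(p-1)/4 < 1/2 and, together with N ≥ 2, also p < 2.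
  have ha : IsAdmissible p B v' := ⟨hp1, by nlinarith, by linarith, hB, hv'⟩
  have hiff (T : ℝ) (u : ℝ → TorusL2 N) :
      IsMildSolution p v u₀ T u ↔ IsMildSolution p v' u₀ T u :=
    ⟨fun h => h.congr_field hvv', fun h => h.congr_field (hvv'.mono fun _ h => h.symm)⟩
  have hmax : maximalTime p v u₀ = maximalTime p v' u₀ := by
    simp only [maximalTime, hiff]
  simp only [hiff, hmax]
  obtain ⟨u, hu, huniq⟩ := ha.exists_maximal u₀
  refine ⟨ha.maximalTime_pos u₀, u, hu, fun T w hw hX => huniq T w ⟨hw, hX⟩,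
    ha.limsup_eq_top hu, fun h => ?_⟩
  by_contra hne
  have hfin := lt_top_iff_ne_top.2 hne
  exact ha.not_bounded hu hfin (h _ (ENNReal.toReal_pos (ha.maximalTime_pos u₀).ne' hfin.ne)
    (ENNReal.ofReal_toReal hne).le)
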